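/- **Setting.** Let $e_0,e_1,\dots$ be the standard orthonormal basis of $\ell_2(\mathbb N)$ (indices $n\ge 0$), identified with the closed span of $u^n$, $n\ge 0$, in $L_2(\mathbb S^1)$, where $u(\mathrm e^{\mathrm it})=\mathrm e^{\mathrm it}$ and arc length is normalised so that the $u^k$, $k\in\mathbb Z$, are orthonormal. Let $P$ be the orthogonal projection of $L_2(\mathbb S^1)$ onto this span, let $T_f\varphi=P(f\varphi)$ be the Toeplitz operator with symbol $f\in C(\mathbb S^1)$, let $\mathcal T\subset B(\ell_2(\mathbb N))$ be the C*-algebra generated by all $T_f$, and let $\sigma:\mathcal T\to C(\mathbb S^1)$ be the symbol map, i.e. $\sigma(a)=f$ if and only if $a-T_f$ is compact. For $g\ge 1$ let $C(\bigvee\mathbb S^1)_g$ be the algebra of all $f\in C(\mathbb S^1)$ with $$f\big(\mathrm e^{\pi\mathrm i\frac{k-1+t}{2g}}\big)=f\big(\mathrm e^{\pi\mathrm i\frac{2g+k-t}{2g}}\big),\qquad t\in[0,1],\ k=1,\dots,2g,$$ and for $g=0$ the algebra of all $f$ with $f(\mathrm e^{\pi\mathrm it})=f(\mathrm e^{-\pi\mathrm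 it})$, $t\in[0,1]$. The noncommutative surface of genus $g\ge 0$ is $C(\mathbb T_{g,q})=\{a\in\mathcal T:\sigma(a)\in C(\bigvee\mathbb S^1)_g\}$. Let $\mathcal K_S$ be the set of operators $A$ on $\ell_2(\mathbb N)$ whose matrix $a_{kn}=\langle e_k,Ae_n\rangle$ satisfies $\lim_{(k,n)\to\infty}k^\alpha|a_{kn}|n^\beta=0$ for all $\alpha,\beta\in\mathbb N_0$, and let $\mathcal A$ be the *-algebra generated by $\mathcal K_S$ and by all $T_f$ with $f\in C^\infty(\mathbb S^1)\cap C(\bigvee\mathbb S^1)_g$. Let $\mathcal H=\ell_2(\mathbb N)\oplus\ell_2(\mathbb N)$, $\pi(a)(v_+\oplus v_-)=av_+\oplus av_-$ for $a\in\mathcal A$, and $\gamma(v_+\oplus v_-)=v_+\oplus(-v_-)$. Let $S e_n=e_{n+1}$ be the shift, let $Ne_n=ne_n$ be the number operator with domain $\{\sum\alpha_ne_n:\sum n^2|\alpha_n|^2<\infty\}$, and let $$D=\begin{pmatrix}0&S^*N\\NS&0\end{pmatrix},\qquad \mathrm{dom}(D)=\mathrm{dom}(N)\oplus\mathrm{dom}(N).$$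 **Theorem.** Let $g\ge 0$. 1. $(\mathcal A,\mathcal H,D,\gamma)$ is an even spectral triple for the C*-algebra $C(\mathbb T_{g,q})$: $\mathcal A$ is a dense *-subalgebra of $C(\mathbb T_{g,q})$ that is stable under holomorphic functional calculus, $\pi$ is a faithful *-representation, $D$ is self-adjoint with compact resolvent, $\gamma=\gamma^*$, $\gamma^2=1$, $\gamma D=-D\gamma$, $\gamma\pi(a)=\pi(a)\gamma$, and, for all $a\in\mathcal A$, $\pi(a)$ preserves $\mathrm{dom}(D)$ and $[D,\pi(a)]$ extends to a bounded operator. 2. It is $1^+$-summable: $(1+|D|)^{-(1+\epsilon)}$ is trace class for all $\epsilon>0$, but $(1+|D|)^{-1}$ is not. 3. It is regular: $\pi(a)$ and $[D,\pi(a)]$ lie in the domain of every power of the derivation $[|D|,\cdot\,]$, for all $a\in\mathcal A$. 4. $\mathrm{spec}(D)=\mathbb Z$, each eigenvalue $k\in\mathbb Z$ has multiplicity $1$, and a complete orthonormal basis of eigenvectors, $Db_k=kb_k$, is given by $$b_k=\tfrac1{\sqrt2}(e_{k-1}\oplus e_k),\quad b_{-k}=\tfrac1{\sqrt2}(-e_{k-1}\oplus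 e_k)\quad(k>0),\qquad b_0=0\oplus e_0.$$ 5. The polar decomposition of $D$ is $D=F|D|$ with $F=\begin{pmatrix}0&S^*\\S&0\end{pmatrix}$ and $|D|=\begin{pmatrix}N+1&0\\0&N\end{pmatrix}$, and $(\mathcal H,F,\gamma)$ is an even Fredholm module over $\mathcal A$ (the fundamental class of $D$). The component $F_{+-}:\mathcal H_-\to\mathcal H_+$ of $F$ between the eigenspaces of $\gamma$ is Fredholm, $\mathrm{ind}(D):=\mathrm{ind}(F_{+-})=\mathrm{ind}(S^*)=1$, and the fundamental class is non-trivial: there is a projection $p$ in some matrix algebra $\mathrm{Mat}_n(\mathcal A)$ for which $\pi(p)F_{+-}\pi(p):\pi(p)\mathcal H_-^n\to\pi(p)\mathcal H_+^n$ is Fredholm with non-zero index. -/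

import Mathlib

open scoped ENNReal ContDiff InnerProductSpace Topology

noncomputable section

namespace SpectralGeometry

/-! ### Holomorphic functional calculus -/

/-- The integral of `G` along the cycle that consists of the paths `γ j`, `t ∈ [0, 1]`. -/
def cycleIntegral {E : Type*} [NormedAddCommGroup E] [NormedSpace ℂ E] {m : ℕ}
    (γ : Fin m → ℝ → ℂ) (G : ℂ → E) : E :=
  ∑ j, ∫ t in (0 : ℝ)..1, deriv (γ j) t • G (γ j t)

/-- The winding number of a cycle around `w`. -/
def cycleIndex {m : ℕ} (γ : Fin m → ℝ → ℂ) (w : ℂ) : ℂ :=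
  (2 * Real.pi * Complex.I)⁻¹ * cycleIntegral γ (fun z => (z - w)⁻¹)

/-- `γ` is a cycle of continuously differentiable loops in `U \ K` that winds once around each point
of `K` and does not wind around the points outside `U`. (The velocity may vanish, so that contours
with corners are included.) -/
structure IsCycleAround (K U : Set ℂ) {m : ℕ} (γ : Fin m → ℝ → ℂ) : Prop where
  smooth : ∀ j, ContDiffOn ℝ 1 (γ j) (Set.Icc 0 1)
  closed : ∀ j, γ j 0 = γ j 1
  mem : ∀ j, ∀ t ∈ Set.Icc (0 : ℝ) 1, γ j t ∈ U \ K
  index_inside : ∀ w ∈ K, cycleIndex γ w = 1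
  index_outside : ∀ w ∉ U, cycleIndex γ w = 0

/-- The Cauchy integral `(2πi)⁻¹ ∮ F(z) (z - a)⁻¹ dz`, which is `F(a)` if the cycle surrounds the
spectrum of `a` in the domain of `F`. -/
def cauchyCalculus {B : Type*} [NormedRing B] [NormedAlgebra ℂ B] {m : ℕ}
    (F : ℂ → ℂ) (γ : Fin m → ℝ → ℂ) (a : B) : B :=
  (2 * Real.pi * Complex.I)⁻¹ • cycleIntegral γ (fun z => F z • resolvent a z)

/-- A subset `A` of a complex Banach algebra `B` is stable under holomorphic functional calculus:
`F(a) ∈ A` for all `a ∈ A` and all `F` that are holomorphic on a neighbourhood of the spectrum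
of `a` in `B`. -/
def IsHolomorphicallyStable {B : Type*} [NormedRing B] [NormedAlgebra ℂ B] (A : Set B) : Prop :=
  ∀ a ∈ A, ∀ (U : Set ℂ) (F : ℂ → ℂ), IsOpen U → spectrum ℂ a ⊆ U → DifferentiableOn ℂ F U →
    ∀ (m : ℕ) (γ : Fin m → ℝ → ℂ), IsCycleAround (spectrum ℂ a) U γ → cauchyCalculus F γ a ∈ A

section Hilbert

variable {H : Type*} [NormedAddCommGroup H] [InnerProductSpace ℂ H] [CompleteSpace H]

/-! ### Unbounded operators -/

/-- `R` is the bounded everywhere defined inverse of `D - z`. -/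
def IsResolventAt (D : H →ₗ.[ℂ] H) (z : ℂ) (R : H →L[ℂ] H) : Prop :=
  (∀ x : H, ∃ hx : R x ∈ D.domain, D ⟨R x, hx⟩ - z • R x = x) ∧
    ∀ x : D.domain, R (D x - z • (x : H)) = x

/-- The spectrum of an unbounded operator. -/
def opSpectrum (D : H →ₗ.[ℂ] H) : Set ℂ := {z | ¬ ∃ R, IsResolventAt D z R}

/-- The space of all `x ∈ dom D` with `D x = z x`. -/
def opEigenspace (D : H →ₗ.[ℂ] H) (z : ℂ) : Submodule ℂ H :=
  (LinearMap.ker (D.toFun - z • D.domain.subtype)).map D.domain.subtype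

/-- `x` preserves the domain of `D`, and the bounded operator `y` extends the commutator
`[D, x] = D x - x D`. -/
def HasCommutator (D : H →ₗ.[ℂ] H) (x y : H →L[ℂ] H) : Prop :=
  ∀ v : D.domain, ∃ hv : x v ∈ D.domain, D ⟨x v, hv⟩ - x (D v) = y v

/-- `P = |D|`: the unique positive self-adjoint operator with the domain of `D` and
`‖P v‖ = ‖D v‖` there, that is, with `P² = D* D`. -/
structure IsAbs (D P : H →ₗ.[ℂ] H) : Prop where
  selfAdjoint : IsSelfAdjoint P
  nonneg : ∀ v : P.domain, 0 ≤ RCLike.re ⟪(v : H), P v⟫_ℂ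
  domain_eq : P.domain = D.domain
  norm_eq : ∀ (v : H) (hP : v ∈ P.domain) (hD : v ∈ D.domain), ‖P ⟨v, hP⟩‖ = ‖D ⟨v, hD⟩‖

/-- `D = F P` is the polar decomposition of `D`: `P = |D|` and `ker F = ker D`. (By `‖P v‖ = ‖D v‖`
the operator `F` is then isometric on the orthogonal complement of its kernel.) -/
structure IsPolarDecomposition (D : H →ₗ.[ℂ] H) (F : H →L[ℂ] H) (P : H →ₗ.[ℂ] H) : Prop where
  isAbs : IsAbs D P
  eq_comp : ∀ (v : H) (hP : v ∈ P.domain) (hD : v ∈ D.domain), D ⟨v, hD⟩ = F (P ⟨v, hP⟩)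
  ker_eq : ∀ v : H, F v = 0 ↔ ∃ hv : v ∈ D.domain, D ⟨v, hv⟩ = 0

/-- Trace class operators: `∑ ⟨b_i, |A| b_i⟩ < ∞` for some, equivalently every, orthonormal
basis `b`. -/
def IsTraceClass (A : H →L[ℂ] H) : Prop :=
  ∃ (s : Set H) (b : HilbertBasis s ℂ H),
    Summable fun i => RCLike.re ⟪b i, (CFC.abs A) (b i)⟫_ℂ

/-- `n⁺`-summability: `(1 + |D|)^(-(n + ε))` is trace class for all `ε > 0`, and `(1 + |D|)^(-n)`
is not. Here `R` is the bounded positive operator `(1 + |D|)⁻¹`, and its real powers are formed by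
the continuous functional calculus. -/
def IsPlusSummable (D : H →ₗ.[ℂ] H) (n : ℝ) : Prop :=
  ∃ (P : H →ₗ.[ℂ] H) (R : H →L[ℂ] H), IsAbs D P ∧ IsResolventAt P (-1) R ∧
    (∀ ε : ℝ, 0 < ε → IsTraceClass (cfc (fun t : ℝ => t ^ (n + ε)) R)) ∧
    ¬ IsTraceClass (cfc (fun t : ℝ => t ^ n) R)

/-- `x` belongs to the domain of the `n`-th power of the derivation `δ = [P, ·]`. -/
def InDomDelta (P : H →ₗ.[ℂ] H) : ℕ → (H →L[ℂ] H) → Prop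
  | 0, _ => True
  | n + 1, x => ∃ y, HasCommutator P x y ∧ InDomDelta P n y

/-! ### Even spectral triples -/

/-- `(A, H, D, γ)`, with the representation `π` of `A` on `H`, is an even spectral triple for the
C*-algebra `B`; here `A` and `B` are *-algebras of bounded operators on a Hilbert space `K`. -/
structure IsEvenSpectralTriple {K : Type*} [NormedAddCommGroup K] [InnerProductSpace ℂ K]
    [CompleteSpace K] (B A : StarSubalgebra ℂ (K →L[ℂ] K)) (π : A →⋆ₐ[ℂ] (H →L[ℂ] H))
    (D : H →ₗ.[ℂ] H) (γ : H →L[ℂ] H) : Prop where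
  isClosed : IsClosed (B : Set (K →L[ℂ] K))
  le : A ≤ B
  dense : (B : Set (K →L[ℂ] K)) ⊆ closure (A : Set (K →L[ℂ] K))
  stable : IsHolomorphicallyStable {b : B | (b : K →L[ℂ] K) ∈ A}
  faithful : Function.Injective π
  selfAdjoint : IsSelfAdjoint D
  exists_resolvent : ∃ z R, IsResolventAt D z R
  compact_resolvent : ∀ z R, IsResolventAt D z R → IsCompactOperator R
  grading_selfAdjoint : IsSelfAdjoint γ
  grading_sq : γ * γ = 1
  grading_dirac : ∀ v : D.domain, ∃ hv : γ v ∈ D.domain, γ (D v) = -D ⟨γ v, hv⟩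
  grading_rep : ∀ a, γ * π a = π a * γ
  commutator : ∀ a, ∃ y, HasCommutator D (π a) y

/-- Regularity: `π a` and `[D, π a]` are in the domains of all powers of `δ = [|D|, ·]`. -/
def IsRegular {A : Type*} (π : A → (H →L[ℂ] H)) (D : H →ₗ.[ℂ] H) : Prop :=
  ∃ P, IsAbs D P ∧ ∀ a, (∀ n, InDomDelta P n (π a)) ∧
    ∃ y, HasCommutator D (π a) y ∧ ∀ n, InDomDelta P n y

/-! ### Fredholm modules and index pairings -/

/-- `(H, F, γ)` is an even Fredholm module over the algebra represented by `π`. -/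
structure IsEvenFredholmModule {A : Type*} (π : A → (H →L[ℂ] H)) (F γ : H →L[ℂ] H) : Prop where
  grading_selfAdjoint : IsSelfAdjoint γ
  grading_sq : γ * γ = 1
  grading_rep : ∀ a, γ * π a = π a * γ
  odd : γ * F = -(F * γ)
  selfAdjoint : IsCompactOperator (star F - F : H →L[ℂ] H)
  sq : IsCompactOperator (F * F - 1 : H →L[ℂ] H)
  commutator : ∀ a, IsCompactOperator (F * π a - π a * F : H →L[ℂ] H)

end Hilbert

section Index

/-- `T` restricts to a map `X → Y` with finite-dimensional kernel and cokernel. -/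
structure IsFredholmBetween {E : Type*} [AddCommGroup E] [Module ℂ E]
    (T : E →ₗ[ℂ] E) (X Y : Submodule ℂ E) : Prop where
  mapsTo : ∀ x ∈ X, T x ∈ Y
  finite_ker : FiniteDimensional ℂ ↥(X ⊓ LinearMap.ker T)
  finite_coker : FiniteDimensional ℂ (Y ⧸ (X.map T).submoduleOf Y)

/-- The index `dim ker - dim coker` of the restriction `X → Y` of `T`. -/
def indexBetween {E : Type*} [AddCommGroup E] [Module ℂ E]
    (T : E →ₗ[ℂ] E) (X Y : Submodule ℂ E) : ℤ :=
  (Module.finrank ℂ ↥(X ⊓ LinearMap.ker T) : ℤ) -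
    (Module.finrank ℂ (Y ⧸ (X.map T).submoduleOf Y) : ℤ)

variable {H : Type*} [NormedAddCommGroup H] [InnerProductSpace ℂ H]

/-- The `s`-eigenspace of the grading; `H₊` for `s = 1`, `H₋` for `s = -1`. -/
def gradedPart (γ : H →L[ℂ] H) (s : ℂ) : Submodule ℂ H :=
  Module.End.eigenspace (γ : H →ₗ[ℂ] H) s

/-- The operator on `Hⁿ` given by a matrix of operators. -/
def matrixOp {n : ℕ} (q : Matrix (Fin n) (Fin n) (H →L[ℂ] H)) :
    (Fin n → H) →ₗ[ℂ] (Fin n → H) :=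
  LinearMap.pi fun i => ∑ j, ((q i j : H →L[ℂ] H) : H →ₗ[ℂ] H).comp (LinearMap.proj j)

/-- The subspace `q (H_s)ⁿ` of `Hⁿ`, for a projection `q` that commutes with the grading. -/
def gradedRange {n : ℕ} (γ : H →L[ℂ] H) (s : ℂ) (q : Matrix (Fin n) (Fin n) (H →L[ℂ] H)) :
    Submodule ℂ (Fin n → H) :=
  (Submodule.pi Set.univ fun _ => gradedPart γ s).map (matrixOp q)

/-- The operator `q F q` on `Hⁿ`. -/
def compression {n : ℕ} (F : H →L[ℂ] H) (q : Matrix (Fin n) (Fin n) (H →L[ℂ] H)) :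
    (Fin n → H) →ₗ[ℂ] (Fin n → H) :=
  (matrixOp q).comp ((matrixOp (Matrix.diagonal fun _ => F)).comp (matrixOp q))

variable [CompleteSpace H]

/-- The fundamental class of `D`, i.e. the even Fredholm module of the phase `F` of `D`, gives rise
to a non-trivial index pairing: for some projection `p` in a matrix algebra over `A`, the operator
`π(p) F₊₋ π(p) : π(p) H₋ⁿ → π(p) H₊ⁿ` is Fredholm with non-zero index. -/
def HasNontrivialFundamentalClass {A : Type*} [Ring A] [StarRing A] [Algebra ℂ A]
    (π : A →⋆ₐ[ℂ] (H →L[ℂ] H)) (D : H →ₗ.[ℂ] H) (γ : H →L[ℂ] H) : Prop :=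
  ∃ F P, IsPolarDecomposition D F P ∧ IsEvenFredholmModule π F γ ∧
    ∃ (n : ℕ) (p : Matrix (Fin n) (Fin n) A), p * p = p ∧ p.conjTranspose = p ∧
      IsFredholmBetween (compression F (p.map π))
        (gradedRange γ (-1) (p.map π)) (gradedRange γ 1 (p.map π)) ∧
      indexBetween (compression F (p.map π))
        (gradedRange γ (-1) (p.map π)) (gradedRange γ 1 (p.map π)) ≠ 0

end Index

end SpectralGeometry

namespace QuantumSurface

/-- The circle, parametrised by the angle. -/
abbrev Circ : Type := AddCircle (2 * Real.pi)

instance twoPiPos : Fact (0 < 2 * Real.pi) := ⟨Real.two_pi_pos⟩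

/-- `L₂` of the circle (with normalised arc length, so that the `uᵏ` are orthonormal). -/
abbrev L2Circ : Type := MeasureTheory.Lp ℂ 2 (AddCircle.haarAddCircle (T := 2 * Real.pi))

/-- `ℓ₂(ℕ)`, with the indices `0, 1, 2, …`. -/
abbrev Ell2 : Type := lp (fun _ : ℕ => ℂ) 2

/-- The standard basis vector `e_n`. -/
def e (n : ℕ) : Ell2 := lp.single 2 n 1

theorem e_apply (n k : ℕ) : (e n) k = if k = n then 1 else 0 := by
  simp [e, lp.single_apply, Pi.single_apply]

theorem inner_e_left (n : ℕ) (x : Ell2) : ⟪e n, x⟫_ℂ = x n := by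
  simp [e, lp.inner_single_left]

theorem hasSum_e (x : Ell2) : HasSum (fun n => x n • e n) x := by
  have h := lp.hasSum_single (p := 2) (by simp) x
  have h2 : (fun n => x n • e n) = fun n => lp.single 2 n (x n) := by
    funext n
    rw [e, ← lp.single_smul]; simp
  rw [h2]; exact h

theorem orthonormal_e : Orthonormal ℂ e := by
  rw [orthonormal_iff_ite]
  intro i j
  rw [inner_e_left, e_apply]

/-- The isometry of `ℓ₂(ℕ)` that sends `e_n` to `v n`. -/
def isometryOf {E : Type*} [NormedAddCommGroup E] [InnerProductSpace ℂ E] [CompleteSpace E]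
    {v : ℕ → E} (hv : Orthonormal ℂ v) : Ell2 →ₗᵢ[ℂ] E :=
  hv.orthogonalFamily.linearIsometry

theorem isometryOf_e {E : Type*} [NormedAddCommGroup E] [InnerProductSpace ℂ E] [CompleteSpace E]
    {v : ℕ → E} (hv : Orthonormal ℂ v) (n : ℕ) : isometryOf hv (e n) = v n := by
  simp [isometryOf, e]

theorem orthonormal_hardy : Orthonormal ℂ
    (fun n : ℕ => fourierLp (T := 2 * Real.pi) 2 (n : ℤ)) :=
  orthonormal_fourier.comp _ Nat.cast_injective

/-- The embedding of `ℓ₂(ℕ)` as the closed span of the `uⁿ`, `n ≥ 0`, in `L₂` of the circle. -/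
def hardy : Ell2 →L[ℂ] L2Circ := (isometryOf orthonormal_hardy).toContinuousLinearMap

theorem hardy_e (n : ℕ) : hardy (e n) = fourierLp 2 (n : ℤ) :=
  isometryOf_e orthonormal_hardy n

/-- The multiplication operators on `L₂` of the circle. -/
def mulOpL : C(Circ, ℂ) →L[ℂ] (L2Circ →L[ℂ] L2Circ) :=
  ((ContinuousLinearMap.mul ℂ ℂ).holderL AddCircle.haarAddCircle ∞ 2 2).comp
    (ContinuousMap.toLp ∞ AddCircle.haarAddCircle ℂ)

theorem mulOpL_coeFn (f : C(Circ, ℂ)) (φ : L2Circ) :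
    (mulOpL f φ : Circ → ℂ) =ᵐ[AddCircle.haarAddCircle] fun x => f x * φ x := by
  have h := ContinuousLinearMap.coeFn_holder (r := 2) (ContinuousLinearMap.mul ℂ ℂ)
    (ContinuousMap.toLp ∞ AddCircle.haarAddCircle ℂ f) φ
  have h2 := ContinuousMap.coeFn_toLp (p := ∞) AddCircle.haarAddCircle (𝕜 := ℂ) f
  filter_upwards [h, h2] with x hx hx2
  refine hx.trans ?_
  rw [hx2]
  simp

def mulOp : C(Circ, ℂ) →⋆ₐ[ℂ] (L2Circ →L[ℂ] L2Circ) where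
  toFun := mulOpL
  map_one' := by
    ext1 φ
    apply MeasureTheory.Lp.ext
    filter_upwards [mulOpL_coeFn 1 φ] with x hx
    rw [hx]; simp
  map_mul' f g := by
    ext1 φ
    apply MeasureTheory.Lp.ext
    filter_upwards [mulOpL_coeFn (f * g) φ, mulOpL_coeFn f (mulOpL g φ), mulOpL_coeFn g φ]
      with x hx hx1 hx2
    rw [hx]
    change _ = (mulOpL f (mulOpL g φ)) x
    rw [hx1, hx2]; simp [mul_assoc]
  map_zero' := map_zero _
  map_add' := map_add _
  commutes' c := by
    ext1 φ
    apply MeasureTheory.Lp.ext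
    have h : (algebraMap ℂ (L2Circ →L[ℂ] L2Circ) c) φ = c • φ := rfl
    filter_upwards [mulOpL_coeFn (algebraMap ℂ C(Circ, ℂ) c) φ, MeasureTheory.Lp.coeFn_smul c φ]
      with x hx h2
    rw [hx, h, h2]; simp
  map_star' f := by
    rw [ContinuousLinearMap.star_eq_adjoint, ContinuousLinearMap.eq_adjoint_iff]
    intro φ ψ
    rw [MeasureTheory.L2.inner_def, MeasureTheory.L2.inner_def]
    apply MeasureTheory.integral_congr_ae
    filter_upwards [mulOpL_coeFn (star f) φ, mulOpL_coeFn f ψ] with x hx hx2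
    rw [hx, hx2]
    simp
    ring

theorem mulOp_coeFn (f : C(Circ, ℂ)) (φ : L2Circ) :
    (mulOp f φ : Circ → ℂ) =ᵐ[AddCircle.haarAddCircle] fun x => f x * φ x := mulOpL_coeFn f φ

theorem mulOp_fourier (m k : ℤ) :
    mulOp (fourier m) (fourierLp 2 k) = fourierLp 2 (m + k) := by
  apply MeasureTheory.Lp.ext
  filter_upwards [mulOp_coeFn (fourier m) (fourierLp 2 k), coeFn_fourierLp (T := 2 * Real.pi) 2 k,
    coeFn_fourierLp (T := 2 * Real.pi) 2 (m + k)] with x h1 h2 h3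
  rw [h1, h2, h3, fourier_add]

theorem norm_mulOp (f : C(Circ, ℂ)) : ‖mulOp f‖ = ‖f‖ := by
  refine NonUnitalStarAlgHom.norm_map mulOp ?_ f
  rw [injective_iff_map_eq_zero]
  intro f hf
  have h : ContinuousMap.toLp 2 AddCircle.haarAddCircle ℂ f = 0 := by
    have h0 : mulOp f (fourierLp 2 0) = 0 := by rw [hf]; rfl
    apply MeasureTheory.Lp.ext
    rw [← h0]
    filter_upwards [mulOp_coeFn f (fourierLp 2 0), coeFn_fourierLp (T := 2 * Real.pi) 2 0,
      ContinuousMap.coeFn_toLp (p := 2) AddCircle.haarAddCircle (𝕜 := ℂ) f] with x h1 h2 h3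
    rw [h1, h2, h3]; simp
  exact ContinuousMap.toLp_injective AddCircle.haarAddCircle (h.trans (map_zero _).symm)

/-- The Toeplitz operator with symbol `f`: compression of the multiplication by `f` to `ℓ₂(ℕ)`. -/
def T (f : C(Circ, ℂ)) : Ell2 →L[ℂ] Ell2 :=
  (ContinuousLinearMap.adjoint hardy).comp ((mulOp f).comp hardy)

theorem hardy_adjoint_hardy (x : Ell2) : ContinuousLinearMap.adjoint hardy (hardy x) = x := by
  apply ext_inner_left ℂ
  intro y
  rw [ContinuousLinearMap.adjoint_inner_right]
  exact (isometryOf orthonormal_hardy).inner_map_map y x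

theorem hardy_adjoint_fourier (k : ℤ) (hk : k < 0) :
    ContinuousLinearMap.adjoint hardy (fourierLp 2 k) = 0 := by
  ext n
  rw [← inner_e_left, ContinuousLinearMap.adjoint_inner_right, hardy_e,
    orthonormal_fourier.inner_eq_zero (by omega)]
  rfl

theorem T_add (f g : C(Circ, ℂ)) : T (f + g) = T f + T g := by
  ext1 x; simp [T]

theorem T_smul (c : ℂ) (f : C(Circ, ℂ)) : T (c • f) = c • T f := by
  ext1 x; simp [T]

theorem T_sub (f g : C(Circ, ℂ)) : T (f - g) = T f - T g := by
  ext1 x; simp [T]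

theorem T_one : T 1 = 1 := by
  ext1 x
  simp [T, hardy_adjoint_hardy]

theorem T_star (f : C(Circ, ℂ)) : T (star f) = star (T f) := by
  rw [ContinuousLinearMap.star_eq_adjoint, ContinuousLinearMap.eq_adjoint_iff]
  intro x y
  simp [T, ContinuousLinearMap.adjoint_inner_left, ContinuousLinearMap.adjoint_inner_right,
    map_star, ContinuousLinearMap.star_eq_adjoint]

theorem norm_hardy_le : ‖hardy‖ ≤ 1 := (isometryOf orthonormal_hardy).norm_toContinuousLinearMap_le

theorem norm_T_le (f : C(Circ, ℂ)) : ‖T f‖ ≤ ‖f‖ := by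
  have h1 := ContinuousLinearMap.opNorm_comp_le (ContinuousLinearMap.adjoint hardy)
    ((mulOp f).comp hardy)
  have h2 := ContinuousLinearMap.opNorm_comp_le (mulOp f) hardy
  have h3 : ‖ContinuousLinearMap.adjoint hardy‖ ≤ 1 := by
    rw [LinearIsometryEquiv.norm_map]; exact norm_hardy_le
  have h4 := norm_hardy_le
  rw [norm_mulOp] at h2
  change ‖(ContinuousLinearMap.adjoint hardy).comp ((mulOp f).comp hardy)‖ ≤ ‖f‖
  have h5 : ‖(mulOp f).comp hardy‖ ≤ ‖f‖ := h2.trans (mul_le_of_le_one_right (norm_nonneg _) h4)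
  exact h1.trans ((mul_le_of_le_one_left (norm_nonneg _) h3).trans h5)

theorem continuous_T : Continuous T := by
  have h : LipschitzWith 1 T := LipschitzWith.of_dist_le_mul fun f g => by
    rw [dist_eq_norm, dist_eq_norm, ← T_sub]; simpa using norm_T_le (f - g)
  exact h.continuous

theorem isCompactOperator_of_e {E : Type*} [NormedAddCommGroup E] [NormedSpace ℂ E]
    (X : Ell2 →L[ℂ] E) (m : ℕ) (h : ∀ n, m ≤ n → X (e n) = 0) : IsCompactOperator X := by
  have h2 : X = ∑ n ∈ Finset.range m, (innerSL ℂ (e n)).smulRight (X (e n)) := by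
    ext1 x
    have h3 := (hasSum_e x).mapL X
    have h4 : HasSum (fun n => X (x n • e n)) (∑ n ∈ Finset.range m, X (x n • e n)) := by
      apply hasSum_sum_of_ne_finset_zero
      intro n hn
      rw [map_smul, h n (by simpa using hn), smul_zero]
    rw [h3.unique h4]
    simp [inner_e_left]
  rw [h2]
  have h5 : ∀ n, IsCompactOperator ((innerSL ℂ (e n)).smulRight (X (e n))) := fun n => by
    have h6 : IsCompactOperator (innerSL ℂ (e n) : Ell2 →L[ℂ] ℂ) :=
      isCompactOperator_of_locallyCompactSpace_dom (innerSL ℂ (e n) : Ell2 →L[ℂ] ℂ)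
    have h7 : IsCompactOperator (ContinuousLinearMap.toSpanSingleton ℂ (X (e n)) ∘ innerSL ℂ (e n)) :=
      h6.clm_comp _
    exact h7
  induction Finset.range m using Finset.induction_on with
  | empty => simpa using isCompactOperator_zero
  | insert a s ha ih =>
    rw [Finset.sum_insert ha]
    exact (h5 a).add ih

/-- The compression of `f` from the Hardy space to its complement. -/
def hankel (f : C(Circ, ℂ)) : Ell2 →L[ℂ] L2Circ :=
  (1 - hardy.comp (ContinuousLinearMap.adjoint hardy)).comp ((mulOp f).comp hardy)

theorem isCompactOperator_hankel (f : C(Circ, ℂ)) : IsCompactOperator (hankel f) := by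
  have hc : IsClosed {f : C(Circ, ℂ) | IsCompactOperator (hankel f)} := by
    have h1 : Continuous hankel := by
      unfold hankel
      exact ((ContinuousLinearMap.compL ℂ Ell2 L2Circ L2Circ _).continuous).comp
        (((ContinuousLinearMap.compL ℂ Ell2 L2Circ L2Circ).flip hardy).continuous.comp
          mulOpL.continuous)
    exact isClosed_setOfPred_isCompactOperator.preimage h1
  have hs : (Submodule.span ℂ (Set.range (fourier (T := 2 * Real.pi))) : Set C(Circ, ℂ)) ⊆
      {f : C(Circ, ℂ) | IsCompactOperator (hankel f)} := by
    intro f hf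
    induction hf using Submodule.span_induction with
    | mem x hx =>
      obtain ⟨k, rfl⟩ := hx
      apply isCompactOperator_of_e _ k.natAbs
      intro n hn
      obtain ⟨j, hj⟩ := Int.eq_ofNat_of_zero_le (show 0 ≤ k + n by omega)
      simp only [hankel, ContinuousLinearMap.comp_apply, hardy_e, mulOp_fourier,
        sub_apply, one_apply_eq_self]
      rw [hj]
      rw [← hardy_e, hardy_adjoint_hardy, sub_self]
    | zero =>
      have : hankel 0 = 0 := by ext1 x; simp [hankel]
      change IsCompactOperator (hankel 0)
      rw [this]; exact isCompactOperator_zero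
    | add x y _ _ hx hy =>
      have : hankel (x + y) = hankel x + hankel y := by ext1 v; simp [hankel]
      change IsCompactOperator (hankel (x + y))
      rw [this]; exact hx.add hy
    | smul c x _ hx =>
      have : hankel (c • x) = c • hankel x := by ext1 v; simp [hankel, smul_sub]
      change IsCompactOperator (hankel (c • x))
      rw [this]; exact hx.smul c
  have h3 := hc.closure_subset_iff.2 hs
  rw [← Submodule.topologicalClosure_coe, span_fourier_closure_eq_top] at h3
  exact h3 (Set.mem_univ f)

theorem T_mul_sub (f g : C(Circ, ℂ)) : IsCompactOperator (T (f * g) - T f * T g) := by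
  have h : T (f * g) - T f * T g =
      ((ContinuousLinearMap.adjoint hardy).comp (mulOp f)).comp (hankel g) := by
    ext1 x
    simp [T, hankel]
  rw [h]
  exact IsCompactOperator.clm_comp (σ₂₃ := RingHom.id ℂ) (isCompactOperator_hankel g)
    ((ContinuousLinearMap.adjoint hardy).comp (mulOp f))

theorem isCompactOperator_adjoint {E F : Type*} [NormedAddCommGroup E] [InnerProductSpace ℂ E]
    [CompleteSpace E] [NormedAddCommGroup F] [InnerProductSpace ℂ F] [CompleteSpace F]
    (K : E →L[ℂ] F) (hK : IsCompactOperator K) :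
    IsCompactOperator (ContinuousLinearMap.adjoint K) := by
  set K' := ContinuousLinearMap.adjoint K with hK'
  have h1 : IsCompactOperator (K.comp K') := hK.comp_clm K'
  have h2 := IsCompactOperator.isCompact_closure_image_closedBall (𝕜₁ := ℂ) (𝕜₂ := ℂ) (σ₁₂ := RingHom.id ℂ)
    (f := (K.comp K').toLinearMap) h1 1
  have h3 := h2.totallyBounded.subset subset_closure
  refine (isCompactOperator_iff_isCompact_closure_image_closedBall K'.toLinearMap one_pos).2 ?_
  refine isCompact_iff_totallyBounded_isComplete.2
    ⟨TotallyBounded.closure ?_, isClosed_closure.isComplete⟩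
  rw [Metric.totallyBounded_iff]
  intro ε hε
  obtain ⟨t, hts, htf, htc⟩ := Metric.finite_approx_of_totallyBounded h3 (ε ^ 2 / 4) (by positivity)
  have hts' : ∀ y ∈ t, ∃ x ∈ Metric.closedBall (0 : F) 1, K (K' x) = y := fun y hy => hts hy
  choose! c hc hc2 using hts'
  refine ⟨(fun y => K' (c y)) '' t, htf.image _, ?_⟩
  rintro _ ⟨x, hx, rfl⟩
  have h4 := htc ⟨x, hx, rfl⟩
  simp only [Set.mem_iUnion, Metric.mem_ball, exists_prop] at h4
  obtain ⟨y, hy, hxy⟩ := h4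
  simp only [Set.mem_iUnion, Metric.mem_ball, exists_prop, Set.exists_mem_image]
  refine ⟨y, hy, ?_⟩
  have h5 : ‖K' (x - c y)‖ ^ 2 ≤ ‖K (K' (x - c y))‖ * ‖x - c y‖ := by
    have h6 : ‖K' (x - c y)‖ ^ 2 = RCLike.re ⟪K (K' (x - c y)), x - c y⟫_ℂ := by
      rw [← ContinuousLinearMap.adjoint_inner_right, ← hK', inner_self_eq_norm_sq]
    rw [h6]
    exact (RCLike.re_le_norm _).trans (norm_inner_le_norm _ _)
  have h7 : ‖K (K' (x - c y))‖ < ε ^ 2 / 4 := by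
    rw [← hc2 y hy, dist_eq_norm] at hxy
    simpa [map_sub] using hxy
  have h8 : ‖x - c y‖ ≤ 2 := by
    have := norm_sub_le x (c y)
    have h9 : ‖x‖ ≤ 1 := by simpa using hx
    have h10 : ‖c y‖ ≤ 1 := by simpa using hc y hy
    linarith
  rw [dist_eq_norm]
  change ‖K' x - K' (c y)‖ < ε
  rw [← map_sub]
  have h11 : ‖K (K' (x - c y))‖ * ‖x - c y‖ ≤ (ε ^ 2 / 4) * 2 :=
    mul_le_mul h7.le h8 (norm_nonneg _) (by positivity)
  refine lt_of_pow_lt_pow_left₀ 2 hε.le ?_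
  nlinarith [pow_pos hε 2]

theorem tendsto_compact_e (K : Ell2 →L[ℂ] Ell2) (hK : IsCompactOperator K) :
    Filter.Tendsto (fun n => K (e n)) Filter.atTop (𝓝 0) := by
  have h1 := hK.isCompact_closure_image_closedBall (f := K.toLinearMap) 1
  have h0 : ∀ n, ‖e n‖ = 1 := orthonormal_e.1
  have hmem : ∀ n, K (e n) ∈ closure (K.toLinearMap '' Metric.closedBall 0 1) := fun n =>
    subset_closure ⟨e n, by simp [h0], rfl⟩
  apply Filter.tendsto_of_subseq_tendsto
  intro ns hns
  obtain ⟨y, -, φ, hφ, hy⟩ := h1.tendsto_subseq (fun n => hmem (ns n))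
  refine ⟨φ, ?_⟩
  suffices y = 0 by rw [← this]; exact hy
  ext k
  have h2 : Filter.Tendsto (fun n => ⟪e k, K (e (ns (φ n)))⟫_ℂ) Filter.atTop (𝓝 ⟪e k, y⟫_ℂ) :=
    tendsto_const_nhds.inner hy
  have h3 : Filter.Tendsto (fun n => ⟪ContinuousLinearMap.adjoint K (e k), e n⟫_ℂ)
      Filter.atTop (𝓝 0) := by
    have h4 := orthonormal_e.inner_products_summable (ContinuousLinearMap.adjoint K (e k))
    have h5 := h4.tendsto_atTop_zero
    rw [tendsto_zero_iff_norm_tendsto_zero]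
    have h6 := (Real.continuous_sqrt.tendsto 0).comp h5
    simp only [Real.sqrt_zero] at h6
    refine h6.congr fun n => ?_
    simp [norm_inner_symm]
  have h7 := h3.comp (hns.comp hφ.tendsto_atTop)
  have h8 : (⟪e k, y⟫_ℂ) = 0 := by
    refine tendsto_nhds_unique h2 (h7.congr fun n => ?_)
    simp [ContinuousLinearMap.adjoint_inner_left]
  rw [← inner_e_left, h8]; rfl

/-- Multiplication by `uⁿ`. -/
def mulU (n : ℕ) : L2Circ →L[ℂ] L2Circ := mulOp (fourier (n : ℤ))

theorem mulOp_mulU (f : C(Circ, ℂ)) (n : ℕ) (ξ : L2Circ) :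
    mulOp f (mulU n ξ) = mulU n (mulOp f ξ) := by
  have h : mulOp f * mulU n = mulU n * mulOp f := by
    have h1 := map_mul mulOp f (fourier (n : ℤ))
    have h2 := map_mul mulOp (fourier (n : ℤ)) f
    exact h1.symm.trans ((congrArg mulOp (mul_comm _ _)).trans h2)
  exact congrArg (fun A : L2Circ →L[ℂ] L2Circ => A ξ) h

theorem inner_mulU (n : ℕ) (ξ η : L2Circ) : ⟪mulU n ξ, mulU n η⟫_ℂ = ⟪ξ, η⟫_ℂ := by
  have h0 : star (fourier (T := 2 * Real.pi) (n : ℤ)) * fourier (n : ℤ) = 1 := by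
    ext x
    have h := fourier_neg (T := 2 * Real.pi) (n := n) (x := x)
    have h2 := fourier_add (T := 2 * Real.pi) (m := -(n : ℤ)) (n := n) (x := x)
    rw [h] at h2
    refine h2.symm.trans ?_
    simp
  have h1 : star (mulU n) * mulU n = 1 := by
    have h2 := map_mul mulOp (star (fourier (T := 2 * Real.pi) (n : ℤ))) (fourier (n : ℤ))
    rw [h0, map_one, map_star] at h2
    exact h2.symm
  rw [← ContinuousLinearMap.adjoint_inner_right, ← ContinuousLinearMap.star_eq_adjoint]
  exact congrArg (fun A : L2Circ →L[ℂ] L2Circ => ⟪ξ, A η⟫_ℂ) h1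

theorem norm_mulU (n : ℕ) (ξ : L2Circ) : ‖mulU n ξ‖ = ‖ξ‖ := by
  rw [@norm_eq_sqrt_re_inner ℂ, inner_mulU, ← @norm_eq_sqrt_re_inner ℂ]

theorem mulU_fourier (n : ℕ) (k : ℤ) : mulU n (fourierLp 2 k) = fourierLp 2 (n + k) :=
  mulOp_fourier n k

/-- The span of the `uᵏ`. -/
def trigSpan : Submodule ℂ L2Circ := Submodule.span ℂ (Set.range (fourierLp (T := 2 * Real.pi) 2))

theorem adjoint_mulU_eventually {ξ : L2Circ} (hξ : ξ ∈ trigSpan) : ∀ᶠ n in Filter.atTop,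
    hardy (ContinuousLinearMap.adjoint hardy (mulU n ξ)) = mulU n ξ := by
  induction hξ using Submodule.span_induction with
  | mem x hx =>
    obtain ⟨k, rfl⟩ := hx
    filter_upwards [Filter.eventually_ge_atTop k.natAbs] with n hn
    obtain ⟨j, hj⟩ := Int.eq_ofNat_of_zero_le (show 0 ≤ (n : ℤ) + k by omega)
    rw [mulU_fourier, hj, ← hardy_e, hardy_adjoint_hardy]
  | zero => simp
  | add x y _ _ hx hy =>
    filter_upwards [hx, hy] with n h1 h2
    simp only [map_add, h1, h2]
  | smul c x _ hx =>
    filter_upwards [hx] with n h1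
    simp only [map_smul, h1]

theorem compact_mulU_tendsto (K : Ell2 →L[ℂ] Ell2) (hK : IsCompactOperator K) {ξ : L2Circ}
    (hξ : ξ ∈ trigSpan) : Filter.Tendsto
      (fun n => K (ContinuousLinearMap.adjoint hardy (mulU n ξ))) Filter.atTop (𝓝 0) := by
  induction hξ using Submodule.span_induction with
  | mem x hx =>
    obtain ⟨k, rfl⟩ := hx
    have h1 := tendsto_compact_e K hK
    have h2 : Filter.Tendsto (fun n : ℕ => ((n : ℤ) + k).toNat) Filter.atTop Filter.atTop := by
      rw [Filter.tendsto_atTop]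
      intro b
      filter_upwards [Filter.eventually_ge_atTop (b + k.natAbs)] with n hn
      omega
    refine (h1.comp h2).congr' ?_
    filter_upwards [Filter.eventually_ge_atTop k.natAbs] with n hn
    obtain ⟨j, hj⟩ := Int.eq_ofNat_of_zero_le (show 0 ≤ (n : ℤ) + k by omega)
    rw [mulU_fourier, hj, ← hardy_e, hardy_adjoint_hardy, Function.comp_apply, hj]
    rfl
  | zero => simp
  | add x y _ _ hx hy =>
    simpa only [map_add, add_zero] using hx.add hy
  | smul c x _ hx =>
    simpa only [map_smul, smul_zero] using hx.const_smul c

theorem norm_hardy_adjoint_le (v : L2Circ) : ‖ContinuousLinearMap.adjoint hardy v‖ ≤ ‖v‖ := by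
  have h3 : ‖ContinuousLinearMap.adjoint hardy‖ ≤ 1 := by
    rw [LinearIsometryEquiv.norm_map]; exact norm_hardy_le
  exact ((ContinuousLinearMap.adjoint hardy).le_of_opNorm_le h3 v).trans (one_mul _).le

theorem norm_inner_mulOp_le (a : Ell2 →L[ℂ] Ell2) (f : C(Circ, ℂ))
    (h : IsCompactOperator (a - T f)) {ξ η : L2Circ} (hξ : ξ ∈ trigSpan) (hη : η ∈ trigSpan) :
    ‖⟪η, mulOp f ξ⟫_ℂ‖ ≤ ‖a‖ * ‖ξ‖ * ‖η‖ := by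
  have h1 : Filter.Tendsto
      (fun n => ‖a‖ * ‖ξ‖ * ‖η‖ +
        ‖(a - T f) (ContinuousLinearMap.adjoint hardy (mulU n ξ))‖ * ‖η‖) Filter.atTop
      (𝓝 (‖a‖ * ‖ξ‖ * ‖η‖ + ‖(0 : Ell2)‖ * ‖η‖)) :=
    tendsto_const_nhds.add ((compact_mulU_tendsto _ h hξ).norm.mul_const _)
  rw [norm_zero, zero_mul, add_zero] at h1
  refine ge_of_tendsto h1 ?_
  filter_upwards [adjoint_mulU_eventually hξ, adjoint_mulU_eventually hη] with n h2 h3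
  set p := ContinuousLinearMap.adjoint hardy (mulU n ξ) with hp
  set q := ContinuousLinearMap.adjoint hardy (mulU n η) with hq
  have h4 : ⟪η, mulOp f ξ⟫_ℂ = ⟪q, T f p⟫_ℂ := by
    rw [T, ContinuousLinearMap.comp_apply, ContinuousLinearMap.adjoint_inner_right, h3,
      ContinuousLinearMap.comp_apply, h2, mulOp_mulU, inner_mulU]
  have h5 : T f p = a p - (a - T f) p := by simp
  have hη' : ‖q‖ ≤ ‖η‖ := (norm_hardy_adjoint_le _).trans (norm_mulU n η).le
  have hξ' : ‖p‖ ≤ ‖ξ‖ := (norm_hardy_adjoint_le _).trans (norm_mulU n ξ).le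
  rw [h4, h5, inner_sub_right]
  refine (norm_sub_le _ _).trans (add_le_add ?_ ?_)
  · refine (norm_inner_le_norm _ _).trans ?_
    rw [mul_comm]
    exact mul_le_mul (a.le_of_opNorm_le_of_le le_rfl hξ') hη' (norm_nonneg _) (by positivity)
  · refine (norm_inner_le_norm _ _).trans ?_
    rw [mul_comm]
    exact mul_le_mul_of_nonneg_left hη' (norm_nonneg _)

/-- The norm of a Toeplitz operator plus a compact one is at least that of the symbol. -/
theorem norm_symbol_le (a : Ell2 →L[ℂ] Ell2) (f : C(Circ, ℂ)) (h : IsCompactOperator (a - T f)) :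
    ‖f‖ ≤ ‖a‖ := by
  have hdense : Dense (trigSpan : Set L2Circ) := by
    rw [Submodule.dense_iff_topologicalClosure_eq_top]
    exact span_fourierLp_closure_eq_top (by simp)
  have key2 : ∀ ξ η, ‖⟪η, mulOp f ξ⟫_ℂ‖ ≤ ‖a‖ * ‖ξ‖ * ‖η‖ := by
    intro ξ η
    have h1 : ∀ η ∈ trigSpan, ‖⟪η, mulOp f ξ⟫_ℂ‖ ≤ ‖a‖ * ‖ξ‖ * ‖η‖ := fun η hη =>
      hdense.induction (P := fun ξ => ‖⟪η, mulOp f ξ⟫_ℂ‖ ≤ ‖a‖ * ‖ξ‖ * ‖η‖)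
        (fun ξ hξ => norm_inner_mulOp_le a f h hξ hη)
        (isClosed_le (by fun_prop) (by fun_prop)) ξ
    exact hdense.induction (P := fun η => ‖⟪η, mulOp f ξ⟫_ℂ‖ ≤ ‖a‖ * ‖ξ‖ * ‖η‖) h1
      (isClosed_le (by fun_prop) (by fun_prop)) η
  rw [← norm_mulOp]
  refine ContinuousLinearMap.opNorm_le_bound _ (norm_nonneg _) fun ξ => ?_
  by_cases h0 : mulOp f ξ = 0
  · rw [h0, norm_zero]; positivity
  have h1 := key2 ξ (mulOp f ξ)
  rw [inner_self_eq_norm_sq_to_K] at h1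
  have h2 : 0 < ‖mulOp f ξ‖ := norm_pos_iff.2 h0
  have h3 : ‖mulOp f ξ‖ * ‖mulOp f ξ‖ ≤ (‖a‖ * ‖ξ‖) * ‖mulOp f ξ‖ := by
    simpa [sq] using h1
  exact le_of_mul_le_mul_right h3 h2

/-- The operators of the form Toeplitz plus compact. -/
def toeplitzPlusCompact : StarSubalgebra ℂ (Ell2 →L[ℂ] Ell2) where
  carrier := {a | ∃ f, IsCompactOperator (a - T f)}
  mul_mem' := by
    rintro a b ⟨f, hf⟩ ⟨g, hg⟩
    refine ⟨f * g, ?_⟩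
    have h : a * b - T (f * g) = (a - T f).comp b + (T f).comp (b - T g)
        - (T (f * g) - T f * T g) := by
      ext1 x; simp
    rw [h]
    exact ((hf.comp_clm b).add (hg.clm_comp (T f))).sub (T_mul_sub f g)
  add_mem' := by
    rintro a b ⟨f, hf⟩ ⟨g, hg⟩
    refine ⟨f + g, ?_⟩
    have h : a + b - T (f + g) = (a - T f) + (b - T g) := by rw [T_add]; abel
    rw [h]
    exact hf.add hg
  algebraMap_mem' c := by
    refine ⟨c • 1, ?_⟩
    have h : algebraMap ℂ (Ell2 →L[ℂ] Ell2) c - T (c • 1) = 0 := by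
      rw [T_smul, T_one, Algebra.algebraMap_eq_smul_one, sub_self]
    rw [h]
    exact isCompactOperator_zero
  star_mem' := by
    rintro a ⟨f, hf⟩
    refine ⟨star f, ?_⟩
    have h : star a - T (star f) = ContinuousLinearMap.adjoint (a - T f) := by
      rw [T_star, ← star_sub, ContinuousLinearMap.star_eq_adjoint]
    rw [h]
    exact isCompactOperator_adjoint _ hf

theorem isClosed_toeplitzPlusCompact :
    IsClosed (toeplitzPlusCompact : Set (Ell2 →L[ℂ] Ell2)) := by
  rw [← isSeqClosed_iff_isClosed]
  intro a l ha hl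
  choose f hf using ha
  have hcau : CauchySeq f := by
    rw [Metric.cauchySeq_iff]
    intro ε hε
    obtain ⟨N, hN⟩ := Metric.cauchySeq_iff.1 hl.cauchySeq ε hε
    refine ⟨N, fun m hm n hn => lt_of_le_of_lt ?_ (hN m hm n hn)⟩
    rw [dist_eq_norm, dist_eq_norm]
    apply norm_symbol_le
    rw [T_sub, sub_sub_sub_comm]
    exact (hf m).sub (hf n)
  obtain ⟨g, hg⟩ := cauchySeq_tendsto_of_complete hcau
  refine ⟨g, isCompactOperator_of_tendsto (hl.sub ((continuous_T.tendsto g).comp hg))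
    (Filter.Eventually.of_forall hf)⟩

/-- The Toeplitz algebra: the C*-algebra generated by the Toeplitz operators. -/
def toeplitzAlgebra : StarSubalgebra ℂ (Ell2 →L[ℂ] Ell2) :=
  (StarAlgebra.adjoin ℂ (Set.range T)).topologicalClosure

theorem toeplitzAlgebra_le : toeplitzAlgebra ≤ toeplitzPlusCompact := by
  refine StarSubalgebra.topologicalClosure_minimal ?_ isClosed_toeplitzPlusCompact
  rw [StarAlgebra.adjoin_le_iff]
  rintro _ ⟨f, rfl⟩
  exact ⟨f, by rw [sub_self]; exact isCompactOperator_zero⟩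

theorem symbol_unique {a : Ell2 →L[ℂ] Ell2} {f g : C(Circ, ℂ)} (hf : IsCompactOperator (a - T f))
    (hg : IsCompactOperator (a - T g)) : f = g := by
  have h : IsCompactOperator ((0 : Ell2 →L[ℂ] Ell2) - T (f - g)) := by
    have : (0 : Ell2 →L[ℂ] Ell2) - T (f - g) = (a - T f) - (a - T g) := by rw [T_sub]; abel
    rw [this]; exact hf.sub hg
  have h2 := norm_symbol_le 0 (f - g) h
  rw [norm_zero] at h2
  exact sub_eq_zero.1 (norm_le_zero_iff.1 h2)

theorem exists_symbol (a : toeplitzAlgebra) :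
    ∃ f, IsCompactOperator ((a : Ell2 →L[ℂ] Ell2) - T f) :=
  toeplitzAlgebra_le a.2

theorem choose_symbol_eq (a : toeplitzAlgebra) {g : C(Circ, ℂ)}
    (hg : IsCompactOperator ((a : Ell2 →L[ℂ] Ell2) - T g)) : (exists_symbol a).choose = g :=
  symbol_unique (exists_symbol a).choose_spec hg

/-- The symbol map `σ` of the Toeplitz algebra: `σ a` is the continuous function on the circle
whose Toeplitz operator differs from `a` by a compact operator, so that `σ (T f) = f` and
`ker σ` consists of compact operators. -/
def symbol : toeplitzAlgebra →⋆ₐ[ℂ] C(Circ, ℂ) where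
  toFun a := (exists_symbol a).choose
  map_one' := choose_symbol_eq _ (by
    have : ((1 : toeplitzAlgebra) : Ell2 →L[ℂ] Ell2) - T 1 = 0 := by rw [T_one]; exact sub_self _
    rw [this]; exact isCompactOperator_zero)
  map_zero' := choose_symbol_eq _ (by
    have : ((0 : toeplitzAlgebra) : Ell2 →L[ℂ] Ell2) - T 0 = 0 := by ext1 x; simp [T]
    rw [this]; exact isCompactOperator_zero)
  map_mul' a b := choose_symbol_eq _ (by
    have hf := (exists_symbol a).choose_spec
    have hg := (exists_symbol b).choose_spec
    set f := (exists_symbol a).choose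
    set g := (exists_symbol b).choose
    have h : ((a * b : toeplitzAlgebra) : Ell2 →L[ℂ] Ell2) - T (f * g) =
        ((a : Ell2 →L[ℂ] Ell2) - T f).comp (b : Ell2 →L[ℂ] Ell2) +
        (T f).comp ((b : Ell2 →L[ℂ] Ell2) - T g) - (T (f * g) - T f * T g) := by
      ext1 x; simp
    rw [h]
    exact ((hf.comp_clm _).add (hg.clm_comp (T f))).sub (T_mul_sub f g))
  map_add' a b := choose_symbol_eq _ (by
    have hf := (exists_symbol a).choose_spec
    have hg := (exists_symbol b).choose_spec
    set f := (exists_symbol a).choose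
    set g := (exists_symbol b).choose
    have h : ((a + b : toeplitzAlgebra) : Ell2 →L[ℂ] Ell2) - T (f + g) =
        ((a : Ell2 →L[ℂ] Ell2) - T f) + ((b : Ell2 →L[ℂ] Ell2) - T g) := by
      rw [T_add]; exact add_sub_add_comm _ _ _ _
    rw [h]
    exact hf.add hg)
  commutes' c := choose_symbol_eq _ (by
    have h : ((algebraMap ℂ toeplitzAlgebra c : toeplitzAlgebra) : Ell2 →L[ℂ] Ell2) -
        T (algebraMap ℂ C(Circ, ℂ) c) = 0 := by
      rw [Algebra.algebraMap_eq_smul_one (A := C(Circ, ℂ)), T_smul, T_one, sub_eq_zero]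
      exact Algebra.algebraMap_eq_smul_one (A := Ell2 →L[ℂ] Ell2) c
    rw [h]; exact isCompactOperator_zero)
  map_star' a := choose_symbol_eq _ (by
    have hf := (exists_symbol a).choose_spec
    set f := (exists_symbol a).choose
    have h : ((star a : toeplitzAlgebra) : Ell2 →L[ℂ] Ell2) - T (star f) =
        ContinuousLinearMap.adjoint ((a : Ell2 →L[ℂ] Ell2) - T f) := by
      rw [T_star, ← ContinuousLinearMap.star_eq_adjoint, star_sub]; rfl
    rw [h]
    exact isCompactOperator_adjoint _ hf)

theorem symbol_eq_iff (a : toeplitzAlgebra) (f : C(Circ, ℂ)) :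
    symbol a = f ↔ IsCompactOperator ((a : Ell2 →L[ℂ] Ell2) - T f) :=
  ⟨fun h => h ▸ (exists_symbol a).choose_spec, fun h => choose_symbol_eq a h⟩

/-! ### The noncommutative surfaces -/

/-- `f` takes the same values at identified points of the circle. For `g ≥ 1` the points
`exp(πi (k - 1 + t) / 2g)` and `exp(πi (2g + k - t) / 2g)`, `k = 1, …, 2g`, `t ∈ [0, 1]`, are
identified; for `g = 0` the points `exp(πi t)` and `exp(-πi t)`. -/
def Respects (g : ℕ) (f : C(Circ, ℂ)) : Prop :=
  (g = 0 → ∀ t ∈ Set.Icc (0 : ℝ) 1,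
    f ((Real.pi * t : ℝ) : Circ) = f ((-(Real.pi * t) : ℝ) : Circ)) ∧
  (1 ≤ g → ∀ k : ℕ, 1 ≤ k → k ≤ 2 * g → ∀ t ∈ Set.Icc (0 : ℝ) 1,
    f ((Real.pi * ((k - 1 + t) / (2 * g)) : ℝ) : Circ) =
      f ((Real.pi * ((2 * g + k - t) / (2 * g)) : ℝ) : Circ))

/-- The continuous functions on the boundary circle that respect the identifications. -/
def boundaryAlgebra (g : ℕ) : StarSubalgebra ℂ C(Circ, ℂ) where
  carrier := {f | Respects g f}
  mul_mem' := by
    rintro a b ⟨ha, ha'⟩ ⟨hb, hb'⟩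
    refine ⟨fun h t ht => ?_, fun h k h1 h2 t ht => ?_⟩
    · rw [ContinuousMap.mul_apply, ContinuousMap.mul_apply, ha h t ht, hb h t ht]
    · rw [ContinuousMap.mul_apply, ContinuousMap.mul_apply, ha' h k h1 h2 t ht,
        hb' h k h1 h2 t ht]
  add_mem' := by
    rintro a b ⟨ha, ha'⟩ ⟨hb, hb'⟩
    refine ⟨fun h t ht => ?_, fun h k h1 h2 t ht => ?_⟩
    · rw [ContinuousMap.add_apply, ContinuousMap.add_apply, ha h t ht, hb h t ht]
    · rw [ContinuousMap.add_apply, ContinuousMap.add_apply, ha' h k h1 h2 t ht,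
        hb' h k h1 h2 t ht]
  algebraMap_mem' c := ⟨fun _ _ _ => rfl, fun _ _ _ _ _ _ => rfl⟩
  star_mem' := by
    rintro a ⟨ha, ha'⟩
    refine ⟨fun h t ht => ?_, fun h k h1 h2 t ht => ?_⟩
    · rw [ContinuousMap.star_apply, ContinuousMap.star_apply, ha h t ht]
    · rw [ContinuousMap.star_apply, ContinuousMap.star_apply, ha' h k h1 h2 t ht]

/-- The C*-algebra `C(𝕋_{g,q})`: the elements of the Toeplitz algebra whose symbol respects the
identifications. -/
def surface (g : ℕ) : StarSubalgebra ℂ (Ell2 →L[ℂ] Ell2) :=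
  ((boundaryAlgebra g).comap symbol).map toeplitzAlgebra.subtype

/-- The operators whose matrix `a_{kn} = (a e_n)_k` is of rapid decay. -/
def IsRapidDecay (a : Ell2 →L[ℂ] Ell2) : Prop :=
  ∀ α β : ℕ, Filter.Tendsto
    (fun p : ℕ × ℕ => (p.1 : ℝ) ^ α * ‖(a (e p.2)) p.1‖ * (p.2 : ℝ) ^ β) Filter.cofinite (𝓝 0)

/-- Smooth functions on the circle, as smooth `2π`-periodic functions of the angle. -/
def IsSmooth (f : C(Circ, ℂ)) : Prop := ContDiff ℝ ∞ (fun t : ℝ => f (t : Circ))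

/-- The *-algebra `𝒜` generated by the matrices of rapid decay and by the Toeplitz operators in
`C(𝕋_{g,q})` with smooth symbol. -/
def smoothAlgebra (g : ℕ) : StarSubalgebra ℂ (Ell2 →L[ℂ] Ell2) :=
  StarAlgebra.adjoin ℂ
    ({a | IsRapidDecay a} ∪ {a | ∃ f, IsSmooth f ∧ f ∈ boundaryAlgebra g ∧ a = T f})

/-! ### Hilbert space, representation, grading and Dirac operator -/

/-- `H = ℓ₂(ℕ) ⊕ ℓ₂(ℕ)`. -/
abbrev Hil : Type := WithLp 2 (Ell2 × Ell2)

/-- The vector `v ⊕ w`. -/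
def vec (v w : Ell2) : Hil := WithLp.toLp 2 (v, w)

/-- The operator on `H` with the block matrix `[[a, b], [c, d]]`. -/
def block (a b c d : Ell2 →L[ℂ] Ell2) : Hil →L[ℂ] Hil :=
  ((WithLp.prodContinuousLinearEquiv 2 ℂ Ell2 Ell2).symm : (Ell2 × Ell2) →L[ℂ] Hil).comp
    ((a.comp (WithLp.fstL 2 ℂ Ell2 Ell2) + b.comp (WithLp.sndL 2 ℂ Ell2 Ell2)).prod
      (c.comp (WithLp.fstL 2 ℂ Ell2 Ell2) + d.comp (WithLp.sndL 2 ℂ Ell2 Ell2)))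

theorem block_apply (a b c d : Ell2 →L[ℂ] Ell2) (x : Hil) :
    block a b c d x = vec (a x.fst + b x.snd) (c x.fst + d x.snd) := rfl

/-- The diagonal representation `a ↦ a ⊕ a`. -/
def diagRep : (Ell2 →L[ℂ] Ell2) →⋆ₐ[ℂ] (Hil →L[ℂ] Hil) where
  toFun a := block a 0 0 a
  map_one' := by
    ext1 x
    simp [block_apply, vec]
    rfl
  map_mul' a b := by
    ext1 x
    simp [block_apply, vec]
  map_zero' := by
    ext1 x
    simp [block_apply, vec]
  map_add' a b := by
    ext1 x
    simp [block_apply, vec, ← WithLp.toLp_add]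
  commutes' c := by
    ext1 x
    simp [block_apply, vec, Algebra.algebraMap_eq_smul_one]
    rfl
  map_star' a := by
    refine (ContinuousLinearMap.eq_adjoint_iff _ _).2 fun x y => ?_
    simp [block_apply, vec, WithLp.prod_inner_apply, ContinuousLinearMap.star_eq_adjoint,
      ContinuousLinearMap.adjoint_inner_left]

/-- The representation `π` of `𝒜` on `H`. -/
def rep (g : ℕ) : smoothAlgebra g →⋆ₐ[ℂ] (Hil →L[ℂ] Hil) :=
  diagRep.comp (smoothAlgebra g).subtype

/-- The grading `γ (v ⊕ w) = v ⊕ (-w)`. -/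
def grading : Hil →L[ℂ] Hil := block 1 0 0 (-1)

theorem orthonormal_e_succ : Orthonormal ℂ (fun n => e (n + 1)) :=
  orthonormal_e.comp _ (add_left_injective 1)

/-- The shift `S e_n = e_{n+1}`. -/
def S : Ell2 →L[ℂ] Ell2 := (isometryOf orthonormal_e_succ).toContinuousLinearMap

/-- The adjoint of the shift. -/
def Sadj : Ell2 →L[ℂ] Ell2 := ContinuousLinearMap.adjoint S

theorem S_e (n : ℕ) : S (e n) = e (n + 1) := isometryOf_e orthonormal_e_succ n

theorem Sadj_apply (x : Ell2) (n : ℕ) : (Sadj x) n = x (n + 1) := by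
  rw [← inner_e_left, Sadj, ContinuousLinearMap.adjoint_inner_right, S_e, inner_e_left]

theorem S_apply_succ (x : Ell2) (n : ℕ) : (S x) (n + 1) = x n := by
  rw [← inner_e_left, ← S_e, ← inner_e_left]
  exact (isometryOf orthonormal_e_succ).inner_map_map (e n) x

theorem S_apply_zero (x : Ell2) : (S x) 0 = 0 := by
  have h : Sadj (e 0) = 0 := by
    ext n
    rw [Sadj_apply, e_apply]
    simp
  rw [← inner_e_left, ← ContinuousLinearMap.adjoint_inner_left]
  change ⟪Sadj (e 0), x⟫_ℂ = 0
  rw [h, inner_zero_left]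

/-- The number operator `N e_n = n e_n`, on the domain of all `x ∈ ℓ₂(ℕ)` for which `(n x_n)` is
again square-summable. -/
def number : Ell2 →ₗ.[ℂ] Ell2 where
  domain :=
    { carrier := {x | Memℓp (fun n : ℕ => (n : ℂ) * x n) 2}
      add_mem' := by
        intro x y hx hy
        have h := hx.add hy
        have h2 : (fun n : ℕ => (n : ℂ) * (x + y) n) =
            (fun n : ℕ => (n : ℂ) * x n) + fun n : ℕ => (n : ℂ) * y n := by
          funext n; simp [mul_add]
        change Memℓp (fun n : ℕ => (n : ℂ) * (x + y) n) 2
        rw [h2]; exact h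
      zero_mem' := by
        change Memℓp (fun n : ℕ => (n : ℂ) * (0 : Ell2) n) 2
        have h2 : (fun n : ℕ => (n : ℂ) * (0 : Ell2) n) = 0 := by funext n; simp
        rw [h2]; exact zero_memℓp
      smul_mem' := by
        intro c x hx
        have h := hx.const_smul c
        have h2 : (fun n : ℕ => (n : ℂ) * (c • x) n) = c • fun n : ℕ => (n : ℂ) * x n := by
          funext n; simp [mul_left_comm]
        change Memℓp (fun n : ℕ => (n : ℂ) * (c • x) n) 2
        rw [h2]; exact h }
  toFun :=
    { toFun := fun x => ⟨fun n : ℕ => (n : ℂ) * (x : Ell2) n, x.2⟩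
      map_add' := by
        intro x y; ext n
        exact mul_add _ _ _
      map_smul' := by
        intro c x; ext n
        exact mul_left_comm _ _ _ }

theorem mem_number_iff (x : Ell2) :
    x ∈ number.domain ↔ Summable fun n : ℕ => (n : ℝ) ^ 2 * ‖x n‖ ^ 2 := by
  change Memℓp (fun n : ℕ => (n : ℂ) * x n) 2 ↔ _
  rw [memℓp_gen_iff (by simp)]
  simp [mul_pow]

theorem number_apply (x : number.domain) (n : ℕ) : (number x) n = n * (x : Ell2) n := rfl

theorem S_mem_number {x : Ell2} (hx : x ∈ number.domain) : S x ∈ number.domain := by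
  rw [mem_number_iff] at hx ⊢
  rw [← summable_nat_add_iff 1]
  have h0 : Summable fun n : ℕ => ‖x n‖ ^ 2 := by
    simpa using (memℓp_gen_iff (p := 2) (by simp)).1 (lp.memℓp x)
  refine Summable.of_nonneg_of_le (fun n => by positivity) (fun n => ?_)
    ((hx.mul_left 2).add (h0.mul_left 2))
  rw [S_apply_succ]
  push_cast
  nlinarith [mul_nonneg (sq_nonneg ((n : ℝ) - 1)) (sq_nonneg ‖x n‖)]

/-- `dom N ⊕ dom N`. -/
def numberDomain : Submodule ℂ Hil :=
  number.domain.comap (WithLp.fstₗ 2 ℂ Ell2 Ell2) ⊓ number.domain.comap (WithLp.sndₗ 2 ℂ Ell2 Ell2)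

/-- The Dirac operator `D = [[0, S* N], [N S, 0]]` on `dom N ⊕ dom N`. -/
def dirac : Hil →ₗ.[ℂ] Hil where
  domain := numberDomain
  toFun :=
    { toFun := fun x => vec (Sadj (number ⟨(x : Hil).snd, x.2.2⟩))
        (number ⟨S (x : Hil).fst, S_mem_number x.2.1⟩)
      map_add' := by
        intro x y
        have h1 : number ⟨((x + y : numberDomain) : Hil).snd, (x + y).2.2⟩ =
            number ⟨(x : Hil).snd, x.2.2⟩ + number ⟨(y : Hil).snd, y.2.2⟩ := by
          rw [← LinearPMap.map_add]; rfl
        have h2 : number ⟨S ((x + y : numberDomain) : Hil).fst, S_mem_number (x + y).2.1⟩ =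
            number ⟨S (x : Hil).fst, S_mem_number x.2.1⟩ +
              number ⟨S (y : Hil).fst, S_mem_number y.2.1⟩ := by
          rw [← LinearPMap.map_add]
          congr 1
          exact Subtype.ext (map_add S _ _)
        rw [h1, h2, map_add]
        rfl
      map_smul' := by
        intro c x
        have h1 : number ⟨((c • x : numberDomain) : Hil).snd, (c • x).2.2⟩ =
            c • number ⟨(x : Hil).snd, x.2.2⟩ := by
          rw [← LinearPMap.map_smul]; rfl
        have h2 : number ⟨S ((c • x : numberDomain) : Hil).fst, S_mem_number (c • x).2.1⟩ =
            c • number ⟨S (x : Hil).fst, S_mem_number x.2.1⟩ := by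
          rw [← LinearPMap.map_smul]
          congr 1
          exact Subtype.ext (map_smul S _ _)
        rw [h1, h2, map_smul]
        rfl }

/-- The operator `[[N + 1, 0], [0, N]]` on `dom N ⊕ dom N`. -/
def absDirac : Hil →ₗ.[ℂ] Hil where
  domain := numberDomain
  toFun :=
    { toFun := fun x => vec (number ⟨(x : Hil).fst, x.2.1⟩ + (x : Hil).fst)
        (number ⟨(x : Hil).snd, x.2.2⟩)
      map_add' := by
        intro x y
        have h1 : number ⟨((x + y : numberDomain) : Hil).fst, (x + y).2.1⟩ =
            number ⟨(x : Hil).fst, x.2.1⟩ + number ⟨(y : Hil).fst, y.2.1⟩ := by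
          rw [← LinearPMap.map_add]; rfl
        have h2 : number ⟨((x + y : numberDomain) : Hil).snd, (x + y).2.2⟩ =
            number ⟨(x : Hil).snd, x.2.2⟩ + number ⟨(y : Hil).snd, y.2.2⟩ := by
          rw [← LinearPMap.map_add]; rfl
        rw [h1, h2]
        change vec (_ + ((x : Hil).fst + (y : Hil).fst)) _ = _
        rw [add_add_add_comm]
        rfl
      map_smul' := by
        intro c x
        have h1 : number ⟨((c • x : numberDomain) : Hil).fst, (c • x).2.1⟩ =
            c • number ⟨(x : Hil).fst, x.2.1⟩ := by
          rw [← LinearPMap.map_smul]; rfl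
        have h2 : number ⟨((c • x : numberDomain) : Hil).snd, (c • x).2.2⟩ =
            c • number ⟨(x : Hil).snd, x.2.2⟩ := by
          rw [← LinearPMap.map_smul]; rfl
        rw [h1, h2]
        change vec (_ + c • (x : Hil).fst) _ = _
        rw [← smul_add]
        rfl }

/-- The operator `[[0, S*], [S, 0]]`. -/
def phase : Hil →L[ℂ] Hil := block 0 Sadj S 0

/-- The vectors `b_k = (e_{k-1} ⊕ e_k) / √2` and `b_{-k} = (-e_{k-1} ⊕ e_k) / √2`, for `k > 0`, and
`b_0 = 0 ⊕ e_0`. -/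
def eigenvec : ℤ → Hil
  | .ofNat 0 => vec 0 (e 0)
  | .ofNat (m + 1) => ((Real.sqrt 2)⁻¹ : ℂ) • vec (e m) (e (m + 1))
  | .negSucc m => ((Real.sqrt 2)⁻¹ : ℂ) • vec (-e m) (e (m + 1))

end QuantumSurface
end

/-!
Throughout, operators on `ℓ₂(ℕ)` are studied through their matrices `(a e_j)_i`.

*The algebra.* For a *-algebra `B` of continuous functions let `smoothToeplitz B` be the set of all
`T f + k` with `f ∈ B` smooth and `k` of rapid decay. The matrix of `T f` is `f̂(i - j)`, which
decays rapidly off the diagonal if `f` is smooth, and the entries `∑ f̂(i + m) ĝ(-m - j)`, `m ≥ 1`,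
of the semi-commutator `T (f g) - T f T g` decay rapidly in `i` and `j`. Hence `smoothToeplitz B` is
a *-algebra and coincides with `𝒜` for `B` the boundary algebra (`smoothAlgebra_eq`); the symbols
commute, so that commutators in it are of rapid decay (`rapid_commutator`).

*Holomorphic functional calculus.* If `r = (z - f)⁻¹`, then `T r` inverts `z - a`, `a = T f + k`, up
to remainders of rapid decay on either side, and the resolvent `R` of `a` is
`T r + m' T r + m' R m`, with remainders `m`, `m'`. A bounded operator between two operators of rapid
decay again gives rapid decay, so `R - T r` decays rapidly, with bounds that are uniform along a
compact path (`rapidFam_resolvent_sub`). Fourier coefficients and matrix entries being continuous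
functionals, these bounds pass to the Cauchy integral (`isHolomorphicallyStable_smoothToeplitz`).

*Density.* A compact operator is the limit of its finite corners, and smooth functions are dense in
the boundary algebra by the Stone–Weierstrass theorem on the quotient space, whose points are
separated by `cos` for `g = 0`, and for `g ≥ 1` by bump functions on an edge and its partner and
their products with a sine; all end points of edges are one point of the quotient
(`boundaryAlgebra_subset_closure`).

*The Dirac operator.* The vectors `b_k` form a Hilbert basis in which `D` and `|D|` are the maximal
diagonal operators with entries `k` and `|k|` (`isDiagonal_dirac`, `isDiagonal_absDirac`).
Self-adjointness, the spectrum, the compactness of resolvents and the summability are then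
statements on diagonal operators. The derivation `[N, ·]` preserves the algebra, since `[N, T f]`
is the Toeplitz operator of `-i f'`, and `[S, a] N` and `[S*, a] N` are bounded because `[S, a]` and
`[S*, a]` decay rapidly. This makes `[D, π a]` a bounded block matrix with entries in
`smoothToeplitz ⊤`, and such matrices are preserved by `[|D|, ·]` (`hasCommutator_absDirac`).

*The index.* `F` maps `H₋` onto `H₊` with kernel spanned by `b_0`, so the pairing of the
fundamental class with the projection `p = 1` is `1`.
-/

noncomputable section

namespace QuantumSurface

open Filter

/-! ### Matrices of rapid decay -/

theorem ext_coef {a b : Ell2 →L[ℂ] Ell2} (h : ∀ i j, (a (e j)) i = (b (e j)) i) : a = b := by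
  ext1 x
  have h1 := (hasSum_e x).mapL a
  have h2 := (hasSum_e x).mapL b
  have h3 : ∀ j, a (e j) = b (e j) := fun j => lp.ext (funext fun i => h i j)
  refine h1.unique ?_
  convert h2 using 2 with n
  rw [map_smul, map_smul, h3]

theorem hasSum_apply (a : Ell2 →L[ℂ] Ell2) (x : Ell2) (i : ℕ) :
    HasSum (fun m => x m * (a (e m)) i) ((a x) i) := by
  have h := ((hasSum_e x).mapL a).mapL (innerSL ℂ (e i))
  simpa [inner_e_left] using h

theorem coef_star (a : Ell2 →L[ℂ] Ell2) (i j : ℕ) :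
    (star a (e j)) i = star ((a (e i)) j) := by
  rw [← inner_e_left, ← inner_e_left, ContinuousLinearMap.star_eq_adjoint,
    ContinuousLinearMap.adjoint_inner_right]
  exact (inner_conj_symm _ _).symm

theorem norm_apply_le (x : Ell2) (i : ℕ) : ‖x i‖ ≤ ‖x‖ := lp.norm_apply_le_norm (by simp) x i

theorem norm_e (n : ℕ) : ‖e n‖ = 1 := orthonormal_e.1 n

theorem summable_one_add_sq : Summable fun m : ℕ => ((1 + m : ℝ) ^ 2)⁻¹ := by
  have h := (summable_nat_add_iff 1).2 (Real.summable_nat_pow_inv.2 (show 1 < 2 by norm_num))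
  refine h.congr fun m => ?_
  push_cast
  rw [add_comm]

/-- The matrices of a family of operators decay rapidly, with bounds that are uniform over the
family. -/
def RapidFam {ι : Type*} (x : ι → (Ell2 →L[ℂ] Ell2)) : Prop :=
  ∀ α : ℕ, ∃ C : ℝ, ∀ s i j, ‖(x s (e j)) i‖ * ((1 + i : ℝ) ^ α * (1 + j : ℝ) ^ α) ≤ C

/-- The matrices of a family of operators decay rapidly off the diagonal, with bounds that are
uniform over the family. -/
def BandFam {ι : Type*} (x : ι → (Ell2 →L[ℂ] Ell2)) : Prop :=
  ∀ α : ℕ, ∃ C : ℝ, ∀ s i j, ‖(x s (e j)) i‖ * (1 + |(i : ℝ) - j|) ^ α ≤ C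

section Families

variable {ι : Type*} {x y a b : ι → (Ell2 →L[ℂ] Ell2)}

theorem RapidFam.add (hx : RapidFam x) (hy : RapidFam y) : RapidFam fun s => x s + y s := by
  intro α
  obtain ⟨C, hC⟩ := hx α
  obtain ⟨C', hC'⟩ := hy α
  refine ⟨C + C', fun s i j => ?_⟩
  refine le_trans ?_ (add_le_add (hC s i j) (hC' s i j))
  rw [← add_mul]
  gcongr
  exact norm_add_le _ _

theorem RapidFam.neg (hx : RapidFam x) : RapidFam fun s => -x s := by
  intro α
  obtain ⟨C, hC⟩ := hx α
  refine ⟨C, fun s i j => ?_⟩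
  convert hC s i j using 2
  exact norm_neg ((x s (e j)) i)

theorem RapidFam.sub (hx : RapidFam x) (hy : RapidFam y) : RapidFam fun s => x s - y s := by
  simpa only [sub_eq_add_neg] using hx.add hy.neg

theorem RapidFam.starFam (hx : RapidFam x) : RapidFam fun s => star (x s) := by
  intro α
  obtain ⟨C, hC⟩ := hx α
  refine ⟨C, fun s i j => ?_⟩
  have h := hC s j i
  rw [coef_star, norm_star, mul_comm ((1 + i : ℝ) ^ α)]
  exact h

theorem BandFam.starFam (hx : BandFam x) : BandFam fun s => star (x s) := by
  intro α
  obtain ⟨C, hC⟩ := hx α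
  refine ⟨C, fun s i j => ?_⟩
  have h := hC s j i
  rw [coef_star, norm_star, abs_sub_comm]
  exact h

theorem RapidFam.bandFam (hx : RapidFam x) : BandFam x := by
  intro α
  obtain ⟨C, hC⟩ := hx α
  refine ⟨C, fun s i j => le_trans ?_ (hC s i j)⟩
  rw [← mul_pow]
  gcongr
  have hi : (0 : ℝ) ≤ i := Nat.cast_nonneg i
  have hj : (0 : ℝ) ≤ j := Nat.cast_nonneg j
  have h : |(i : ℝ) - j| ≤ i + j := abs_le.2 ⟨by linarith, by linarith⟩
  nlinarith [mul_nonneg hi hj]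

/-- Rapid decay absorbs rapid decay off the diagonal. -/
theorem RapidFam.mul_bandFam (hx : RapidFam x) (ha : BandFam a) :
    RapidFam fun s => x s * a s := by
  intro α
  obtain ⟨C, hC⟩ := hx (α + 2)
  obtain ⟨C', hC'⟩ := ha α
  refine ⟨C * C' * ∑' m : ℕ, ((1 + m : ℝ) ^ 2)⁻¹, fun s i j => ?_⟩
  have h := hasSum_apply (x s) (a s (e j)) i
  -- the weight of the column index `j` is split over the factors by `1 + j ≤ (1 + m)(1 + |m - j|)`
  have hb : ∀ m : ℕ, ‖(a s (e j)) m * (x s (e m)) i‖ * ((1 + i : ℝ) ^ α * (1 + j : ℝ) ^ α) ≤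
      C * C' * ((1 + m : ℝ) ^ 2)⁻¹ := by
    intro m
    have h1 : (1 + j : ℝ) ^ α ≤ (1 + m : ℝ) ^ α * (1 + |(m : ℝ) - j|) ^ α := by
      rw [← mul_pow]
      gcongr
      have hm : (0 : ℝ) ≤ m := Nat.cast_nonneg m
      nlinarith [mul_nonneg hm (abs_nonneg ((m : ℝ) - j)), neg_abs_le ((m : ℝ) - j)]
    have h2 : (1 + i : ℝ) ^ α ≤ (1 + i : ℝ) ^ (α + 2) :=
      pow_le_pow_right₀ (by simp) (by omega)
    have h3 := mul_le_mul (hC s i m) (hC' s m j) (by positivity)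
      (le_trans (by positivity) (hC s i m))
    have h5 : (0 : ℝ) < (1 + m : ℝ) ^ 2 := by positivity
    rw [norm_mul, ← div_eq_mul_inv, le_div_iff₀ h5]
    refine le_trans ?_ h3
    calc ‖(a s (e j)) m‖ * ‖(x s (e m)) i‖ * ((1 + i : ℝ) ^ α * (1 + j : ℝ) ^ α) * (1 + m : ℝ) ^ 2
        ≤ ‖(a s (e j)) m‖ * ‖(x s (e m)) i‖ * ((1 + i : ℝ) ^ (α + 2) *
          ((1 + m : ℝ) ^ α * (1 + |(m : ℝ) - j|) ^ α)) * (1 + m : ℝ) ^ 2 := by gcongr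
      _ = _ := by ring
  have hw : (0 : ℝ) < (1 + i : ℝ) ^ α * (1 + j : ℝ) ^ α := by positivity
  rw [← le_div_iff₀ hw, ← tsum_mul_left, ← tsum_div_const]
  refine h.norm_le_of_bounded ((summable_one_add_sq.mul_left (C * C')).div_const _).hasSum
    fun m => ?_
  rw [le_div_iff₀ hw]
  exact hb m

theorem RapidFam.bandFam_mul (hx : RapidFam x) (ha : BandFam a) :
    RapidFam fun s => a s * x s := by
  simpa using (hx.starFam.mul_bandFam ha.starFam).starFam

theorem RapidFam.exists_norm_apply_e_le (hx : RapidFam x) (α : ℕ) :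
    ∃ C : ℝ, ∀ s j, ‖x s (e j)‖ * (1 + j : ℝ) ^ α ≤ C := by
  obtain ⟨C, hC⟩ := hx (α + 2)
  refine ⟨C * ∑' m : ℕ, ((1 + m : ℝ) ^ 2)⁻¹, fun s j => ?_⟩
  have hw : (0 : ℝ) < (1 + j : ℝ) ^ α := by positivity
  rw [← le_div_iff₀ hw, ← tsum_mul_left, ← tsum_div_const]
  refine (hasSum_e (x s (e j))).norm_le_of_bounded
    ((summable_one_add_sq.mul_left C).div_const _).hasSum fun m => ?_
  rw [norm_smul, norm_e, mul_one, le_div_iff₀ hw, ← div_eq_mul_inv, le_div_iff₀ (by positivity)]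
  refine le_trans ?_ (hC s m j)
  have h1 : (1 + j : ℝ) ^ α ≤ (1 + j : ℝ) ^ (α + 2) := pow_le_pow_right₀ (by simp) (by omega)
  have h2 : (1 + m : ℝ) ^ 2 ≤ (1 + m : ℝ) ^ (α + 2) := pow_le_pow_right₀ (by simp) (by omega)
  calc ‖(x s (e j)) m‖ * (1 + j : ℝ) ^ α * (1 + m : ℝ) ^ 2
      ≤ ‖(x s (e j)) m‖ * (1 + j : ℝ) ^ (α + 2) * (1 + m : ℝ) ^ (α + 2) := by gcongr
    _ = _ := by ring

/-- An arbitrary bounded operator may stand between two rapidly decaying ones. -/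
theorem RapidFam.mul_bounded_mul (hx : RapidFam x) (hy : RapidFam y) {M : ℝ}
    (hb : ∀ s, ‖b s‖ ≤ M) : RapidFam fun s => x s * b s * y s := by
  intro α
  obtain ⟨C, hC⟩ := hx.starFam.exists_norm_apply_e_le α
  obtain ⟨C', hC'⟩ := hy.exists_norm_apply_e_le α
  refine ⟨C * (M * C'), fun s i j => ?_⟩
  have h1 : ((x s * b s * y s) (e j)) i = ⟪star (x s) (e i), b s (y s (e j))⟫_ℂ := by
    rw [← inner_e_left, ContinuousLinearMap.star_eq_adjoint,
      ContinuousLinearMap.adjoint_inner_left]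
    rfl
  have hM : 0 ≤ M := (norm_nonneg _).trans (hb s)
  rw [h1]
  calc ‖⟪star (x s) (e i), b s (y s (e j))⟫_ℂ‖ * ((1 + i : ℝ) ^ α * (1 + j : ℝ) ^ α)
      ≤ (‖star (x s) (e i)‖ * (M * ‖y s (e j)‖)) * ((1 + i : ℝ) ^ α * (1 + j : ℝ) ^ α) := by
        gcongr
        exact (norm_inner_le_norm _ _).trans
          (mul_le_mul_of_nonneg_left ((b s).le_of_opNorm_le (hb s) _) (norm_nonneg _))
    _ = (‖star (x s) (e i)‖ * (1 + i : ℝ) ^ α) * (M * (‖y s (e j)‖ * (1 + j : ℝ) ^ α)) := by ring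
    _ ≤ C * (M * C') := by
        gcongr
        · exact le_trans (by positivity) (hC s i)
        · exact hC s i
        · exact hC' s j

end Families

theorem summable_prod_inv : Summable fun p : ℕ × ℕ =>
    ((1 + p.1 : ℝ) ^ 2)⁻¹ * ((1 + p.2 : ℝ) ^ 2)⁻¹ :=
  summable_one_add_sq.mul_of_nonneg summable_one_add_sq (fun _ => by positivity)
    fun _ => by positivity

/-- Rapid decay as a limit along the cofinite filter and rapid decay as a bound are the same. -/
theorem isRapidDecay_iff (a : Ell2 →L[ℂ] Ell2) :
    IsRapidDecay a ↔ RapidFam fun _ : Unit => a := by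
  constructor
  · intro h α
    have h1 := ((h α α).add (h α 0)).add ((h 0 α).add (h 0 0))
    obtain ⟨B, hB⟩ : ∃ B : ℝ, ∀ p : ℕ × ℕ,
        ‖(a (e p.2)) p.1‖ * ((1 + (p.1 : ℝ) ^ α) * (1 + (p.2 : ℝ) ^ α)) ≤ B := by
      have h2 : ∀ᶠ p : ℕ × ℕ in cofinite,
          ‖(a (e p.2)) p.1‖ * ((1 + (p.1 : ℝ) ^ α) * (1 + (p.2 : ℝ) ^ α)) ≤ 1 := by
        filter_upwards [h1.eventually_le_const (show (0 : ℝ) + 0 + (0 + 0) < 1 by norm_num)]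
          with p hp
        refine le_trans (le_of_eq ?_) hp
        ring
      have h3 : {p : ℕ × ℕ | ¬ ‖(a (e p.2)) p.1‖ *
        ((1 + (p.1 : ℝ) ^ α) * (1 + (p.2 : ℝ) ^ α)) ≤ 1}.Finite := h2
      obtain ⟨B, hB⟩ := (h3.image fun p => ‖(a (e p.2)) p.1‖ *
        ((1 + (p.1 : ℝ) ^ α) * (1 + (p.2 : ℝ) ^ α))).bddAbove
      refine ⟨max 1 B, fun p => ?_⟩
      by_cases hp : ‖(a (e p.2)) p.1‖ * ((1 + (p.1 : ℝ) ^ α) * (1 + (p.2 : ℝ) ^ α)) ≤ 1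
      · exact hp.trans (le_max_left _ _)
      · exact (hB ⟨p, hp, rfl⟩).trans (le_max_right _ _)
    have h4 : ∀ i : ℕ, (1 + i : ℝ) ^ α ≤ 2 ^ α * (1 + (i : ℝ) ^ α) := by
      intro i
      rcases Nat.eq_zero_or_pos i with rfl | hi
      · have h6 : (1 : ℝ) ≤ 2 ^ α := one_le_pow₀ (by norm_num)
        have h7 : (0 : ℝ) ≤ ((0 : ℕ) : ℝ) ^ α := by positivity
        simp only [Nat.cast_zero, add_zero, one_pow] at h7 ⊢
        nlinarith
      · have h5 : (1 : ℝ) ≤ i := by exact_mod_cast hi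
        calc (1 + i : ℝ) ^ α ≤ (2 * i : ℝ) ^ α := by gcongr; linarith
          _ = 2 ^ α * (i : ℝ) ^ α := mul_pow _ _ _
          _ ≤ _ := by gcongr; linarith
    refine ⟨2 ^ α * 2 ^ α * B, fun _ i j => ?_⟩
    calc ‖(a (e j)) i‖ * ((1 + i : ℝ) ^ α * (1 + j : ℝ) ^ α)
        ≤ ‖(a (e j)) i‖ * ((2 ^ α * (1 + (i : ℝ) ^ α)) * (2 ^ α * (1 + (j : ℝ) ^ α))) := by
          gcongr
          · exact h4 i
          · exact h4 j
      _ = 2 ^ α * 2 ^ α * (‖(a (e j)) i‖ * ((1 + (i : ℝ) ^ α) * (1 + (j : ℝ) ^ α))) := by ring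
      _ ≤ _ := by gcongr; exact hB (i, j)
  · intro h α β
    obtain ⟨C, hC⟩ := h (α + β + 2)
    have h1 := (summable_prod_inv.mul_left C).tendsto_cofinite_zero
    refine squeeze_zero (fun p => by positivity) (fun p => ?_) h1
    obtain ⟨i, j⟩ := p
    have h2 : (i : ℝ) ^ α * (1 + i : ℝ) ^ 2 ≤ (1 + i : ℝ) ^ (α + β + 2) := by
      calc (i : ℝ) ^ α * (1 + i : ℝ) ^ 2 ≤ (1 + i : ℝ) ^ α * (1 + i : ℝ) ^ 2 := by
            gcongr; linarith
        _ = (1 + i : ℝ) ^ (α + 2) := by ring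
        _ ≤ _ := pow_le_pow_right₀ (by simp) (by omega)
    have h3 : (j : ℝ) ^ β * (1 + j : ℝ) ^ 2 ≤ (1 + j : ℝ) ^ (α + β + 2) := by
      calc (j : ℝ) ^ β * (1 + j : ℝ) ^ 2 ≤ (1 + j : ℝ) ^ β * (1 + j : ℝ) ^ 2 := by
            gcongr; linarith
        _ = (1 + j : ℝ) ^ (β + 2) := by ring
        _ ≤ _ := pow_le_pow_right₀ (by simp) (by omega)
    rw [← mul_inv, ← div_eq_mul_inv, le_div_iff₀ (by positivity)]
    refine le_trans ?_ (hC () i j)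
    calc (i : ℝ) ^ α * ‖(a (e j)) i‖ * (j : ℝ) ^ β * ((1 + i : ℝ) ^ 2 * (1 + j : ℝ) ^ 2)
        = ‖(a (e j)) i‖ * (((i : ℝ) ^ α * (1 + i : ℝ) ^ 2) * ((j : ℝ) ^ β * (1 + j : ℝ) ^ 2)) := by
          ring
      _ ≤ _ := by gcongr

/-- The matrix unit `e_i ⟨e_j, ·⟩`. -/
def matUnit (p : ℕ × ℕ) : Ell2 →L[ℂ] Ell2 := (innerSL ℂ (e p.2)).smulRight (e p.1)

theorem matUnit_coef (p : ℕ × ℕ) (i j : ℕ) :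
    (matUnit p (e j)) i = if p = (i, j) then 1 else 0 := by
  obtain ⟨k, l⟩ := p
  simp only [matUnit, ContinuousLinearMap.smulRight_apply, innerSL_apply_apply, inner_e_left,
    lp.coeFn_smul, Pi.smul_apply, smul_eq_mul, e_apply, Prod.mk.injEq]
  by_cases h1 : k = i <;> by_cases h2 : l = j <;> simp [h1, h2, Ne.symm]

theorem norm_matUnit_le (p : ℕ × ℕ) : ‖matUnit p‖ ≤ 1 := by
  simp [matUnit, ContinuousLinearMap.norm_smulRight_apply, norm_e]

/-- An absolutely summable matrix is the matrix of a bounded operator, and the sum of its entries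
times the matrix units converges to that operator in norm. -/
theorem exists_hasSum_matUnit {M : ℕ × ℕ → ℂ} (hM : Summable fun p => ‖M p‖) :
    ∃ a : Ell2 →L[ℂ] Ell2, HasSum (fun p => M p • matUnit p) a ∧
      ∀ i j, (a (e j)) i = M (i, j) := by
  have hs : Summable fun p => M p • matUnit p := by
    refine Summable.of_norm_bounded hM fun p => ?_
    rw [norm_smul]
    exact mul_le_of_le_one_right (norm_nonneg _) (norm_matUnit_le p)
  obtain ⟨a, ha⟩ := hs
  refine ⟨a, ha, fun i j => ?_⟩
  have h1 := (ha.mapL (ContinuousLinearMap.apply ℂ Ell2 (e j))).mapL (innerSL ℂ (e i))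
  have hf : ∀ p, innerSL ℂ (e i) (ContinuousLinearMap.apply ℂ Ell2 (e j) (M p • matUnit p)) =
      if p = (i, j) then M p else 0 := by
    intro p
    rw [innerSL_apply_apply, ContinuousLinearMap.apply_apply, inner_e_left]
    refine (congrArg (M p * ·) (matUnit_coef p i j)).trans ?_
    simp
  have h2 : HasSum (fun p : ℕ × ℕ => if p = (i, j) then M p else 0) ((a (e j)) i) := by
    rw [innerSL_apply_apply, ContinuousLinearMap.apply_apply, inner_e_left] at h1
    simpa only [hf] using h1
  refine h2.unique ?_
  convert hasSum_ite_eq (i, j) (M (i, j)) using 2 with p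
  split_ifs with hp
  · rw [hp]
  · rfl

theorem RapidFam.summable_coef {a : Ell2 →L[ℂ] Ell2} (ha : RapidFam fun _ : Unit => a) :
    Summable fun p : ℕ × ℕ => ‖(a (e p.2)) p.1‖ := by
  obtain ⟨C, hC⟩ := ha 2
  refine Summable.of_nonneg_of_le (fun _ => norm_nonneg _) (fun p => ?_)
    (summable_prod_inv.mul_left C)
  rw [← mul_inv, ← div_eq_mul_inv, le_div_iff₀ (by positivity)]
  exact hC () p.1 p.2

theorem RapidFam.hasSum_matUnit {a : Ell2 →L[ℂ] Ell2} (ha : RapidFam fun _ : Unit => a) :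
    HasSum (fun p : ℕ × ℕ => (a (e p.2)) p.1 • matUnit p) a := by
  obtain ⟨b, hb, hb'⟩ := exists_hasSum_matUnit ha.summable_coef
  rwa [ext_coef hb'] at hb

theorem isCompactOperator_matUnit (p : ℕ × ℕ) : IsCompactOperator (matUnit p) := by
  refine isCompactOperator_of_e _ (p.2 + 1) fun n hn => ?_
  ext i
  rw [matUnit_coef, if_neg]
  · rfl
  · rintro rfl
    simp at hn

theorem RapidFam.isCompactOperator {a : Ell2 →L[ℂ] Ell2} (ha : RapidFam fun _ : Unit => a) :
    IsCompactOperator a := by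
  refine isCompactOperator_of_tendsto ha.hasSum_matUnit (Eventually.of_forall fun t => ?_)
  induction t using Finset.induction_on with
  | empty => simpa using isCompactOperator_zero
  | insert p s hp ih =>
    rw [Finset.sum_insert hp]
    exact ((isCompactOperator_matUnit p).smul _).add ih

/-! ### Smooth functions and their Fourier coefficients -/

/-- The Fourier coefficients of a family of functions decay rapidly, with bounds that are uniform
over the family. -/
def SmoothFam {ι : Type*} (f : ι → C(Circ, ℂ)) : Prop :=
  ∀ α : ℕ, ∃ C : ℝ, ∀ s (m : ℤ), ‖fourierCoeff (f s) m‖ * (1 + |(m : ℝ)|) ^ α ≤ C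

theorem inner_fourierLp_mulOp (f : C(Circ, ℂ)) (m k : ℤ) :
    ⟪fourierLp 2 m, mulOp f (fourierLp 2 k)⟫_ℂ = fourierCoeff f (m - k) := by
  rw [MeasureTheory.L2.inner_def, fourierCoeff]
  apply MeasureTheory.integral_congr_ae
  filter_upwards [mulOp_coeFn f (fourierLp 2 k), coeFn_fourierLp (T := 2 * Real.pi) 2 k,
    coeFn_fourierLp (T := 2 * Real.pi) 2 m] with x h1 h2 h3
  rw [h1, h2, h3, neg_sub, sub_eq_add_neg, fourier_add, fourier_neg]
  simp
  ring

/-- Toeplitz operators have Toeplitz matrices. -/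
theorem coef_T (f : C(Circ, ℂ)) (i j : ℕ) :
    (T f (e j)) i = fourierCoeff f ((i : ℤ) - j) := by
  rw [← inner_e_left, T, ContinuousLinearMap.comp_apply, ContinuousLinearMap.adjoint_inner_right,
    ContinuousLinearMap.comp_apply, hardy_e, hardy_e, inner_fourierLp_mulOp]

/-- The `m`-th Fourier coefficient as a continuous linear functional. -/
def fourierCoeffL (m : ℤ) : C(Circ, ℂ) →L[ℂ] ℂ :=
  (innerSL ℂ (fourierLp 2 m)).comp ((ContinuousLinearMap.apply ℂ L2Circ (fourierLp 2 0)).comp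
    mulOpL)

theorem fourierCoeffL_apply (f : C(Circ, ℂ)) (m : ℤ) :
    fourierCoeffL m f = fourierCoeff f m := by
  have h := inner_fourierLp_mulOp f m 0
  rwa [sub_zero] at h

section Families

variable {ι : Type*}

theorem SmoothFam.bandFam_T {f : ι → C(Circ, ℂ)} (hf : SmoothFam f) :
    BandFam fun s => T (f s) := by
  intro α
  obtain ⟨C, hC⟩ := hf α
  refine ⟨C, fun s i j => ?_⟩
  have h := hC s ((i : ℤ) - j)
  rw [coef_T]
  push_cast at h
  exact h

/-- The semi-commutator of Toeplitz operators with smooth symbols decays rapidly: its entries are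
`∑ f̂(i + m) ĝ(-m - j)` over `m ≥ 1`. -/
theorem SmoothFam.rapidFam_semicommutator {f g : ι → C(Circ, ℂ)} (hf : SmoothFam f)
    (hg : SmoothFam g) : RapidFam fun s => T (f s * g s) - T (f s) * T (g s) := by
  intro α
  obtain ⟨C, hC⟩ := hf (α + 2)
  obtain ⟨C', hC'⟩ := hg α
  refine ⟨C * C' * ∑' m : ℕ, ((1 + m : ℝ) ^ 2)⁻¹, fun s i j => ?_⟩
  have h : T (f s * g s) - T (f s) * T (g s) =
      ((ContinuousLinearMap.adjoint hardy).comp (mulOp (f s))).comp (hankel (g s)) := by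
    ext1 x
    simp [T, hankel]
  have h2 : (((T (f s * g s) - T (f s) * T (g s)) : Ell2 →L[ℂ] Ell2) (e j)) i =
      ⟪mulOp (star (f s)) (fourierLp 2 i), hankel (g s) (e j)⟫_ℂ := by
    rw [h, ← inner_e_left, ContinuousLinearMap.comp_apply, ContinuousLinearMap.comp_apply,
      ContinuousLinearMap.adjoint_inner_right, hardy_e, map_star,
      ContinuousLinearMap.star_eq_adjoint, ContinuousLinearMap.adjoint_inner_left]
  have h3 := fourierBasis.hasSum_inner_mul_inner (mulOp (star (f s)) (fourierLp 2 (i : ℤ)))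
    (hankel (g s) (e j))
  rw [← h2, coe_fourierBasis] at h3
  have h4 : ∀ m : ℤ, ⟪mulOp (star (f s)) (fourierLp 2 (i : ℤ)), fourierLp 2 m⟫_ℂ =
      fourierCoeff (f s) (i - m) := by
    intro m
    rw [map_star, ContinuousLinearMap.star_eq_adjoint, ContinuousLinearMap.adjoint_inner_left,
      inner_fourierLp_mulOp]
  have h5 : ∀ m : ℤ, ⟪fourierLp 2 m, hankel (g s) (e j)⟫_ℂ =
      if 0 ≤ m then 0 else fourierCoeff (g s) (m - j) := by
    intro m
    have h6 : hankel (g s) (e j) = mulOp (g s) (fourierLp 2 (j : ℤ)) -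
        hardy (ContinuousLinearMap.adjoint hardy (mulOp (g s) (fourierLp 2 (j : ℤ)))) := by
      simp [hankel, hardy_e]
    rw [h6, inner_sub_right, inner_fourierLp_mulOp, ← ContinuousLinearMap.adjoint_inner_left]
    split_ifs with hm
    · obtain ⟨n, rfl⟩ := Int.eq_ofNat_of_zero_le hm
      rw [← hardy_e, hardy_adjoint_hardy, ContinuousLinearMap.adjoint_inner_right, hardy_e,
        inner_fourierLp_mulOp, sub_self]
    · rw [hardy_adjoint_fourier m (by omega), inner_zero_left, sub_zero]
  have h7 : HasSum (fun m : ℕ => fourierCoeff (f s) (i + (m + 1)) *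
      fourierCoeff (g s) (-(m + 1) - j))
      ((((T (f s * g s) - T (f s) * T (g s)) : Ell2 →L[ℂ] Ell2) (e j)) i) := by
    have hinj : Function.Injective fun m : ℕ => (-(m + 1) : ℤ) := fun a b hab => by
      simpa using hab
    rw [← hinj.hasSum_iff] at h3
    · have hfun : (fun m => ⟪mulOp (star (f s)) (fourierLp 2 (i : ℤ)), fourierLp 2 m⟫_ℂ *
          ⟪fourierLp 2 m, hankel (g s) (e j)⟫_ℂ) ∘ (fun m : ℕ => (-(m + 1) : ℤ)) =
          fun m : ℕ => fourierCoeff (f s) (i + (m + 1)) * fourierCoeff (g s) (-(m + 1) - j) := by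
        funext m
        rw [Function.comp_apply, h4, h5, if_neg (by omega), sub_neg_eq_add]
      exact hfun ▸ h3
    · intro m hm
      have : 0 ≤ m := by
        by_contra hneg
        refine hm ⟨(-m - 1).toNat, ?_⟩
        simp only
        omega
      rw [h5, if_pos this, mul_zero]
  have hw : (0 : ℝ) < (1 + i : ℝ) ^ α * (1 + j : ℝ) ^ α := by positivity
  rw [← le_div_iff₀ hw, ← tsum_mul_left, ← tsum_div_const]
  refine h7.norm_le_of_bounded ((summable_one_add_sq.mul_left (C * C')).div_const _).hasSum
    fun m => ?_
  rw [le_div_iff₀ hw, ← div_eq_mul_inv, le_div_iff₀ (by positivity), norm_mul]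
  have hf1 := hC s (i + (m + 1))
  have hg1 := hC' s (-(m + 1) - j)
  have e1 : |(((i : ℤ) + (m + 1) : ℤ) : ℝ)| = (i : ℝ) + (m + 1) := by
    push_cast
    exact abs_of_nonneg (by positivity)
  have e2 : |((-((m : ℤ) + 1) - j : ℤ) : ℝ)| = (m : ℝ) + 1 + j := by
    push_cast
    rw [← abs_neg, abs_of_nonneg] <;> [ring; (ring_nf; positivity)]
  rw [e1] at hf1
  rw [e2] at hg1
  refine le_trans ?_ (mul_le_mul hf1 hg1 (by positivity) (le_trans (by positivity) hf1))
  have hi : (0 : ℝ) ≤ i := Nat.cast_nonneg i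
  have hj : (0 : ℝ) ≤ j := Nat.cast_nonneg j
  have hm : (0 : ℝ) ≤ m := Nat.cast_nonneg m
  have h8 : (1 + i : ℝ) ^ α * (1 + m : ℝ) ^ 2 ≤ (1 + ((i : ℝ) + (m + 1))) ^ (α + 2) := by
    rw [pow_add]
    gcongr <;> linarith
  have h9 : (1 + j : ℝ) ^ α ≤ (1 + ((m : ℝ) + 1 + j)) ^ α := by
    gcongr
    linarith
  calc ‖fourierCoeff (f s) (i + (m + 1))‖ * ‖fourierCoeff (g s) (-(m + 1) - j)‖ *
        ((1 + i : ℝ) ^ α * (1 + j : ℝ) ^ α) * (1 + m : ℝ) ^ 2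
      = ‖fourierCoeff (f s) (i + (m + 1))‖ * ((1 + i : ℝ) ^ α * (1 + m : ℝ) ^ 2) *
        (‖fourierCoeff (g s) (-(m + 1) - j)‖ * (1 + j : ℝ) ^ α) := by ring
    _ ≤ _ := by gcongr

/-! ### Uniform bounds on derivatives -/

/-- A family of functions on the line whose derivatives up to order `n` are bounded, uniformly over
the family. -/
def BddDeriv : ℕ → (ι → ℝ → ℂ) → Prop
  | 0, G => (∀ s, Continuous (G s)) ∧ ∃ C : ℝ, ∀ s t, ‖G s t‖ ≤ C
  | n + 1, G => (∃ C : ℝ, ∀ s t, ‖G s t‖ ≤ C) ∧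
      ∃ G', (∀ s t, HasDerivAt (G s) (G' s t) t) ∧ BddDeriv n G'

theorem BddDeriv.bdd {n : ℕ} {G : ι → ℝ → ℂ} (h : BddDeriv n G) :
    ∃ C : ℝ, ∀ s t, ‖G s t‖ ≤ C := by
  cases n with
  | zero => exact h.2
  | succ n => exact h.1

theorem BddDeriv.continuous {n : ℕ} {G : ι → ℝ → ℂ} (h : BddDeriv n G) (s : ι) :
    Continuous (G s) := by
  cases n with
  | zero => exact h.1 s
  | succ n =>
    obtain ⟨G', hG', -⟩ := h.2
    exact continuous_iff_continuousAt.2 fun t => (hG' s t).continuousAt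

theorem BddDeriv.of_succ {n : ℕ} {G : ι → ℝ → ℂ} (h : BddDeriv (n + 1) G) : BddDeriv n G := by
  induction n generalizing G with
  | zero => exact ⟨h.continuous, h.bdd⟩
  | succ n ih =>
    obtain ⟨h1, G', h2, h3⟩ := h
    exact ⟨h1, G', h2, ih h3⟩

theorem BddDeriv.add {n : ℕ} {G K : ι → ℝ → ℂ} (hG : BddDeriv n G) (hK : BddDeriv n K) :
    BddDeriv n fun s t => G s t + K s t := by
  have hb : ∃ C : ℝ, ∀ s t, ‖G s t + K s t‖ ≤ C := by
    obtain ⟨C, hC⟩ := hG.bdd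
    obtain ⟨C', hC'⟩ := hK.bdd
    exact ⟨C + C', fun s t => (norm_add_le _ _).trans (add_le_add (hC s t) (hC' s t))⟩
  induction n generalizing G K with
  | zero => exact ⟨fun s => (hG.1 s).add (hK.1 s), hb⟩
  | succ n ih =>
    obtain ⟨-, G', hG1, hG2⟩ := hG
    obtain ⟨-, K', hK1, hK2⟩ := hK
    refine ⟨hb, fun s t => G' s t + K' s t, fun s t => (hG1 s t).add (hK1 s t), ih hG2 hK2 ?_⟩
    obtain ⟨C, hC⟩ := hG2.bdd
    obtain ⟨C', hC'⟩ := hK2.bdd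
    exact ⟨C + C', fun s t => (norm_add_le _ _).trans (add_le_add (hC s t) (hC' s t))⟩

theorem BddDeriv.mul {n : ℕ} {G K : ι → ℝ → ℂ} (hG : BddDeriv n G) (hK : BddDeriv n K) :
    BddDeriv n fun s t => G s t * K s t := by
  have hb : ∃ C : ℝ, ∀ s t, ‖G s t * K s t‖ ≤ C := by
    obtain ⟨C, hC⟩ := hG.bdd
    obtain ⟨C', hC'⟩ := hK.bdd
    refine ⟨C * C', fun s t => ?_⟩
    rw [norm_mul]
    exact mul_le_mul (hC s t) (hC' s t) (norm_nonneg _) ((norm_nonneg _).trans (hC s t))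
  induction n generalizing G K with
  | zero => exact ⟨fun s => (hG.1 s).mul (hK.1 s), hb⟩
  | succ n ih =>
    have hG0 := hG.of_succ
    have hK0 := hK.of_succ
    obtain ⟨-, G', hG1, hG2⟩ := hG
    obtain ⟨-, K', hK1, hK2⟩ := hK
    have aux : ∀ {A B : ι → ℝ → ℂ}, BddDeriv n A → BddDeriv n B →
        ∃ C : ℝ, ∀ s t, ‖A s t * B s t‖ ≤ C := by
      intro A B hA hB
      obtain ⟨C, hC⟩ := hA.bdd
      obtain ⟨C', hC'⟩ := hB.bdd
      refine ⟨C * C', fun s t => ?_⟩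
      rw [norm_mul]
      exact mul_le_mul (hC s t) (hC' s t) (norm_nonneg _) ((norm_nonneg _).trans (hC s t))
    exact ⟨hb, fun s t => G' s t * K s t + G s t * K' s t,
      fun s t => (hG1 s t).mul (hK1 s t),
      (ih hG2 hK0 (aux hG2 hK0)).add (ih hG0 hK2 (aux hG0 hK2))⟩

/-- Uniform bounds on the derivatives of the reciprocals `(z - F)⁻¹`, from `r' = F' r²`. -/
theorem BddDeriv.reciprocal {F : ℝ → ℂ} (hF : ∀ n, BddDeriv n fun (_ : ι) => F) {z : ι → ℂ}
    {r : ι → ℝ → ℂ} (hr : ∀ s t, r s t * (z s - F t) = 1) {C : ℝ} (hC : ∀ s t, ‖r s t‖ ≤ C)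
    (n : ℕ) : BddDeriv n r := by
  have hne : ∀ s t, z s - F t ≠ 0 := fun s t h => by simpa [h] using hr s t
  have hinv : ∀ s, r s = fun t => (z s - F t)⁻¹ := fun s => by
    funext t
    exact eq_inv_of_mul_eq_one_left (hr s t)
  obtain ⟨-, F', hF1, -⟩ := hF 1
  have hF' : ∀ n, BddDeriv n F' := by
    intro n
    obtain ⟨-, F2, hF2, hF3⟩ := hF (n + 1)
    have : F2 = F' := by
      funext s t
      exact (hF2 s t).unique (hF1 s t)
    rwa [this] at hF3
  have hderiv : ∀ s t, HasDerivAt (r s) (F' s t * (r s t * r s t)) t := by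
    intro s t
    have h1 := ((hF1 s t).const_sub (z s)).inv (hne s t)
    rw [hinv s]
    refine h1.congr_deriv ?_
    rw [neg_neg, div_eq_mul_inv, sq, mul_inv]
  induction n with
  | zero =>
    exact ⟨fun s => continuous_iff_continuousAt.2 fun t => (hderiv s t).continuousAt, C, hC⟩
  | succ n ih => exact ⟨⟨C, hC⟩, _, hderiv, (hF' n).mul (ih.mul ih)⟩

/-- Decay of the Fourier coefficients from bounds on the derivatives, by partial integration. -/
theorem BddDeriv.exists_bound {n : ℕ} {G : ι → ℝ → ℂ} (h : BddDeriv n G)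
    (hp : ∀ s, Function.Periodic (G s) (2 * Real.pi)) : ∃ C : ℝ, ∀ s (m : ℤ),
      ‖∫ t in (0 : ℝ)..2 * Real.pi, Complex.exp (-(m * Complex.I) * t) * G s t‖ *
        |(m : ℝ)| ^ n ≤ C := by
  have hexp : ∀ (m : ℤ) (t : ℝ), ‖Complex.exp (-(m * Complex.I) * t)‖ = 1 := by
    intro m t
    have : -((m : ℂ) * Complex.I) * t = ((-(m * t) : ℝ) : ℂ) * Complex.I := by push_cast; ring
    rw [this, Complex.norm_exp_ofReal_mul_I]
  induction n generalizing G with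
  | zero =>
    obtain ⟨-, C, hC⟩ := h
    refine ⟨C * |2 * Real.pi - 0|, fun s m => ?_⟩
    rw [pow_zero, mul_one]
    refine intervalIntegral.norm_integral_le_of_norm_le_const fun t _ => ?_
    rw [norm_mul, hexp, one_mul]
    exact hC s t
  | succ n ih =>
    have hcont := h.continuous
    obtain ⟨-, G', hG', h'⟩ := h
    have hp' : ∀ s, Function.Periodic (G' s) (2 * Real.pi) := fun s t => by
      have h1 := (hG' s (t + 2 * Real.pi)).comp_add_const t (2 * Real.pi)
      have h2 : (fun x => G s (x + 2 * Real.pi)) = G s := funext (hp s)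
      rw [h2] at h1
      exact h1.unique (hG' s t)
    obtain ⟨C, hC⟩ := ih h' hp'
    refine ⟨C, fun s m => ?_⟩
    have hu : ∀ t : ℝ, HasDerivAt (fun t : ℝ => Complex.exp (-(m * Complex.I) * t))
        (Complex.exp (-(m * Complex.I) * t) * -(m * Complex.I)) t := by
      intro t
      have h1 : HasDerivAt (fun t : ℝ => -((m : ℂ) * Complex.I) * (t : ℂ))
          (-((m : ℂ) * Complex.I) * 1) t :=
        (Complex.ofRealCLM.hasDerivAt (x := t)).const_mul _
      simpa using h1.cexp
    have h3 := intervalIntegral.integral_mul_deriv_eq_deriv_mul (a := 0) (b := 2 * Real.pi)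
      (u := fun t : ℝ => Complex.exp (-(m * Complex.I) * t)) (v := G s)
      (fun t _ => hu t) (fun t _ => hG' s t)
      (Continuous.intervalIntegrable (by fun_prop) _ _)
      ((h'.continuous s).intervalIntegrable _ _)
    have h4 : Complex.exp (-(m * Complex.I) * ((2 * Real.pi : ℝ) : ℂ)) = 1 := by
      have := Complex.exp_int_mul_two_pi_mul_I (-m)
      rw [← this]
      congr 1
      push_cast
      ring
    have h5 : G s (2 * Real.pi) = G s 0 := by simpa using hp s 0
    have h6 : (fun t : ℝ => Complex.exp (-(m * Complex.I) * t) * -(m * Complex.I) * G s t) =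
        fun t : ℝ => -(m * Complex.I) * (Complex.exp (-(m * Complex.I) * t) * G s t) := by
      funext t
      ring
    rw [h4, h5, h6, intervalIntegral.integral_const_mul] at h3
    simp only [Complex.ofReal_zero, mul_zero, Complex.exp_zero, sub_self, zero_sub, neg_mul,
      neg_neg] at h3
    have h7 := hC s m
    simp only [neg_mul] at h7 ⊢
    rw [h3, norm_mul, norm_mul, Complex.norm_I, mul_one, Complex.norm_intCast] at h7
    rw [pow_succ]
    refine le_trans (le_of_eq ?_) h7
    ring

theorem fourierCoeff_eq_integral (f : C(Circ, ℂ)) (m : ℤ) :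
    fourierCoeff f m = (1 / (2 * Real.pi) : ℝ) •
      ∫ t in (0 : ℝ)..2 * Real.pi, Complex.exp (-(m * Complex.I) * t) * f (t : Circ) := by
  rw [fourierCoeff_eq_intervalIntegral _ _ 0, zero_add]
  congr 2
  funext t
  rw [fourier_coe_apply, smul_eq_mul]
  congr 2
  have : (Real.pi : ℂ) ≠ 0 := by exact_mod_cast Real.pi_ne_zero
  push_cast
  field_simp

theorem smoothFam_of_bddDeriv {f : ι → C(Circ, ℂ)}
    (h : ∀ n, BddDeriv n fun s (t : ℝ) => f s (t : Circ)) : SmoothFam f := by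
  have hp : ∀ s, Function.Periodic (fun t : ℝ => f s (t : Circ)) (2 * Real.pi) := fun s t => by
    simp
  intro α
  obtain ⟨C, hC⟩ := (h 0).exists_bound hp
  obtain ⟨C', hC'⟩ := (h α).exists_bound hp
  refine ⟨(1 / (2 * Real.pi)) * (2 ^ α * (C + C')), fun s m => ?_⟩
  have h1 := hC s m
  have h2 := hC' s m
  rw [pow_zero, mul_one] at h1
  have h3 : (1 + |(m : ℝ)|) ^ α ≤ 2 ^ α * (1 + |(m : ℝ)| ^ α) := by
    rcases eq_or_ne m 0 with rfl | hm
    · have h6 : (1 : ℝ) ≤ 2 ^ α := one_le_pow₀ (by norm_num)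
      have h7 : (0 : ℝ) ≤ |((0 : ℤ) : ℝ)| ^ α := by positivity
      simp only [Int.cast_zero, abs_zero, add_zero, one_pow] at h7 ⊢
      nlinarith
    · have h5 : (1 : ℝ) ≤ |(m : ℝ)| := by exact_mod_cast Int.one_le_abs hm
      calc (1 + |(m : ℝ)|) ^ α ≤ (2 * |(m : ℝ)|) ^ α := by gcongr; linarith
        _ = 2 ^ α * |(m : ℝ)| ^ α := mul_pow _ _ _
        _ ≤ _ := by gcongr; linarith
  rw [fourierCoeff_eq_integral, norm_smul, Real.norm_of_nonneg (by positivity), mul_assoc]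
  refine mul_le_mul_of_nonneg_left ?_ (by positivity)
  refine (mul_le_mul_of_nonneg_left h3 (norm_nonneg (∫ t in (0 : ℝ)..2 * Real.pi,
    Complex.exp (-(m * Complex.I) * t) * f s (t : Circ)))).trans ?_
  rw [mul_left_comm, mul_add, mul_one]
  gcongr

end Families

theorem IsSmooth.bddDeriv {ι : Type*} {f : C(Circ, ℂ)} (hf : IsSmooth f) (n : ℕ) :
    BddDeriv n fun (_ : ι) (t : ℝ) => f (t : Circ) := by
  have key : ∀ (n : ℕ) (G : ℝ → ℂ), Function.Periodic G (2 * Real.pi) → ContDiff ℝ ∞ G →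
      BddDeriv n fun (_ : ι) => G := by
    intro n
    induction n with
    | zero =>
      intro G hp hG
      obtain ⟨C, hC⟩ :=
        (hp.compact_of_continuous Real.two_pi_pos.ne' hG.continuous).isBounded.exists_norm_le
      exact ⟨fun _ => hG.continuous, C, fun _ t => hC _ ⟨t, rfl⟩⟩
    | succ n ih =>
      intro G hp hG
      obtain ⟨C, hC⟩ :=
        (hp.compact_of_continuous Real.two_pi_pos.ne' hG.continuous).isBounded.exists_norm_le
      obtain ⟨h1, h2⟩ := contDiff_infty_iff_deriv.1 hG
      refine ⟨⟨C, fun _ t => hC _ ⟨t, rfl⟩⟩, fun _ => deriv G, fun _ t => (h1 t).hasDerivAt,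
        ih _ (fun t => ?_) h2⟩
      rw [← deriv_comp_add_const, funext hp]
  exact key n _ (fun t => by simp) hf

theorem IsSmooth.smoothFam {ι : Type*} {f : C(Circ, ℂ)} (hf : IsSmooth f) :
    SmoothFam fun _ : ι => f :=
  smoothFam_of_bddDeriv fun n => hf.bddDeriv n

/-- Reciprocals `(z - f)⁻¹` of a smooth function form a smooth family as long as they are uniformly
bounded. -/
theorem IsSmooth.smoothFam_reciprocal {ι : Type*} {f : C(Circ, ℂ)} (hf : IsSmooth f) {z : ι → ℂ}
    {r : ι → C(Circ, ℂ)} (hr : ∀ s, r s * (algebraMap ℂ C(Circ, ℂ) (z s) - f) = 1) {C : ℝ}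
    (hC : ∀ s, ‖r s‖ ≤ C) : SmoothFam r :=
  smoothFam_of_bddDeriv fun n => BddDeriv.reciprocal (fun n => hf.bddDeriv n)
    (fun s t => by simpa using DFunLike.congr_fun (hr s) (t : Circ))
    (fun s t => ((r s).norm_coe_le_norm _).trans (hC s)) n

theorem summable_int_inv_sq : Summable fun m : ℤ => ((1 + |(m : ℝ)|) ^ 2)⁻¹ := by
  apply Summable.of_nat_of_neg
  · simpa using summable_one_add_sq
  · simpa using summable_one_add_sq

/-- An absolutely summable sequence is the sequence of Fourier coefficients of a continuous
function. -/
theorem exists_fourierCoeff_eq {c : ℤ → ℂ} (hc : Summable fun m => ‖c m‖) :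
    ∃ f : C(Circ, ℂ), HasSum (fun m => c m • fourier m) f ∧ ∀ m, fourierCoeff f m = c m := by
  have hs : Summable fun m => c m • (fourier m : C(Circ, ℂ)) := by
    refine Summable.of_norm_bounded hc fun m => ?_
    rw [norm_smul, fourier_norm, mul_one]
  obtain ⟨f, hf⟩ := hs
  refine ⟨f, hf, fun m => ?_⟩
  have h1 := hf.mapL (fourierCoeffL m)
  have h2 : ∀ k, fourierCoeffL m (c k • fourier k) = if k = m then c m else 0 := by
    intro k
    rw [map_smul, fourierCoeffL_apply, fourierCoeff_fourier, smul_eq_mul]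
    by_cases h : k = m
    · simp [h]
    · simp [h, Ne.symm h]
  simp only [h2, fourierCoeffL_apply] at h1
  exact h1.unique (hasSum_ite_eq m (c m))

theorem SmoothFam.summable_fourierCoeff {f : C(Circ, ℂ)} (hf : SmoothFam fun _ : Unit => f)
    (α : ℕ) : Summable fun m : ℤ => |(m : ℝ)| ^ α * ‖fourierCoeff f m‖ := by
  obtain ⟨C, hC⟩ := hf (α + 2)
  refine Summable.of_nonneg_of_le (fun m => by positivity) (fun m => ?_)
    (summable_int_inv_sq.mul_left C)
  rw [← div_eq_mul_inv, le_div_iff₀ (by positivity)]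
  refine le_trans ?_ (hC () m)
  rw [pow_add, mul_comm _ ‖fourierCoeff f m‖, mul_assoc]
  gcongr
  simp

/-- A continuous function with rapidly decaying Fourier coefficients is smooth. -/
theorem SmoothFam.isSmooth {f : C(Circ, ℂ)} (hf : SmoothFam fun _ : Unit => f) : IsSmooth f := by
  have hs := hf.summable_fourierCoeff
  have h0 : Summable (fourierCoeff f) := Summable.of_norm (by simpa using hs 0)
  have h1 : (fun t : ℝ => f (t : Circ)) =
      fun t : ℝ => ∑' m : ℤ, fourierCoeff f m * Complex.exp (m * Complex.I * t) := by
    funext t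
    rw [← (has_pointwise_sum_fourier_series_of_summable h0 (t : Circ)).tsum_eq]
    congr 1
    funext m
    rw [fourier_coe_apply, smul_eq_mul]
    congr 2
    have : (Real.pi : ℂ) ≠ 0 := by exact_mod_cast Real.pi_ne_zero
    push_cast
    field_simp
  have hit : ∀ (k : ℕ) (m : ℤ), iteratedDeriv k
      (fun t : ℝ => fourierCoeff f m * Complex.exp (m * Complex.I * t)) =
      fun t : ℝ => fourierCoeff f m * ((m * Complex.I) ^ k * Complex.exp (m * Complex.I * t)) := by
    intro k m
    induction k with
    | zero => simp
    | succ k ih =>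
      rw [iteratedDeriv_succ, ih]
      funext t
      have h2 : HasDerivAt (fun t : ℝ => (m * Complex.I : ℂ) * (t : ℂ)) (m * Complex.I * 1) t :=
        (Complex.ofRealCLM.hasDerivAt (x := t)).const_mul _
      have h3 := ((h2.cexp.const_mul ((m * Complex.I : ℂ) ^ k)).const_mul (fourierCoeff f m)).deriv
      rw [h3]
      ring
  change ContDiff ℝ ∞ _
  rw [h1]
  refine contDiff_tsum (v := fun k (m : ℤ) => |(m : ℝ)| ^ k * ‖fourierCoeff f m‖)
    (fun m => contDiff_const.mul (contDiff_const.mul Complex.ofRealCLM.contDiff).cexp)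
    (fun k _ => hs k) fun k m t _ => ?_
  rw [norm_iteratedFDeriv_eq_norm_iteratedDeriv, hit, norm_mul, norm_mul, norm_pow, norm_mul,
    Complex.norm_I, mul_one, Complex.norm_intCast]
  have : (m : ℂ) * Complex.I * t = ((m * t : ℝ) : ℂ) * Complex.I := by push_cast; ring
  rw [this, Complex.norm_exp_ofReal_mul_I, mul_one, mul_comm]

/-! ### Toeplitz operators with smooth symbol plus matrices of rapid decay -/

/-- The matrix of a single operator decays rapidly, as a bound on the entries. -/
abbrev Rapid (a : Ell2 →L[ℂ] Ell2) : Prop := RapidFam fun _ : Unit => a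

theorem rapid_zero : Rapid 0 := fun _ => ⟨0, fun _ i j => by simp⟩

theorem isSmooth_add {f g : C(Circ, ℂ)} (hf : IsSmooth f) (hg : IsSmooth g) :
    IsSmooth (f + g) := ContDiff.add hf hg

theorem isSmooth_mul {f g : C(Circ, ℂ)} (hf : IsSmooth f) (hg : IsSmooth g) :
    IsSmooth (f * g) := ContDiff.mul hf hg

theorem isSmooth_star {f : C(Circ, ℂ)} (hf : IsSmooth f) : IsSmooth (star f) :=
  Complex.conjCLE.contDiff.comp hf

theorem isSmooth_algebraMap (c : ℂ) : IsSmooth (algebraMap ℂ C(Circ, ℂ) c) := contDiff_const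

theorem isSmooth_fourier (n : ℤ) : IsSmooth (fourier n) := by
  have h : (fun t : ℝ => fourier n (t : Circ)) =
      fun t : ℝ => Complex.exp (2 * Real.pi * Complex.I * n * t / (2 * Real.pi : ℝ)) := by
    funext t
    exact fourier_coe_apply
  change ContDiff ℝ ∞ _
  rw [h]
  exact ((contDiff_const.mul Complex.ofRealCLM.contDiff).div_const _).cexp

theorem T_algebraMap (c : ℂ) : T (algebraMap ℂ C(Circ, ℂ) c) = algebraMap ℂ _ c := by
  rw [Algebra.algebraMap_eq_smul_one, T_smul, T_one, Algebra.algebraMap_eq_smul_one]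

/-- Modulo operators of rapid decay, symbols multiply. -/
theorem rapid_mul_sub {a b : Ell2 →L[ℂ] Ell2} {f g : C(Circ, ℂ)} (hf : IsSmooth f)
    (hg : IsSmooth g) (ha : Rapid (a - T f)) (hb : Rapid (b - T g)) :
    Rapid (a * b - T (f * g)) := by
  have h : a * b - T (f * g) = (a - T f) * T g + (a - T f) * (b - T g) + T f * (b - T g) -
      (T (f * g) - T f * T g) := by noncomm_ring
  rw [h]
  exact (((ha.mul_bandFam hg.smoothFam.bandFam_T).add (ha.mul_bandFam hb.bandFam)).add
    (hb.bandFam_mul hf.smoothFam.bandFam_T)).sub (hf.smoothFam.rapidFam_semicommutator hg.smoothFam)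

/-- The operators `T f + k`, where the smooth symbol `f` belongs to a given *-algebra of continuous
functions, and where `k` is of rapid decay. -/
def smoothToeplitz (B : StarSubalgebra ℂ C(Circ, ℂ)) : StarSubalgebra ℂ (Ell2 →L[ℂ] Ell2) where
  carrier := {a | ∃ f, IsSmooth f ∧ f ∈ B ∧ Rapid (a - T f)}
  mul_mem' := by
    rintro a b ⟨f, hf, hfB, ha⟩ ⟨g, hg, hgB, hb⟩
    exact ⟨f * g, isSmooth_mul hf hg, mul_mem hfB hgB, rapid_mul_sub hf hg ha hb⟩
  add_mem' := by
    rintro a b ⟨f, hf, hfB, ha⟩ ⟨g, hg, hgB, hb⟩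
    refine ⟨f + g, isSmooth_add hf hg, add_mem hfB hgB, ?_⟩
    rw [T_add, add_sub_add_comm]
    exact ha.add hb
  algebraMap_mem' c := by
    refine ⟨algebraMap ℂ _ c, isSmooth_algebraMap c, B.algebraMap_mem c, ?_⟩
    rw [T_algebraMap, sub_self]
    exact rapid_zero
  star_mem' := by
    rintro a ⟨f, hf, hfB, ha⟩
    refine ⟨star f, isSmooth_star hf, star_mem hfB, ?_⟩
    rw [T_star, ← star_sub]
    exact ha.starFam

theorem T_mem_smoothToeplitz {B : StarSubalgebra ℂ C(Circ, ℂ)} {f : C(Circ, ℂ)}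
    (hf : IsSmooth f) (hB : f ∈ B) : T f ∈ smoothToeplitz B :=
  ⟨f, hf, hB, by rw [sub_self]; exact rapid_zero⟩

theorem rapid_mem_smoothToeplitz {B : StarSubalgebra ℂ C(Circ, ℂ)} {k : Ell2 →L[ℂ] Ell2}
    (hk : Rapid k) : k ∈ smoothToeplitz B := by
  refine ⟨0, by simpa using isSmooth_algebraMap 0, zero_mem B, ?_⟩
  have : T 0 = 0 := by simpa using T_algebraMap 0
  rwa [this, sub_zero]

theorem smoothToeplitz_le_top (B : StarSubalgebra ℂ C(Circ, ℂ)) :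
    smoothToeplitz B ≤ smoothToeplitz ⊤ :=
  fun _ ⟨f, hf, _, h⟩ => ⟨f, hf, trivial, h⟩

/-- The algebra generated by the smooth Toeplitz operators and the matrices of rapid decay consists
of their sums. -/
theorem smoothAlgebra_eq (g : ℕ) : smoothAlgebra g = smoothToeplitz (boundaryAlgebra g) := by
  apply le_antisymm
  · rw [smoothAlgebra, StarAlgebra.adjoin_le_iff]
    rintro a (ha | ⟨f, hf, hB, rfl⟩)
    · exact rapid_mem_smoothToeplitz ((isRapidDecay_iff a).1 ha)
    · exact T_mem_smoothToeplitz hf hB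
  · rintro a ⟨f, hf, hB, ha⟩
    rw [← sub_add_cancel a (T f)]
    exact add_mem (StarAlgebra.subset_adjoin ℂ _ (Or.inl ((isRapidDecay_iff _).2 ha)))
      (StarAlgebra.subset_adjoin ℂ _ (Or.inr ⟨f, hf, hB, rfl⟩))

/-- Commutators are of rapid decay, because the symbols commute. -/
theorem rapid_commutator {a b : Ell2 →L[ℂ] Ell2} (ha : a ∈ smoothToeplitz ⊤)
    (hb : b ∈ smoothToeplitz ⊤) : Rapid (a * b - b * a) := by
  obtain ⟨f, hf, -, ha⟩ := ha
  obtain ⟨g, hg, -, hb⟩ := hb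
  have h := (rapid_mul_sub hf hg ha hb).sub (rapid_mul_sub hg hf hb ha)
  rwa [mul_comm g f, sub_sub_sub_cancel_right] at h

theorem S_eq_T : S = T (fourier 1) := by
  refine ext_coef fun i j => ?_
  rw [coef_T, S_e, e_apply, fourierCoeff_fourier]
  by_cases h : i = j + 1
  · subst h
    simp
  · have : (i : ℤ) - j ≠ 1 := by omega
    simp [h, this]

theorem Sadj_eq_T : Sadj = T (fourier (-1)) := by
  have h : (fourier (-1) : C(Circ, ℂ)) = star (fourier 1) := by
    ext x
    exact fourier_neg
  rw [h, T_star, ← S_eq_T]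
  rfl

theorem S_mem : S ∈ smoothToeplitz ⊤ :=
  S_eq_T ▸ T_mem_smoothToeplitz (isSmooth_fourier 1) trivial

theorem Sadj_mem : Sadj ∈ smoothToeplitz ⊤ :=
  Sadj_eq_T ▸ T_mem_smoothToeplitz (isSmooth_fourier (-1)) trivial

/-! ### Commutators with the number operator -/

/-- The entries of a matrix of rapid decay may be multiplied by polynomially bounded weights. -/
theorem Rapid.exists_weighted {k : Ell2 →L[ℂ] Ell2} (hk : Rapid k) (w : ℕ → ℕ → ℝ)
    (hw : ∀ i j, |w i j| ≤ (1 + i) * (1 + j)) :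
    ∃ d, Rapid d ∧ ∀ i j, (d (e j)) i = w i j * (k (e j)) i := by
  have hb : ∀ α : ℕ, ∃ C : ℝ, ∀ i j : ℕ, ‖(w i j : ℂ) * (k (e j)) i‖ *
      ((1 + i : ℝ) ^ α * (1 + j : ℝ) ^ α) ≤ C := by
    intro α
    obtain ⟨C, hC⟩ := hk (α + 1)
    refine ⟨C, fun i j => le_trans ?_ (hC () i j)⟩
    rw [norm_mul, Complex.norm_real, Real.norm_eq_abs]
    calc |w i j| * ‖(k (e j)) i‖ * ((1 + i : ℝ) ^ α * (1 + j : ℝ) ^ α)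
        ≤ ((1 + i) * (1 + j)) * ‖(k (e j)) i‖ * ((1 + i : ℝ) ^ α * (1 + j : ℝ) ^ α) := by
          gcongr
          exact hw i j
      _ = _ := by ring
  have hs : Summable fun p : ℕ × ℕ => ‖(w p.1 p.2 : ℂ) * (k (e p.2)) p.1‖ := by
    obtain ⟨C, hC⟩ := hb 2
    refine Summable.of_nonneg_of_le (fun _ => norm_nonneg _) (fun p => ?_)
      (summable_prod_inv.mul_left C)
    rw [← mul_inv, ← div_eq_mul_inv, le_div_iff₀ (by positivity)]
    exact hC p.1 p.2
  obtain ⟨d, -, hd⟩ := exists_hasSum_matUnit hs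
  refine ⟨d, fun α => ?_, hd⟩
  obtain ⟨C, hC⟩ := hb α
  refine ⟨C, fun _ i j => ?_⟩
  rw [hd]
  exact hC i j

/-- The commutator of `N` with `T f + k` again is an operator of this form: its symbol is `-i f'`. -/
theorem exists_coef_commutator {a : Ell2 →L[ℂ] Ell2} (ha : a ∈ smoothToeplitz ⊤) :
    ∃ d ∈ smoothToeplitz ⊤, ∀ i j, (d (e j)) i = ((i : ℂ) - j) * (a (e j)) i := by
  obtain ⟨f, hf, -, ha⟩ := ha
  have hfs := hf.smoothFam (ι := Unit)
  obtain ⟨h, -, hh⟩ := exists_fourierCoeff_eq (c := fun m => m * fourierCoeff f m)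
    (by simpa using hfs.summable_fourierCoeff 1)
  have hsm : IsSmooth h := by
    refine SmoothFam.isSmooth fun α => ?_
    obtain ⟨C, hC⟩ := hfs (α + 1)
    refine ⟨C, fun _ m => le_trans ?_ (hC () m)⟩
    rw [hh, norm_mul, Complex.norm_intCast, pow_succ]
    have : |(m : ℝ)| ≤ 1 + |(m : ℝ)| := by linarith
    calc |(m : ℝ)| * ‖fourierCoeff f m‖ * (1 + |(m : ℝ)|) ^ α
        ≤ (1 + |(m : ℝ)|) * ‖fourierCoeff f m‖ * (1 + |(m : ℝ)|) ^ α := by gcongr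
      _ = _ := by ring
  obtain ⟨k', hk', hk2⟩ := Rapid.exists_weighted ha (fun i j => (i : ℝ) - j) fun i j => by
    have hi : (0 : ℝ) ≤ i := Nat.cast_nonneg i
    have hj : (0 : ℝ) ≤ j := Nat.cast_nonneg j
    exact abs_le.2 ⟨by nlinarith [mul_nonneg hi hj], by nlinarith [mul_nonneg hi hj]⟩
  refine ⟨T h + k', add_mem (T_mem_smoothToeplitz hsm trivial) (rapid_mem_smoothToeplitz hk'),
    fun i j => ?_⟩
  have h1 : ((T h + k') (e j)) i = (T h (e j)) i + (k' (e j)) i := rfl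
  have h2 : ((a - T f) (e j)) i = (a (e j)) i - (T f (e j)) i := rfl
  rw [h1, hk2, h2, coef_T, coef_T, hh]
  push_cast
  ring

/-- An entrywise identity for the commutator with `N` holds for the operators, including domains. -/
theorem hasCommutator_number {a d : Ell2 →L[ℂ] Ell2}
    (h : ∀ i j, (d (e j)) i = ((i : ℂ) - j) * (a (e j)) i) :
    SpectralGeometry.HasCommutator number a d := by
  intro v
  have key : ∀ i : ℕ, (i : ℂ) * (a (v : Ell2)) i = (d (v : Ell2) + a (number v)) i := by
    intro i
    have h1 := (hasSum_apply a (v : Ell2) i).mul_left (i : ℂ)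
    have h2 := (hasSum_apply d (v : Ell2) i).add (hasSum_apply a (number v) i)
    refine h1.unique ?_
    have h3 : (fun m => (v : Ell2) m * (d (e m)) i + (number v) m * (a (e m)) i) =
        fun m => (i : ℂ) * ((v : Ell2) m * (a (e m)) i) := by
      funext m
      rw [h, number_apply]
      ring
    rw [h3] at h2
    exact h2
  have hv : a (v : Ell2) ∈ number.domain := by
    change Memℓp (fun n : ℕ => (n : ℂ) * (a (v : Ell2)) n) 2
    rw [funext key]
    exact (d (v : Ell2) + a (number v)).2
  refine ⟨hv, ?_⟩
  rw [sub_eq_iff_eq_add]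
  ext i
  rw [number_apply]
  exact key i

theorem exists_hasCommutator_number {a : Ell2 →L[ℂ] Ell2} (ha : a ∈ smoothToeplitz ⊤) :
    ∃ d ∈ smoothToeplitz ⊤, SpectralGeometry.HasCommutator number a d := by
  obtain ⟨d, hd, h⟩ := exists_coef_commutator ha
  exact ⟨d, hd, hasCommutator_number h⟩

theorem Rapid.exists_mul_number {k : Ell2 →L[ℂ] Ell2} (hk : Rapid k) :
    ∃ d, Rapid d ∧ ∀ v : number.domain, k (number v) = d (v : Ell2) := by
  obtain ⟨d, hd, h⟩ := hk.exists_weighted (fun _ j => (j : ℝ)) fun i j => by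
    have hi : (0 : ℝ) ≤ i := Nat.cast_nonneg i
    have hj : (0 : ℝ) ≤ j := Nat.cast_nonneg j
    rw [abs_of_nonneg hj]
    nlinarith [mul_nonneg hi hj]
  refine ⟨d, hd, fun v => ?_⟩
  ext i
  refine (hasSum_apply k (number v) i).unique ?_
  have h2 := hasSum_apply d (v : Ell2) i
  have h3 : (fun m => (v : Ell2) m * (d (e m)) i) = fun m => (number v) m * (k (e m)) i := by
    funext m
    rw [h, number_apply]
    push_cast
    ring
  rwa [h3] at h2

/-! ### The symbol map on the noncommutative surface -/

theorem mem_surface_iff (g : ℕ) (a : Ell2 →L[ℂ] Ell2) : a ∈ surface g ↔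
    ∃ h : a ∈ toeplitzAlgebra, symbol ⟨a, h⟩ ∈ boundaryAlgebra g := by
  constructor
  · rintro ⟨b, hb, rfl⟩
    exact ⟨b.2, hb⟩
  · rintro ⟨h, hb⟩
    exact ⟨⟨a, h⟩, hb, rfl⟩

theorem surface_le (g : ℕ) : surface g ≤ toeplitzAlgebra :=
  fun a ha => ((mem_surface_iff g a).1 ha).1

theorem norm_symbol_apply_le (a : toeplitzAlgebra) : ‖symbol a‖ ≤ ‖(a : Ell2 →L[ℂ] Ell2)‖ :=
  norm_symbol_le _ _ ((symbol_eq_iff a _).1 rfl)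

theorem continuous_symbol : Continuous symbol :=
  AddMonoidHomClass.continuous_of_bound symbol 1 fun a => by
    rw [one_mul]
    exact norm_symbol_apply_le a

theorem isClosed_boundaryAlgebra (g : ℕ) : IsClosed (boundaryAlgebra g : Set C(Circ, ℂ)) := by
  have h : (boundaryAlgebra g : Set C(Circ, ℂ)) = {f | Respects g f} := rfl
  rw [h]
  simp only [Respects, Set.ofPred_and, Set.ofPred_forall]
  refine IsClosed.inter ?_ ?_
  · refine isClosed_iInter fun _ => isClosed_iInter fun t => isClosed_iInter fun _ => ?_
    exact isClosed_eq (continuous_eval_const _) (continuous_eval_const _)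
  · refine isClosed_iInter fun _ => isClosed_iInter fun k => isClosed_iInter fun _ =>
      isClosed_iInter fun _ => isClosed_iInter fun t => isClosed_iInter fun _ => ?_
    exact isClosed_eq (continuous_eval_const _) (continuous_eval_const _)

theorem isClosed_surface (g : ℕ) : IsClosed (surface g : Set (Ell2 →L[ℂ] Ell2)) := by
  have h : (surface g : Set (Ell2 →L[ℂ] Ell2)) =
      Subtype.val '' (symbol ⁻¹' (boundaryAlgebra g : Set C(Circ, ℂ))) := by
    ext a
    constructor
    · intro ha
      obtain ⟨h1, h2⟩ := (mem_surface_iff g a).1 ha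
      exact ⟨⟨a, h1⟩, h2, rfl⟩
    · rintro ⟨b, hb, rfl⟩
      exact (mem_surface_iff g _).2 ⟨b.2, hb⟩
  rw [h]
  exact (StarSubalgebra.isClosed_topologicalClosure _).isClosedEmbedding_subtypeVal.isClosedMap _
    ((isClosed_boundaryAlgebra g).preimage continuous_symbol)

/-- The symbol map of the noncommutative surface. -/
def surfaceSymbol (g : ℕ) : surface g →⋆ₐ[ℂ] C(Circ, ℂ) :=
  symbol.comp (StarSubalgebra.inclusion (surface_le g))

theorem surfaceSymbol_mem {g : ℕ} (a : surface g) : surfaceSymbol g a ∈ boundaryAlgebra g :=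
  ((mem_surface_iff g a).1 a.2).2

theorem norm_surfaceSymbol_le {g : ℕ} (a : surface g) : ‖surfaceSymbol g a‖ ≤ ‖a‖ :=
  norm_symbol_apply_le _

/-- The symbol map as a continuous linear map. -/
def surfaceSymbolL (g : ℕ) : surface g →L[ℂ] C(Circ, ℂ) :=
  (surfaceSymbol g).toAlgHom.toLinearMap.mkContinuous 1 fun a => by
    rw [one_mul]
    exact norm_surfaceSymbol_le a

theorem surfaceSymbol_eq_of_rapid {g : ℕ} (a : surface g) {f : C(Circ, ℂ)}
    (h : Rapid ((a : Ell2 →L[ℂ] Ell2) - T f)) : surfaceSymbol g a = f :=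
  (symbol_eq_iff _ f).2 h.isCompactOperator

/-! ### Stability under holomorphic functional calculus -/

/-- A bound for a linear functional of a path integral, with a constant that does not depend on the
functional. -/
theorem exists_bound_pathIntegral {E : Type*} [NormedAddCommGroup E] [NormedSpace ℂ E]
    [CompleteSpace E] {γ : ℝ → ℂ} (hγ : ContDiffOn ℝ 1 γ (Set.Icc 0 1)) {F : ℂ → ℂ}
    (hF : ContinuousOn F (γ '' Set.Icc 0 1)) (R : ℂ → E) :
    ∃ C : ℝ, 0 ≤ C ∧ ∀ (l : E →L[ℂ] ℂ) (c : ℝ), (∀ t ∈ Set.Icc (0 : ℝ) 1, ‖l (R (γ t))‖ ≤ c) →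
      ‖l (∫ t in (0 : ℝ)..1, deriv γ t • (F (γ t) • R (γ t)))‖ ≤ C * c := by
  have h1 : ContinuousOn (derivWithin γ (Set.Icc 0 1)) (Set.Icc 0 1) :=
    hγ.continuousOn_derivWithin (uniqueDiffOn_Icc one_pos) le_rfl
  obtain ⟨A, hA⟩ := isCompact_Icc.exists_bound_of_continuousOn h1
  obtain ⟨B, hB⟩ := isCompact_Icc.exists_bound_of_continuousOn
    (hF.comp hγ.continuousOn (Set.mapsTo_image _ _))
  -- at the end point `1` the two-sided derivative need not be the one-sided one
  have hA' : ∀ t ∈ Set.Ioc (0 : ℝ) 1, ‖deriv γ t‖ ≤ max A ‖deriv γ 1‖ := by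
    intro t ht
    rcases ht.2.eq_or_lt with rfl | h
    · exact le_max_right _ _
    · rw [← derivWithin_of_mem_nhds (Icc_mem_nhds ht.1 h)]
      exact (hA t ⟨ht.1.le, ht.2⟩).trans (le_max_left _ _)
  have hB0 : 0 ≤ B := (norm_nonneg _).trans (hB 0 ⟨le_rfl, zero_le_one⟩)
  have hA0 : 0 ≤ max A ‖deriv γ 1‖ := (norm_nonneg _).trans (le_max_right _ _)
  refine ⟨max A ‖deriv γ 1‖ * B, mul_nonneg hA0 hB0, fun l c hc => ?_⟩
  have hc0 : 0 ≤ c := (norm_nonneg _).trans (hc 0 ⟨le_rfl, zero_le_one⟩)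
  by_cases hi : IntervalIntegrable (fun t => deriv γ t • (F (γ t) • R (γ t)))
      MeasureTheory.volume 0 1
  · rw [← l.intervalIntegral_comp_comm hi]
    refine (intervalIntegral.norm_integral_le_of_norm_le_const
      (C := max A ‖deriv γ 1‖ * B * c) fun t ht => ?_).trans (by simp)
    rw [Set.uIoc_of_le zero_le_one] at ht
    have ht' : t ∈ Set.Icc (0 : ℝ) 1 := ⟨ht.1.le, ht.2⟩
    rw [map_smul, map_smul, smul_eq_mul, smul_eq_mul, norm_mul, norm_mul, mul_assoc]
    exact mul_le_mul (hA' t ht) (mul_le_mul (hB t ht') (hc t ht') (norm_nonneg _) hB0)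
      (by positivity) hA0
  -- without integrability the integral is zero by convention, and the bound is trivial
  · rw [intervalIntegral.integral_undef hi, map_zero, norm_zero]
    positivity

section Resolvent

variable {ι : Type*} {a : Ell2 →L[ℂ] Ell2} {f : C(Circ, ℂ)} {z : ι → ℂ}
  {R : ι → (Ell2 →L[ℂ] Ell2)} {r : ι → C(Circ, ℂ)}

/-- The resolvents of `T f + k` differ from the Toeplitz operators of the resolvents of `f` by
operators of rapid decay. Here `T r` is a parametrix of `z - a`: with the remainders
`m = 1 - (z - a) T r` and `m' = 1 - T r (z - a)` one has `R = T r + m' T r + m' R m`. -/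
theorem rapidFam_resolvent_sub (hf : IsSmooth f) (ha : Rapid (a - T f))
    (hR1 : ∀ s, R s * (algebraMap ℂ _ (z s) - a) = 1)
    (hR2 : ∀ s, (algebraMap ℂ _ (z s) - a) * R s = 1) {M : ℝ} (hM : ∀ s, ‖R s‖ ≤ M)
    (hr : ∀ s, r s * (algebraMap ℂ C(Circ, ℂ) (z s) - f) = 1) (hrs : SmoothFam r) :
    RapidFam fun s => R s - T (r s) := by
  have hf' : SmoothFam fun _ : ι => f := hf.smoothFam
  have ha' : RapidFam fun _ : ι => a - T f := fun α => by
    obtain ⟨C, hC⟩ := ha α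
    exact ⟨C, fun _ i j => hC () i j⟩
  have hT : ∀ s, T (f * r s) = algebraMap ℂ _ (z s) * T (r s) - 1 := by
    intro s
    have h1 : f * r s = z s • r s - 1 := by
      have h2 := hr s
      rw [mul_sub, Algebra.algebraMap_eq_smul_one, mul_smul_comm, mul_one] at h2
      rw [← h2, mul_comm f]
      abel
    rw [h1, T_sub, T_smul, T_one, Algebra.algebraMap_eq_smul_one, smul_mul_assoc, one_mul]
  have hm : RapidFam fun s => 1 - (algebraMap ℂ _ (z s) - a) * T (r s) := by
    have h1 := (ha'.mul_bandFam hrs.bandFam_T).sub (hf'.rapidFam_semicommutator hrs)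
    refine (funext fun s => ?_ : (fun s => _) = _) ▸ h1
    rw [hT]
    noncomm_ring
  have hm' : RapidFam fun s => 1 - T (r s) * (algebraMap ℂ _ (z s) - a) := by
    have h1 := (ha'.bandFam_mul hrs.bandFam_T).sub (hrs.rapidFam_semicommutator hf')
    refine (funext fun s => ?_ : (fun s => _) = _) ▸ h1
    rw [mul_comm (r s) f, hT, Algebra.commutes]
    noncomm_ring
  have h2 := (hm'.mul_bandFam hrs.bandFam_T).add (hm'.mul_bounded_mul hm hM)
  refine (funext fun s => ?_ : (fun s => _) = _) ▸ h2
  have e1 : (1 - T (r s) * (algebraMap ℂ _ (z s) - a)) * R s = R s - T (r s) := by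
    rw [sub_mul, one_mul, mul_assoc, hR2, mul_one]
  have e2 : R s * (1 - (algebraMap ℂ _ (z s) - a) * T (r s)) = R s - T (r s) := by
    rw [mul_sub, mul_one, ← mul_assoc, hR1, one_mul]
  rw [mul_assoc, e2, ← mul_add, add_sub_cancel, e1]

end Resolvent

/-- The `(i, j)` entry of `b - T (σ b)`, as a continuous linear functional of `b`. -/
def remainderCoef (g i j : ℕ) : surface g →L[ℂ] ℂ :=
  (innerSL ℂ (e i)).comp ((ContinuousLinearMap.apply ℂ Ell2 (e j)).comp
    (surface g).toSubalgebra.toSubmodule.subtypeL) -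
  (fourierCoeffL ((i : ℤ) - j)).comp (surfaceSymbolL g)

theorem remainderCoef_apply (g i j : ℕ) (b : surface g) : remainderCoef g i j b =
    (((b : Ell2 →L[ℂ] Ell2) - T (surfaceSymbol g b)) (e j)) i := by
  have h : (((b : Ell2 →L[ℂ] Ell2) - T (surfaceSymbol g b)) (e j)) i =
    ((b : Ell2 →L[ℂ] Ell2) (e j)) i - (T (surfaceSymbol g b) (e j)) i := rfl
  rw [h, coef_T, ← fourierCoeffL_apply, ← inner_e_left]
  rfl

/-- The symbol of the Cauchy integral and its difference from the Toeplitz operator of this symbol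
inherit the bounds on the resolvents along the cycle, one coefficient at a time. -/
theorem isHolomorphicallyStable_smoothToeplitz (g : ℕ) :
    SpectralGeometry.IsHolomorphicallyStable
      {b : surface g | (b : Ell2 →L[ℂ] Ell2) ∈ smoothToeplitz (boundaryAlgebra g)} := by
  have hcs : CompleteSpace (surface g) := (isClosed_surface g).completeSpace_coe
  rintro a ⟨f, hf, hfB, ha⟩ U F hU hsp hF m γ hγ
  have hσ : surfaceSymbol g a = f := surfaceSymbol_eq_of_rapid a ha
  suffices h : ∀ j, ((∫ t in (0 : ℝ)..1, deriv (γ j) t • (F (γ j t) • resolvent a (γ j t)) :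
      surface g) : Ell2 →L[ℂ] Ell2) ∈ smoothToeplitz (boundaryAlgebra g) by
    change ((SpectralGeometry.cauchyCalculus F γ a : surface g) : Ell2 →L[ℂ] Ell2) ∈
      smoothToeplitz (boundaryAlgebra g)
    rw [SpectralGeometry.cauchyCalculus, SpectralGeometry.cycleIntegral]
    refine (smoothToeplitz _).smul_mem ?_ _
    have h2 := sum_mem (t := Finset.univ) fun (j : Fin m) _ => h j
    have h3 : ((∑ j, ∫ t in (0 : ℝ)..1, deriv (γ j) t • (F (γ j t) • resolvent a (γ j t)) :
        surface g) : Ell2 →L[ℂ] Ell2) =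
        ∑ j, ((∫ t in (0 : ℝ)..1, deriv (γ j) t • (F (γ j t) • resolvent a (γ j t)) :
          surface g) : Ell2 →L[ℂ] Ell2) := map_sum (surface g).subtype _ _
    rw [h3]
    exact h2
  intro j
  have hmem := hγ.mem j
  have hcont := (hγ.smooth j).continuousOn
  obtain ⟨C₀, hC₀, hbound⟩ := exists_bound_pathIntegral (hγ.smooth j) (F := F)
    (hF.continuousOn.mono (by rintro _ ⟨t, ht, rfl⟩; exact (hmem t ht).1)) (resolvent a)
  set X : surface g := ∫ t in (0 : ℝ)..1, deriv (γ j) t • (F (γ j t) • resolvent a (γ j t))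
  have hres : ∀ t ∈ Set.Icc (0 : ℝ) 1, γ j t ∈ resolventSet ℂ a := fun t ht => by
    simpa [spectrum] using (hmem t ht).2
  obtain ⟨M, hM⟩ := isCompact_Icc.exists_bound_of_continuousOn
    (f := fun t => resolvent a (γ j t)) (s := Set.Icc (0 : ℝ) 1) (fun t ht =>
      (spectrum.hasDerivAt_resolvent_const_left (hres t ht)).continuousAt.comp_continuousWithinAt
        (hcont t ht))
  set r : Set.Icc (0 : ℝ) 1 → C(Circ, ℂ) := fun s => surfaceSymbol g (resolvent a (γ j s))
  have hR1 : ∀ s : Set.Icc (0 : ℝ) 1,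
      resolvent a (γ j s) * (algebraMap ℂ (surface g) (γ j s) - a) = 1 := fun s =>
    Ring.inverse_mul_cancel _ (hres s s.2)
  have hR2 : ∀ s : Set.Icc (0 : ℝ) 1,
      (algebraMap ℂ (surface g) (γ j s) - a) * resolvent a (γ j s) = 1 := fun s =>
    Ring.mul_inverse_cancel _ (hres s s.2)
  have hr : ∀ s, r s * (algebraMap ℂ C(Circ, ℂ) (γ j s) - f) = 1 := fun s => by
    have h1 := congrArg (surfaceSymbol g) (hR1 s)
    rwa [map_mul, map_sub, hσ, map_one, AlgHomClass.commutes] at h1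
  have hrs : SmoothFam r := hf.smoothFam_reciprocal hr fun s =>
    (norm_surfaceSymbol_le _).trans (hM s s.2)
  have hK := rapidFam_resolvent_sub hf ha
    (R := fun s : Set.Icc (0 : ℝ) 1 => (resolvent a (γ j s) : surface g))
    (z := fun s : Set.Icc (0 : ℝ) 1 => γ j s) (fun s => congrArg Subtype.val (hR1 s))
    (fun s => congrArg Subtype.val (hR2 s)) (fun s => hM s s.2) hr hrs
  refine ⟨surfaceSymbol g X, SmoothFam.isSmooth fun α => ?_, surfaceSymbol_mem X, fun α => ?_⟩
  · obtain ⟨C, hC⟩ := hrs α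
    refine ⟨C₀ * C, fun _ n => ?_⟩
    have hw : (0 : ℝ) < (1 + |(n : ℝ)|) ^ α := by positivity
    have h1 := hbound ((fourierCoeffL n).comp (surfaceSymbolL g)) (C / (1 + |(n : ℝ)|) ^ α)
      fun t ht => by
        rw [le_div_iff₀ hw]
        have h2 := hC ⟨t, ht⟩ n
        rw [← fourierCoeffL_apply] at h2
        exact h2
    rw [← mul_div_assoc, le_div_iff₀ hw] at h1
    rw [← fourierCoeffL_apply]
    exact h1
  · obtain ⟨C, hC⟩ := hK α
    refine ⟨C₀ * C, fun _ k l => ?_⟩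
    have hw : (0 : ℝ) < (1 + k : ℝ) ^ α * (1 + l : ℝ) ^ α := by positivity
    have h1 := hbound (remainderCoef g k l) (C / ((1 + k : ℝ) ^ α * (1 + l : ℝ) ^ α))
      fun t ht => by
        rw [le_div_iff₀ hw, remainderCoef_apply]
        exact hC ⟨t, ht⟩ k l
    rw [← mul_div_assoc, le_div_iff₀ hw, remainderCoef_apply] at h1
    exact h1

/-! ### Compact operators and matrices of rapid decay -/

theorem T_mem_toeplitzAlgebra (f : C(Circ, ℂ)) : T f ∈ toeplitzAlgebra :=
  StarSubalgebra.le_topologicalClosure _ (StarAlgebra.subset_adjoin ℂ _ ⟨f, rfl⟩)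

theorem T_fourier_e (k : ℤ) (n : ℕ) :
    T (fourier k) (e n) = if 0 ≤ n + k then e (n + k).toNat else 0 := by
  ext i
  rw [coef_T, fourierCoeff_fourier]
  split_ifs with h
  · rw [e_apply, Pi.single_apply]
    congr 1
    exact propext ⟨fun _ => by omega, fun _ => by omega⟩
  · rw [Pi.single_apply, if_neg (by omega)]
    rfl

/-- The matrix units are `Sⁱ (1 - S S*) S*ʲ`. -/
theorem matUnit_mem_toeplitzAlgebra (p : ℕ × ℕ) : matUnit p ∈ toeplitzAlgebra := by
  obtain ⟨i, j⟩ := p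
  have h : matUnit (i, j) = T (fourier i) * (1 - T (fourier 1) * T (fourier (-1))) *
      T (fourier (-j)) := by
    refine ext_coef fun k l => ?_
    have h1 : matUnit (i, j) (e l) = (if l = j then 1 else 0 : ℂ) • e i := by
      simp only [matUnit, ContinuousLinearMap.smulRight_apply, innerSL_apply_apply, inner_e_left,
        e_apply, eq_comm]
    rw [h1, mul_apply_eq_comp, mul_apply_eq_comp,
      T_fourier_e (-j)]
    split_ifs with h2 h3 h3
    · subst h2
      simp [T_fourier_e]
    · omega
    · obtain ⟨m, hm⟩ : ∃ m : ℕ, ((l : ℤ) + -(j : ℤ)).toNat = m + 1 :=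
        ⟨((l : ℤ) + -(j : ℤ)).toNat - 1, by omega⟩
      rw [hm, sub_apply, mul_apply_eq_comp, T_fourier_e (-1)]
      have h5 : (((m + 1 : ℕ) : ℤ) + -1).toNat = m := by omega
      have h6 : ((m : ℤ) + 1).toNat = m + 1 := by omega
      rw [if_pos (by omega), h5, T_fourier_e, if_pos (by omega), h6]
      simp
    · simp
  rw [h]
  exact mul_mem (mul_mem (T_mem_toeplitzAlgebra _) (sub_mem (one_mem _)
    (mul_mem (T_mem_toeplitzAlgebra _) (T_mem_toeplitzAlgebra _)))) (T_mem_toeplitzAlgebra _)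

theorem Rapid.mem_toeplitzAlgebra {k : Ell2 →L[ℂ] Ell2} (hk : Rapid k) : k ∈ toeplitzAlgebra :=
  (StarSubalgebra.isClosed_topologicalClosure _).mem_of_tendsto hk.hasSum_matUnit
    (Eventually.of_forall fun _ => sum_mem fun p _ =>
      toeplitzAlgebra.smul_mem (matUnit_mem_toeplitzAlgebra p) _)

theorem smoothToeplitz_le_surface (g : ℕ) : smoothToeplitz (boundaryAlgebra g) ≤ surface g := by
  rintro a ⟨f, -, hB, ha⟩
  have h : a ∈ toeplitzAlgebra := by
    rw [← sub_add_cancel a (T f)]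
    exact add_mem ha.mem_toeplitzAlgebra (T_mem_toeplitzAlgebra f)
  refine (mem_surface_iff g a).2 ⟨h, ?_⟩
  rw [(symbol_eq_iff ⟨a, h⟩ f).2 ha.isCompactOperator]
  exact hB

/-- The projection onto the span of `e_0, …, e_{n-1}`. -/
def cutoff (n : ℕ) : Ell2 →L[ℂ] Ell2 := ∑ m ∈ Finset.range n, matUnit (m, m)

theorem cutoff_apply (n : ℕ) (x : Ell2) (i : ℕ) : (cutoff n x) i = if i < n then x i else 0 := by
  have h : cutoff n x = ∑ m ∈ Finset.range n, x m • e m := by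
    simp [cutoff, matUnit, inner_e_left]
  have h2 : ∀ s : Finset ℕ, ((∑ m ∈ s, x m • e m : Ell2)) i = if i ∈ s then x i else 0 := by
    intro s
    rw [← inner_e_left, inner_sum]
    simp [inner_smul_right, inner_e_left, e_apply]
  rw [h, h2]
  simp

theorem norm_cutoff_apply_le (n : ℕ) (x : Ell2) : ‖cutoff n x‖ ≤ ‖x‖ := by
  refine lp.norm_mono (by simp) fun i => ?_
  rw [cutoff_apply]
  split_ifs
  · exact le_rfl
  · simp

theorem norm_sub_cutoff_apply_le (n : ℕ) (x : Ell2) : ‖x - cutoff n x‖ ≤ ‖x‖ := by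
  refine lp.norm_mono (by simp) fun i => ?_
  have h : (x - cutoff n x) i = x i - (cutoff n x) i := rfl
  rw [h, cutoff_apply]
  split_ifs
  · simp
  · simp

theorem tendsto_cutoff_apply (x : Ell2) : Tendsto (fun n => cutoff n x) atTop (𝓝 x) := by
  refine (hasSum_e x).tendsto_sum_nat.congr fun n => ?_
  simp [cutoff, matUnit, inner_e_left]

theorem star_cutoff (n : ℕ) : star (cutoff n) = cutoff n := by
  refine ext_coef fun i j => ?_
  rw [coef_star, cutoff_apply, cutoff_apply, e_apply, e_apply]
  by_cases h : i = j
  · subst h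
    split_ifs <;> simp
  · simp [h, Ne.symm h]

/-- A compact operator is the norm limit of its upper rows. -/
theorem tendsto_cutoff_mul (K : Ell2 →L[ℂ] Ell2) (hK : IsCompactOperator K) :
    Tendsto (fun n => cutoff n * K) atTop (𝓝 K) := by
  rw [Metric.tendsto_atTop]
  intro ε hε
  have h2 := (IsCompactOperator.isCompact_closure_image_closedBall (𝕜₁ := ℂ) (𝕜₂ := ℂ)
    (σ₁₂ := RingHom.id ℂ) (f := K.toLinearMap) hK 1).totallyBounded.subset subset_closure
  obtain ⟨t, ht, hcov⟩ := Metric.totallyBounded_iff.1 h2 (ε / 4) (by positivity)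
  have h3 : ∀ᶠ n in atTop, ∀ y ∈ t, dist (cutoff n y) y < ε / 4 := by
    rw [eventually_all_finite ht]
    exact fun y _ => (Metric.tendsto_nhds.1 (tendsto_cutoff_apply y)) _ (by positivity)
  obtain ⟨n₀, hn₀⟩ := eventually_atTop.1 h3
  refine ⟨n₀, fun n hn => ?_⟩
  rw [dist_eq_norm]
  refine lt_of_le_of_lt (ContinuousLinearMap.opNorm_le_of_unit_norm (C := ε / 2) (by positivity)
    fun x hx => ?_) (by linarith)
  have h4 := hcov ⟨x, by simp [hx], rfl⟩
  simp only [Set.mem_iUnion, Metric.mem_ball, exists_prop] at h4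
  obtain ⟨y, hy, hxy⟩ := h4
  have h5 := hn₀ n hn y hy
  rw [dist_eq_norm] at h5 hxy
  have h6 : (cutoff n * K - K) x = (cutoff n y - y) -
      ((K x - y) - cutoff n (K x - y)) := by
    simp only [sub_apply, mul_apply_eq_comp, map_sub]
    abel
  rw [h6]
  refine (norm_sub_le _ _).trans ?_
  have h7 := norm_sub_cutoff_apply_le n (K x - y)
  have h8 : ‖K x - y‖ < ε / 4 := hxy
  linarith

theorem rapid_cutoff_mul_cutoff (K : Ell2 →L[ℂ] Ell2) (n : ℕ) :
    Rapid (cutoff n * K * cutoff n) := by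
  intro α
  refine ⟨‖K‖ * ((1 + n : ℝ) ^ α * (1 + n : ℝ) ^ α), fun _ i j => ?_⟩
  have h1 : ((cutoff n * K * cutoff n) (e j)) i = if i < n then (K (cutoff n (e j))) i else 0 :=
    cutoff_apply n _ i
  have h2 : cutoff n (e j) = if j < n then e j else 0 := by
    ext k
    rw [cutoff_apply, e_apply]
    by_cases h3 : k = j
    · subst h3
      split_ifs <;> simp_all [e_apply]
    · split_ifs <;> simp [e_apply, h3]
  rw [h1, h2]
  by_cases hi : i < n
  · by_cases hj : j < n
    · rw [if_pos hi, if_pos hj]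
      have h3 : (i : ℝ) ≤ n := by exact_mod_cast hi.le
      have h4 : (j : ℝ) ≤ n := by exact_mod_cast hj.le
      gcongr
      refine (norm_apply_le _ _).trans ((K.le_opNorm _).trans ?_)
      rw [norm_e, mul_one]
    · rw [if_pos hi, if_neg hj, map_zero]
      have : ‖(0 : Ell2) i‖ = 0 := norm_zero
      rw [this, zero_mul]
      positivity
  · rw [if_neg hi, norm_zero, zero_mul]
    positivity

/-- The finite corners of a compact operator converge to it in norm. -/
theorem mem_closure_rapid (K : Ell2 →L[ℂ] Ell2) (hK : IsCompactOperator K) :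
    K ∈ closure {k : Ell2 →L[ℂ] Ell2 | Rapid k} := by
  have h1 := tendsto_cutoff_mul K hK
  have h2 : Tendsto (fun n => K * cutoff n) atTop (𝓝 K) := by
    have h3 := tendsto_cutoff_mul (star K) (isCompactOperator_adjoint K hK)
    have h4 := (continuous_star.tendsto _).comp h3
    rw [star_star] at h4
    refine h4.congr fun n => ?_
    simp [star_cutoff]
  refine mem_closure_of_tendsto (f := fun n => cutoff n * K * cutoff n) (b := atTop) ?_
    (Eventually.of_forall fun n => rapid_cutoff_mul_cutoff K n)
  rw [tendsto_iff_norm_sub_tendsto_zero] at h1 h2 ⊢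
  refine squeeze_zero (fun _ => norm_nonneg _) (fun n => ?_) (by simpa using h1.add h2)
  have h3 : cutoff n * K * cutoff n - K = (cutoff n * K - K) + cutoff n * (K * cutoff n - K) := by
    noncomm_ring
  rw [h3]
  refine (norm_add_le _ _).trans (add_le_add_right ?_ _)
  refine (norm_mul_le _ _).trans (mul_le_of_le_one_left (norm_nonneg _) ?_)
  exact ContinuousLinearMap.opNorm_le_bound _ zero_le_one fun x => by
    rw [one_mul]
    exact norm_cutoff_apply_le n x

theorem surface_subset_closure {g : ℕ}
    (hd : (boundaryAlgebra g : Set C(Circ, ℂ)) ⊆ closure {f | IsSmooth f ∧ f ∈ boundaryAlgebra g}) :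
    (surface g : Set (Ell2 →L[ℂ] Ell2)) ⊆
      closure (smoothToeplitz (boundaryAlgebra g) : Set (Ell2 →L[ℂ] Ell2)) := by
  intro a ha
  obtain ⟨h1, h2⟩ := (mem_surface_iff g a).1 ha
  have h3 : IsCompactOperator (a - T (symbol ⟨a, h1⟩)) := (symbol_eq_iff ⟨a, h1⟩ _).1 rfl
  have h4 : a - T (symbol ⟨a, h1⟩) ∈ (smoothToeplitz (boundaryAlgebra g)).topologicalClosure :=
    closure_mono (fun k hk => rapid_mem_smoothToeplitz hk) (mem_closure_rapid _ h3)
  have h5 : T (symbol ⟨a, h1⟩) ∈ (smoothToeplitz (boundaryAlgebra g)).topologicalClosure :=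
    map_mem_closure continuous_T (hd h2) fun f hf => T_mem_smoothToeplitz hf.1 hf.2
  have h6 := add_mem h4 h5
  rwa [sub_add_cancel] at h6

/-! ### Density of the smooth functions in the boundary algebra -/

/-- The Stone–Weierstrass theorem for star subalgebras that need not separate points: the closure
contains every continuous function that is constant wherever the subalgebra is. -/
theorem mem_topologicalClosure_of_fibers {X : Type*} [TopologicalSpace X] [CompactSpace X]
    (A : StarSubalgebra ℂ C(X, ℂ)) (f : C(X, ℂ))
    (h : ∀ x y, (∀ a ∈ A, a x = a y) → f x = f y) : f ∈ A.topologicalClosure := by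
  let r : Setoid X :=
    { r := fun x y => ∀ a ∈ A, a x = a y
      iseqv := ⟨fun _ _ _ => rfl, fun h a ha => (h a ha).symm,
        fun h1 h2 a ha => (h1 a ha).trans (h2 a ha)⟩ }
  let q : C(X, Quotient r) := ⟨Quotient.mk r, continuous_quotient_mk'⟩
  let φ : C(Quotient r, ℂ) →⋆ₐ[ℂ] C(X, ℂ) := ContinuousMap.compStarAlgHom' ℂ ℂ q
  have hφ : Continuous φ := ContinuousMap.continuous_precomp q
  have hsep : (A.comap φ).SeparatesPoints := by
    intro x y
    induction x using Quotient.inductionOn with | _ x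
    induction y using Quotient.inductionOn with | _ y
    intro hxy
    have h1 : ¬ ∀ a ∈ A, a x = a y := fun h2 => hxy (Quotient.sound h2)
    push Not at h1
    obtain ⟨a, ha, hne⟩ := h1
    let a' : C(Quotient r, ℂ) :=
      ⟨Quotient.lift a fun x y hxy => hxy a ha, a.continuous.quotient_lift _⟩
    have ha' : φ a' = a := ContinuousMap.ext fun _ => rfl
    refine ⟨a', ⟨a', ?_, rfl⟩, hne⟩
    change φ a' ∈ A
    rwa [ha']
  have htop := ContinuousMap.starSubalgebra_topologicalClosure_eq_top_of_separatesPoints _ hsep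
  let f' : C(Quotient r, ℂ) :=
    ⟨Quotient.lift f fun x y hxy => h x y hxy, f.continuous.quotient_lift _⟩
  have hf' : φ f' = f := ContinuousMap.ext fun _ => rfl
  have h2 : f' ∈ (A.comap φ).topologicalClosure := htop ▸ trivial
  rw [← hf']
  exact map_mem_closure hφ h2 fun a ha => ha

/-- The smooth functions that respect the identifications. -/
def smoothBoundary (g : ℕ) : StarSubalgebra ℂ C(Circ, ℂ) where
  carrier := {f | IsSmooth f ∧ f ∈ boundaryAlgebra g}
  mul_mem' ha hb := ⟨isSmooth_mul ha.1 hb.1, mul_mem ha.2 hb.2⟩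
  add_mem' ha hb := ⟨isSmooth_add ha.1 hb.1, add_mem ha.2 hb.2⟩
  algebraMap_mem' c := ⟨isSmooth_algebraMap c, (boundaryAlgebra g).algebraMap_mem c⟩
  star_mem' ha := ⟨isSmooth_star ha.1, star_mem ha.2⟩

/-- The continuous function on the circle that is given by a periodic function of the angle. -/
def ofPeriodic (G : ℝ → ℂ) (hp : Function.Periodic G (2 * Real.pi)) (hc : Continuous G) :
    C(Circ, ℂ) := ⟨hp.lift, continuous_coinduced_dom.2 hc⟩

theorem ofPeriodic_coe {G : ℝ → ℂ} (hp : Function.Periodic G (2 * Real.pi)) (hc : Continuous G)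
    (t : ℝ) : ofPeriodic G hp hc (t : Circ) = G t := rfl

theorem exists_coe_eq (x : Circ) : ∃ t : ℝ, 0 ≤ t ∧ t < 2 * Real.pi ∧ (t : Circ) = x := by
  refine ⟨(AddCircle.equivIco (2 * Real.pi) 0 x : ℝ), (AddCircle.equivIco _ 0 x).2.1, ?_,
    AddCircle.coe_equivIco⟩
  simpa using (AddCircle.equivIco (2 * Real.pi) 0 x).2.2

theorem coe_add_two_pi (t : ℝ) : ((t + 2 * Real.pi : ℝ) : Circ) = (t : Circ) :=
  AddCircle.coe_add_period _ t

/-- On the sphere `cos` separates the points of the quotient. -/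
theorem eq_of_smoothBoundary_zero {f : C(Circ, ℂ)} (hf : f ∈ boundaryAlgebra 0) (x y : Circ)
    (h : ∀ a ∈ smoothBoundary 0, a x = a y) : f x = f y := by
  have hper : Function.Periodic (fun t : ℝ => (Real.cos t : ℂ)) (2 * Real.pi) := fun t => by
    simp only [Real.cos_add_two_pi]
  have hcos : ofPeriodic (fun t : ℝ => (Real.cos t : ℂ)) hper (by fun_prop) ∈
      smoothBoundary 0 := by
    refine ⟨?_, fun _ t _ => ?_, fun h => by omega⟩
    · exact Complex.ofRealCLM.contDiff.comp Real.contDiff_cos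
    · rw [ofPeriodic_coe, ofPeriodic_coe, Real.cos_neg]
  have hrep : ∀ x : Circ, ∃ t ∈ Set.Icc 0 Real.pi, ∀ a ∈ boundaryAlgebra 0,
      a x = a ((t : ℝ) : Circ) := by
    intro x
    obtain ⟨t, h0, h1, rfl⟩ := exists_coe_eq x
    rcases le_total t Real.pi with h2 | h2
    · exact ⟨t, ⟨h0, h2⟩, fun _ _ => rfl⟩
    · refine ⟨2 * Real.pi - t, ⟨by linarith, by linarith⟩, fun a ha => ?_⟩
      have h3 := ha.1 rfl ((2 * Real.pi - t) / Real.pi)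
        ⟨div_nonneg (by linarith) Real.pi_pos.le, (div_le_one Real.pi_pos).2 (by linarith)⟩
      rw [mul_div_cancel₀ _ Real.pi_ne_zero] at h3
      rw [h3, ← coe_add_two_pi (-(2 * Real.pi - t))]
      congr 2
      ring
  obtain ⟨s, hs, hx⟩ := hrep x
  obtain ⟨t, ht, hy⟩ := hrep y
  have h1 := h _ hcos
  rw [hx _ hcos.2, hy _ hcos.2, ofPeriodic_coe, ofPeriodic_coe] at h1
  have h2 : s = t := Real.injOn_cos hs ht (by exact_mod_cast h1)
  rw [hx f hf, hy f hf, h2]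

section Positive

variable {g : ℕ}

/-- The angle `π (k - 1 + t) / 2g`: the point at the parameter `t` of the `k`-th edge. -/
def edge (g k : ℕ) (t : ℝ) : ℝ := Real.pi * ((k - 1 + t) / (2 * g))

/-- Every point of the circle is identified with a point of the edges in the upper half circle. -/
theorem exists_edge (hg : 1 ≤ g) (x : Circ) : ∃ k, 1 ≤ k ∧ k ≤ 2 * g ∧ ∃ t ∈ Set.Icc (0 : ℝ) 1,
    ∀ a ∈ boundaryAlgebra g, a x = a (edge g k t : Circ) := by
  obtain ⟨s, h0, h1, rfl⟩ := exists_coe_eq x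
  have hg' : (0 : ℝ) < g := by exact_mod_cast hg
  have hπ := Real.pi_pos
  set y : ℝ := s * (2 * g) / Real.pi with hy
  have hs : s = Real.pi * (y / (2 * g)) := by
    rw [hy]
    field_simp
  have hy0 : 0 ≤ y := by positivity
  have hy1 : y < 4 * g := by
    rw [hy, div_lt_iff₀ hπ]
    nlinarith
  have hn0 := Nat.floor_le hy0
  have hn1 := Nat.lt_floor_add_one y
  have hn2 : ⌊y⌋₊ < 4 * g := (Nat.floor_lt hy0).2 (by push_cast; exact hy1)
  by_cases hn : ⌊y⌋₊ < 2 * g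
  · refine ⟨⌊y⌋₊ + 1, by omega, by omega, y - ⌊y⌋₊, ⟨by linarith, by linarith⟩, fun a _ => ?_⟩
    have : edge g (⌊y⌋₊ + 1) (y - ⌊y⌋₊) = s := by
      rw [edge, hs]
      push_cast
      ring
    rw [this]
  · obtain ⟨m, hm⟩ := Nat.exists_eq_add_of_le (not_lt.1 hn)
    have hm' : (⌊y⌋₊ : ℝ) = 2 * g + m := by exact_mod_cast hm
    refine ⟨m + 1, by omega, by omega, 1 - (y - ⌊y⌋₊), ⟨by linarith, by linarith⟩, fun a ha => ?_⟩
    have h2 := ha.2 hg (m + 1) (by omega) (by omega) (1 - (y - ⌊y⌋₊)) ⟨by linarith, by linarith⟩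
    rw [edge, h2, hs]
    congr 4
    push_cast
    linarith

/-- All end points of edges are identified. -/
theorem vertex_eq (hg : 1 ≤ g) {f : C(Circ, ℂ)} (hf : f ∈ boundaryAlgebra g) (j : ℕ)
    (hj : j ≤ 2 * g) : f ((Real.pi * (j / (2 * g)) : ℝ) : Circ) = f ((0 : ℝ) : Circ) := by
  have hg' : (0 : ℝ) < g := by exact_mod_cast hg
  set V : ℕ → ℂ := fun j => f ((Real.pi * (j / (2 * g)) : ℝ) : Circ) with hV
  have hV0 : V 0 = f ((0 : ℝ) : Circ) := by simp [hV]
  have hV4 : V (4 * g) = V 0 := by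
    have h : Real.pi * ((4 * g : ℕ) / (2 * g)) = Real.pi * ((0 : ℕ) / (2 * g)) + 2 * Real.pi := by
      push_cast
      field_simp
      ring
    simp only [hV]
    rw [h, coe_add_two_pi]
  -- the two end points of the `k`-th edge
  have hstart : ∀ k, k < 2 * g → V k = V (2 * g + k + 1) := by
    intro k hk
    have h := hf.2 hg (k + 1) (by omega) (by omega) 0 ⟨le_rfl, zero_le_one⟩
    simp only [hV]
    convert h using 4 <;> push_cast <;> ring
  have hend : ∀ k, k < 2 * g → V (k + 1) = V (2 * g + k) := by
    intro k hk
    have h := hf.2 hg (k + 1) (by omega) (by omega) 1 ⟨zero_le_one, le_rfl⟩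
    simp only [hV]
    convert h using 4 <;> push_cast <;> ring
  have hstep : ∀ k, k + 2 ≤ 2 * g → V (k + 2) = V k := fun k hk =>
    (hend (k + 1) (by omega)).trans (hstart k (by omega)).symm
  have heven : ∀ m, 2 * m ≤ 2 * g → V (2 * m) = V 0 := by
    intro m
    induction m with
    | zero => intro _; rfl
    | succ m ih => exact fun h => (hstep (2 * m) (by omega)).trans (ih (by omega))
  have h1 : V 1 = V 0 := (hend 0 (by omega)).trans (heven g le_rfl)
  have hodd : ∀ m, 2 * m + 1 ≤ 2 * g → V (2 * m + 1) = V 0 := by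
    intro m
    induction m with
    | zero => intro _; exact h1
    | succ m ih => exact fun h => (hstep (2 * m + 1) (by omega)).trans (ih (by omega))
  change V j = _
  rw [← hV0]
  rcases Nat.even_or_odd' j with ⟨m, rfl | rfl⟩
  · exact heven m hj
  · exact hodd m hj

/-- A smooth even function of `x` that is supported on `|x| ≥ cos (π / 4g)`. -/
def edgeBump (g : ℕ) (x : ℝ) : ℝ :=
  expNegInvGlue (x - Real.cos (Real.pi / (4 * g))) +
    expNegInvGlue (-x - Real.cos (Real.pi / (4 * g)))

theorem contDiff_edgeBump (g : ℕ) : ContDiff ℝ ∞ (edgeBump g) :=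
  (expNegInvGlue.contDiff.comp (contDiff_id.sub contDiff_const)).add
    (expNegInvGlue.contDiff.comp (contDiff_neg.sub contDiff_const))

theorem edgeBump_neg (g : ℕ) (x : ℝ) : edgeBump g (-x) = edgeBump g x := by
  rw [edgeBump, edgeBump, neg_neg, add_comm]

theorem edgeBump_eq_zero {x : ℝ} (h : |x| ≤ Real.cos (Real.pi / (4 * g))) : edgeBump g x = 0 := by
  have h1 := abs_le.1 h
  rw [edgeBump, expNegInvGlue.zero_of_nonpos (by linarith),
    expNegInvGlue.zero_of_nonpos (by linarith), add_zero]

theorem edgeBump_pos {x : ℝ} (h : Real.cos (Real.pi / (4 * g)) < x) : 0 < edgeBump g x :=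
  add_pos_of_pos_of_nonneg (expNegInvGlue.pos_of_pos (by linarith)) (expNegInvGlue.nonneg _)

/-- The mid point of the `k`-th edge. -/
def center (g k : ℕ) : ℝ := edge g k (1 / 2)

/-- Points of other edges lie outside the support of the bump function of the `k`-th edge. -/
theorem edgeBump_cos_edge_of_ne (hg : 1 ≤ g) {k l : ℕ} (hk1 : 1 ≤ k) (hk : k ≤ 2 * g)
    (hl1 : 1 ≤ l) (hl : l ≤ 2 * g) (hkl : k ≠ l) {t : ℝ} (ht : t ∈ Set.Icc (0 : ℝ) 1) :
    edgeBump g (Real.cos (edge g l t - center g k)) = 0 := by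
  have hg' : (1 : ℝ) ≤ g := by exact_mod_cast hg
  have hπ := Real.pi_pos
  obtain ⟨ht0, ht1⟩ := ht
  set u := |edge g l t - center g k| with hu
  have hw : Real.pi / (4 * g) = Real.pi * ((1 / 2) / (2 * g)) := by field_simp; norm_num
  have hd : edge g l t - center g k = Real.pi * ((l - k + t - 1 / 2) / (2 * g)) := by
    rw [center, edge, edge]
    ring
  have habs : u = Real.pi * (|(l : ℝ) - k + t - 1 / 2| / (2 * g)) := by
    rw [hu, hd, abs_mul, abs_div, abs_of_pos hπ, abs_of_pos (show (0 : ℝ) < 2 * g by positivity)]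
  have h1 : 1 / 2 ≤ |(l : ℝ) - k + t - 1 / 2| ∧ |(l : ℝ) - k + t - 1 / 2| ≤ 2 * g - 1 / 2 := by
    have hk1' : (1 : ℝ) ≤ k := by exact_mod_cast hk1
    have hk' : (k : ℝ) ≤ 2 * g := by exact_mod_cast hk
    have hl1' : (1 : ℝ) ≤ l := by exact_mod_cast hl1
    have hl' : (l : ℝ) ≤ 2 * g := by exact_mod_cast hl
    refine ⟨?_, abs_le.2 ⟨by linarith, by linarith⟩⟩
    rcases lt_or_gt_of_ne hkl with h | h
    · have : (k : ℝ) + 1 ≤ l := by exact_mod_cast h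
      exact le_trans (by linarith) (le_abs_self _)
    · have : (l : ℝ) + 1 ≤ k := by exact_mod_cast h
      exact le_trans (by linarith) (neg_le_abs _)
  have h2 : Real.pi / (4 * g) ≤ u := by
    rw [hw, habs]
    gcongr
    exact h1.1
  have h3 : u ≤ Real.pi - Real.pi / (4 * g) := by
    have : Real.pi - Real.pi / (4 * g) = Real.pi * ((2 * g - 1 / 2) / (2 * g)) := by
      field_simp
      ring
    rw [this, habs]
    gcongr
    exact h1.2
  have h4 : 0 < Real.pi / (4 * g) := by positivity
  apply edgeBump_eq_zero
  rw [← Real.cos_abs, ← hu, abs_le]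
  constructor
  · rw [← Real.cos_pi_sub]
    exact Real.cos_le_cos_of_nonneg_of_le_pi (by linarith) (by linarith) h3
  · exact Real.cos_le_cos_of_nonneg_of_le_pi h4.le (by linarith) h2

theorem cos_opposite (hg : 1 ≤ g) (k l : ℕ) (t : ℝ) :
    Real.pi * ((2 * g + l - t) / (2 * g)) - center g k =
      Real.pi - (edge g k t - center g l) := by
  have hg' : (0 : ℝ) < g := by exact_mod_cast hg
  rw [center, center, edge, edge, edge]
  field_simp
  ring

/-- Smooth functions that are supported on the `k`-th edge and its partner, and that respect the
identification `θ ↦ π - θ` (with respect to the mid point of the edge) of the two. -/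
theorem edgeFunction_mem (hg : 1 ≤ g) {k : ℕ} (hk1 : 1 ≤ k) (hk : k ≤ 2 * g) {p : ℝ → ℝ}
    (hp : ContDiff ℝ ∞ p) (hp2 : Function.Periodic p (2 * Real.pi))
    (hpsymm : ∀ u, p (Real.pi - u) = p u) :
    ∃ a ∈ smoothBoundary g, ∀ t : ℝ, a (t : Circ) =
      ((p (t - center g k) * edgeBump g (Real.cos (t - center g k)) : ℝ) : ℂ) := by
  have hsm : ContDiff ℝ ∞ fun t : ℝ =>
      ((p (t - center g k) * edgeBump g (Real.cos (t - center g k)) : ℝ) : ℂ) :=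
    Complex.ofRealCLM.contDiff.comp ((hp.comp (contDiff_id.sub contDiff_const)).mul
      ((contDiff_edgeBump g).comp (Real.contDiff_cos.comp (contDiff_id.sub contDiff_const))))
  have hper : Function.Periodic (fun t : ℝ =>
      ((p (t - center g k) * edgeBump g (Real.cos (t - center g k)) : ℝ) : ℂ)) (2 * Real.pi) := by
    intro t
    have h1 : t + 2 * Real.pi - center g k = (t - center g k) + 2 * Real.pi := by ring
    simp only [h1, hp2 (t - center g k), Real.cos_add_two_pi]
  refine ⟨ofPeriodic _ hper hsm.continuous, ⟨hsm, fun h => by omega, fun _ l hl1 hl t ht => ?_⟩,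
    ofPeriodic_coe _ _⟩
  rw [ofPeriodic_coe, ofPeriodic_coe, cos_opposite hg, Real.cos_pi_sub, edgeBump_neg]
  change ((p (edge g l t - center g k) * edgeBump g (Real.cos (edge g l t - center g k)) : ℝ) : ℂ) =
    _
  by_cases hkl : k = l
  · subst hkl
    rw [hpsymm]
  · rw [edgeBump_cos_edge_of_ne hg hk1 hk hl1 hl hkl ht,
      edgeBump_cos_edge_of_ne hg hl1 hl hk1 hk (Ne.symm hkl) ht, mul_zero, mul_zero]

/-- The bump function of the `k`-th edge separates its interior from the other edges, and its product
with the sine separates the points of the edge. -/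
theorem edge_eq_of_interior (hg : 1 ≤ g) {k l : ℕ} (hk1 : 1 ≤ k) (hk : k ≤ 2 * g) (hl1 : 1 ≤ l)
    (hl : l ≤ 2 * g) {s t : ℝ} (hs : s ∈ Set.Ioo (0 : ℝ) 1) (ht : t ∈ Set.Icc (0 : ℝ) 1)
    (h : ∀ a ∈ smoothBoundary g, a (edge g k s : Circ) = a (edge g l t : Circ)) :
    edge g k s = edge g l t := by
  have hg' : (1 : ℝ) ≤ g := by exact_mod_cast hg
  have hπ := Real.pi_pos
  have hd : ∀ t : ℝ, edge g k t - center g k = Real.pi * ((t - 1 / 2) / (2 * g)) := fun t => by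
    rw [center, edge, edge]
    ring
  have hw : Real.pi / (4 * g) = Real.pi * ((1 / 2) / (2 * g)) := by field_simp; norm_num
  have hw2 : Real.pi / (4 * g) ≤ Real.pi / 2 := by
    rw [hw, div_eq_mul_inv Real.pi]
    gcongr
    rw [div_le_iff₀ (by positivity)]
    linarith
  obtain ⟨q, hq, hq'⟩ := edgeFunction_mem hg hk1 hk (p := fun _ => 1) contDiff_const
    (fun _ => rfl) fun _ => rfl
  obtain ⟨r, hr, hr'⟩ := edgeFunction_mem hg hk1 hk (p := Real.sin) Real.contDiff_sin
    Real.sin_periodic Real.sin_pi_sub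
  have h1 := h q hq
  have h2 := h r hr
  rw [hq', hq'] at h1
  rw [hr', hr'] at h2
  have h3 : edgeBump g (Real.cos (edge g k s - center g k)) ≠ 0 := by
    refine (edgeBump_pos ?_).ne'
    rw [← Real.cos_abs (edge g k s - center g k)]
    refine Real.cos_lt_cos_of_nonneg_of_le_pi (abs_nonneg _) (by linarith) ?_
    rw [hd, hw, abs_mul, abs_of_pos hπ, abs_div, abs_of_pos (show (0 : ℝ) < 2 * g by positivity)]
    gcongr
    exact abs_lt.2 ⟨by linarith [hs.1], by linarith [hs.2]⟩
  have h1' : edgeBump g (Real.cos (edge g k s - center g k)) =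
      edgeBump g (Real.cos (edge g l t - center g k)) := by
    simpa using (Complex.ofReal_injective h1)
  have h2' := Complex.ofReal_injective h2
  have hkl : k = l := by
    by_contra hkl
    rw [edgeBump_cos_edge_of_ne hg hk1 hk hl1 hl hkl ht] at h1'
    exact h3 h1'
  subst hkl
  rw [← h1'] at h2'
  have h4 := mul_right_cancel₀ h3 h2'
  have hmem : ∀ t ∈ Set.Icc (0 : ℝ) 1,
      edge g k t - center g k ∈ Set.Icc (-(Real.pi / 2)) (Real.pi / 2) := by
    intro t ht
    have : |edge g k t - center g k| ≤ Real.pi / (4 * g) := by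
      rw [hd, hw, abs_mul, abs_of_pos hπ, abs_div, abs_of_pos (show (0 : ℝ) < 2 * g by positivity)]
      gcongr
      exact abs_le.2 ⟨by linarith [ht.1], by linarith [ht.2]⟩
    have h5 := abs_le.1 this
    exact ⟨by linarith, by linarith⟩
  have h6 := Real.injOn_sin (hmem s ⟨hs.1.le, hs.2.le⟩) (hmem t ht) h4
  linarith

theorem eq_of_smoothBoundary (hg : 1 ≤ g) {f : C(Circ, ℂ)} (hf : f ∈ boundaryAlgebra g)
    (x y : Circ) (h : ∀ a ∈ smoothBoundary g, a x = a y) : f x = f y := by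
  obtain ⟨k, hk1, hk, s, hs, hx⟩ := exists_edge hg x
  obtain ⟨l, hl1, hl, t, ht, hy⟩ := exists_edge hg y
  have h' : ∀ a ∈ smoothBoundary g, a (edge g k s : Circ) = a (edge g l t : Circ) := fun a ha => by
    rw [← hx a ha.2, ← hy a ha.2, h a ha]
  rw [hx f hf, hy f hf]
  have hvert : ∀ k, 1 ≤ k → k ≤ 2 * g → ∀ t ∈ Set.Icc (0 : ℝ) 1, t ∉ Set.Ioo (0 : ℝ) 1 →
      f (edge g k t : Circ) = f ((0 : ℝ) : Circ) := by
    intro k hk1 hk t ht ht'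
    obtain ⟨j, rfl⟩ := Nat.exists_eq_add_of_le' hk1
    have : t = 0 ∨ t = 1 := by
      by_contra hne
      push Not at hne
      exact ht' ⟨lt_of_le_of_ne ht.1 hne.1.symm, lt_of_le_of_ne ht.2 hne.2⟩
    rcases this with rfl | rfl
    · rw [← vertex_eq hg hf j (by omega), edge]
      congr 4
      push_cast
      ring
    · rw [← vertex_eq hg hf (j + 1) (by omega), edge]
      congr 4
      push_cast
      ring
  by_cases h1 : s ∈ Set.Ioo (0 : ℝ) 1
  · rw [edge_eq_of_interior hg hk1 hk hl1 hl h1 ht h']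
  · by_cases h2 : t ∈ Set.Ioo (0 : ℝ) 1
    · rw [edge_eq_of_interior hg hl1 hl hk1 hk h2 hs fun a ha => (h' a ha).symm]
    · rw [hvert k hk1 hk s hs h1, hvert l hl1 hl t ht h2]

end Positive

theorem boundaryAlgebra_subset_closure (g : ℕ) : (boundaryAlgebra g : Set C(Circ, ℂ)) ⊆
    closure {f | IsSmooth f ∧ f ∈ boundaryAlgebra g} := by
  intro f hf
  refine mem_topologicalClosure_of_fibers (smoothBoundary g) f fun x y h => ?_
  rcases Nat.eq_zero_or_pos g with rfl | hg
  · exact eq_of_smoothBoundary_zero hf x y h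
  · exact eq_of_smoothBoundary hg hf x y h

end QuantumSurface

namespace SpectralGeometry

open Filter

section Diagonal

variable {H : Type*} [NormedAddCommGroup H] [InnerProductSpace ℂ H]
  {ι : Type*} {b : HilbertBasis ι ℂ H}

/-! ### Diagonal operators with respect to a Hilbert basis -/

theorem ext_inner_basis {x y : H} (h : ∀ k, ⟪b k, x⟫_ℂ = ⟪b k, y⟫_ℂ) : x = y := by
  apply b.repr.injective
  ext k
  rw [b.repr_apply_apply, b.repr_apply_apply, h]

theorem hasSum_norm_inner_sq (b : HilbertBasis ι ℂ H) (x : H) :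
    HasSum (fun k => ‖⟪b k, x⟫_ℂ‖ ^ 2) (‖x‖ ^ 2) := by
  have h1 := Complex.hasSum_re (b.hasSum_inner_mul_inner x x)
  have h2 : ∀ k, (⟪x, b k⟫_ℂ * ⟪b k, x⟫_ℂ).re = ‖⟪b k, x⟫_ℂ‖ ^ 2 := fun k => by
    rw [← inner_conj_symm x (b k), RCLike.conj_mul]
    norm_cast
  simp only [h2] at h1
  rw [inner_self_eq_norm_sq_to_K] at h1
  convert h1
  norm_cast

theorem norm_le_of_inner_le (b : HilbertBasis ι ℂ H) {x y : H} {C : ℝ} (hC : 0 ≤ C)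
    (h : ∀ k, ‖⟪b k, y⟫_ℂ‖ ≤ C * ‖⟪b k, x⟫_ℂ‖) : ‖y‖ ≤ C * ‖x‖ := by
  refine le_of_sq_le_sq ?_ (by positivity)
  rw [mul_pow]
  refine hasSum_le (fun k => ?_) (hasSum_norm_inner_sq b y)
    ((hasSum_norm_inner_sq b x).mul_left (C ^ 2))
  rw [← mul_pow]
  exact pow_le_pow_left₀ (norm_nonneg _) (h k) 2

theorem inner_basis_self [DecidableEq ι] (b : HilbertBasis ι ℂ H) (k l : ι) :
    ⟪b k, b l⟫_ℂ = if k = l then 1 else 0 := orthonormal_iff_ite.1 b.orthonormal k l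

theorem exists_mem_of_summable (b : HilbertBasis ι ℂ H) {c : ι → ℂ}
    (hc : Summable fun k => ‖c k‖ ^ 2) : ∃ y : H, ∀ k, ⟪b k, y⟫_ℂ = c k := by
  have h : Memℓp c 2 := (memℓp_gen_iff (by simp)).2 (by simpa using hc)
  refine ⟨b.repr.symm ⟨c, h⟩, fun k => ?_⟩
  rw [← b.repr_apply_apply, LinearIsometryEquiv.apply_symm_apply]

/-- Every bounded sequence is the diagonal of a bounded operator. -/
theorem exists_diagonal (b : HilbertBasis ι ℂ H) {μ : ι → ℂ} {C : ℝ} (hμ : ∀ k, ‖μ k‖ ≤ C) :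
    ∃ R : H →L[ℂ] H, ∀ x k, ⟪b k, R x⟫_ℂ = μ k * ⟪b k, x⟫_ℂ := by
  have hle : ∀ (x : H) k, ‖μ k * ⟪b k, x⟫_ℂ‖ ≤ max C 0 * ‖⟪b k, x⟫_ℂ‖ := fun x k => by
    rw [norm_mul]
    exact mul_le_mul_of_nonneg_right ((hμ k).trans (le_max_left _ _)) (norm_nonneg _)
  have h1 : ∀ x : H, ∃ y : H, ∀ k, ⟪b k, y⟫_ℂ = μ k * ⟪b k, x⟫_ℂ := fun x => by
    refine exists_mem_of_summable b (Summable.of_nonneg_of_le (fun _ => by positivity)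
      (fun k => pow_le_pow_left₀ (norm_nonneg _) (hle x k) 2) ?_)
    simp only [mul_pow]
    exact (hasSum_norm_inner_sq b x).summable.mul_left _
  choose R hR using h1
  refine ⟨LinearMap.mkContinuous
    { toFun := R
      map_add' := fun x y => ext_inner_basis (b := b) fun k => by
        rw [inner_add_right, hR, hR, hR, inner_add_right, mul_add]
      map_smul' := fun c x => ext_inner_basis (b := b) fun k => by
        rw [RingHom.id_apply, inner_smul_right, hR, hR, inner_smul_right, mul_left_comm] }
    (max C 0) fun x => norm_le_of_inner_le b (le_max_right _ _) fun k => ?_, fun x k => hR x k⟩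
  change ‖⟪b k, R x⟫_ℂ‖ ≤ _
  rw [hR]
  exact hle x k

theorem apply_basis_of_diagonal {R : H →L[ℂ] H} {μ : ι → ℂ}
    (hR : ∀ x k, ⟪b k, R x⟫_ℂ = μ k * ⟪b k, x⟫_ℂ) (k : ι) : R (b k) = μ k • b k := by
  classical
  refine ext_inner_basis (b := b) fun l => ?_
  rw [hR, inner_smul_right, inner_basis_self]
  split_ifs with hl
  · rw [hl]
  · simp

theorem isCompactOperator_rankOne (u v : H) :
    IsCompactOperator ((innerSL ℂ u).smulRight v : H →L[ℂ] H) := by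
  have h : IsCompactOperator (innerSL ℂ u : H →L[ℂ] ℂ) :=
    isCompactOperator_of_locallyCompactSpace_dom (innerSL ℂ u : H →L[ℂ] ℂ)
  exact h.clm_comp (ContinuousLinearMap.toSpanSingleton ℂ v)

/-- A bounded diagonal operator whose diagonal tends to zero is compact. -/
theorem isCompactOperator_of_tendsto_diagonal [CompleteSpace H] {μ : ι → ℂ}
    (hμ : Tendsto μ cofinite (𝓝 0)) {R : H →L[ℂ] H}
    (hR : ∀ x k, ⟪b k, R x⟫_ℂ = μ k * ⟪b k, x⟫_ℂ) : IsCompactOperator R := by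
  classical
  refine isCompactOperator_of_tendsto (l := (atTop : Filter (Finset ι)))
    (F := fun s => ∑ k ∈ s, (innerSL ℂ (b k)).smulRight (μ k • b k)) ?_
    (Eventually.of_forall fun s => ?_)
  · rw [Metric.tendsto_nhds]
    intro ε hε
    have h1 : {k | ¬ ‖μ k‖ < ε / 2}.Finite := by
      have := Metric.tendsto_nhds.1 hμ (ε / 2) (by positivity)
      simpa using this
    filter_upwards [eventually_ge_atTop h1.toFinset] with s hs
    rw [dist_eq_norm]
    refine lt_of_le_of_lt (ContinuousLinearMap.opNorm_le_bound _ (M := ε / 2) (by positivity)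
      fun x => norm_le_of_inner_le b (by positivity) fun k => ?_) (by linarith)
    have h2 : ⟪b k, (∑ k ∈ s, (innerSL ℂ (b k)).smulRight (μ k • b k)) x⟫_ℂ =
        if k ∈ s then μ k * ⟪b k, x⟫_ℂ else 0 := by
      simp [inner_basis_self, mul_comm]
    rw [sub_apply, inner_sub_right, h2, hR]
    split_ifs with hk
    · rw [sub_self, norm_zero]
      positivity
    · rw [zero_sub, norm_neg, norm_mul]
      gcongr
      by_contra hlt
      exact hk (hs (by simpa using (not_le.1 hlt).le))
  · induction s using Finset.induction_on with
    | empty => simpa using isCompactOperator_zero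
    | insert k s hk ih =>
      rw [Finset.sum_insert hk]
      exact (isCompactOperator_rankOne _ _).add ih

/-- `D` is the self-adjoint operator with eigenvectors `b k` and eigenvalues `lam k`, on its maximal
domain. -/
structure IsDiagonal (D : H →ₗ.[ℂ] H) (b : HilbertBasis ι ℂ H) (lam : ι → ℝ) : Prop where
  mem_iff : ∀ x, x ∈ D.domain ↔ Summable fun k => lam k ^ 2 * ‖⟪b k, x⟫_ℂ‖ ^ 2
  inner_apply : ∀ (x : D.domain) k, ⟪b k, D x⟫_ℂ = lam k * ⟪b k, (x : H)⟫_ℂ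

namespace IsDiagonal

variable {D P : H →ₗ.[ℂ] H} {lam : ι → ℝ}

theorem basis_mem (h : IsDiagonal D b lam) (k : ι) : b k ∈ D.domain := by
  classical
  rw [h.mem_iff]
  refine summable_of_ne_finset_zero (s := {k}) fun l hl => ?_
  rw [inner_basis_self, if_neg (by simpa using hl)]
  simp

theorem apply_basis (h : IsDiagonal D b lam) (k : ι) :
    D ⟨b k, h.basis_mem k⟩ = (lam k : ℂ) • b k := by
  classical
  refine ext_inner_basis (b := b) fun l => ?_
  rw [h.inner_apply, inner_smul_right, inner_basis_self]
  split_ifs with hl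
  · rw [hl]
  · simp

theorem dense_domain (h : IsDiagonal D b lam) : Dense (D.domain : Set H) := by
  have h1 : Submodule.span ℂ (Set.range b) ≤ D.domain :=
    Submodule.span_le.2 (by rintro _ ⟨k, rfl⟩; exact h.basis_mem k)
  exact (Submodule.dense_iff_topologicalClosure_eq_top.2 b.dense_span).mono h1

theorem isSelfAdjoint [CompleteSpace H] (h : IsDiagonal D b lam) : IsSelfAdjoint D := by
  rw [LinearPMap.isSelfAdjoint_def]
  have hsymm : D.IsFormalAdjoint D := by
    intro x y
    have h1 := b.hasSum_inner_mul_inner (D x) y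
    have h2 := b.hasSum_inner_mul_inner (x : H) (D y)
    refine h1.unique ?_
    have h3 : (fun k => ⟪D x, b k⟫_ℂ * ⟪b k, (y : H)⟫_ℂ) =
        fun k => ⟪(x : H), b k⟫_ℂ * ⟪b k, D y⟫_ℂ := by
      funext k
      rw [h.inner_apply, ← inner_conj_symm (D x), h.inner_apply, map_mul, Complex.conj_ofReal,
        inner_conj_symm]
      ring
    rw [h3]
    exact h2
  refine le_antisymm ?_ (hsymm.le_adjoint h.dense_domain)
  have hfa := LinearPMap.adjoint_isFormalAdjoint h.dense_domain
  -- testing the adjoint on the basis vectors shows that its graph is contained in that of `D`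
  have key : ∀ (y : D.adjoint.domain) k,
      ⟪b k, D.adjoint y⟫_ℂ = lam k * ⟪b k, (y : H)⟫_ℂ := by
    intro y k
    have h1 := hfa y ⟨b k, h.basis_mem k⟩
    rw [h.apply_basis, inner_smul_right] at h1
    rw [← inner_conj_symm, h1, map_mul, Complex.conj_ofReal, inner_conj_symm]
  refine ⟨fun y hy => ?_, fun y x hyx => ?_⟩
  · rw [h.mem_iff]
    refine (hasSum_norm_inner_sq b (D.adjoint ⟨y, hy⟩)).summable.congr fun k => ?_
    rw [key ⟨y, hy⟩, norm_mul, Complex.norm_real, mul_pow, Real.norm_eq_abs, sq_abs]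
  · refine ext_inner_basis (b := b) fun k => ?_
    rw [key, h.inner_apply, hyx]

theorem isAbs [CompleteSpace H] (hD : IsDiagonal D b lam)
    (hP : IsDiagonal P b fun k => |lam k|) : IsAbs D P where
  selfAdjoint := hP.isSelfAdjoint
  nonneg v := by
    have h1 := Complex.hasSum_re (b.hasSum_inner_mul_inner (v : H) (P v))
    refine h1.nonneg fun k => ?_
    have h2 : ⟪(v : H), b k⟫_ℂ * ⟪b k, P v⟫_ℂ = ((|lam k| * ‖⟪b k, (v : H)⟫_ℂ‖ ^ 2 : ℝ) : ℂ) := by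
      rw [hP.inner_apply, ← inner_conj_symm (v : H) (b k), mul_left_comm, RCLike.conj_mul]
      push_cast
      rfl
    rw [h2, Complex.ofReal_re]
    positivity
  domain_eq := by
    ext x
    rw [hP.mem_iff, hD.mem_iff]
    simp only [sq_abs]
  norm_eq v h1 h2 := by
    refine (pow_left_inj₀ (norm_nonneg _) (norm_nonneg _) two_ne_zero).1 ?_
    refine (hasSum_norm_inner_sq b _).unique ?_
    have h3 := hasSum_norm_inner_sq b (D ⟨v, h2⟩)
    have h4 : (fun k => ‖⟪b k, D ⟨v, h2⟩⟫_ℂ‖ ^ 2) = fun k => ‖⟪b k, P ⟨v, h1⟩⟫_ℂ‖ ^ 2 := by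
      funext k
      rw [hP.inner_apply, hD.inner_apply, norm_mul, norm_mul, Complex.norm_real, Complex.norm_real,
        Real.norm_eq_abs, Real.norm_eq_abs, abs_abs]
    rwa [h4] at h3

theorem inner_resolvent (h : IsDiagonal D b lam) {z : ℂ} {R : H →L[ℂ] H}
    (hR : IsResolventAt D z R) (k : ι) :
    (lam k : ℂ) - z ≠ 0 ∧ ∀ x, ⟪b k, R x⟫_ℂ = ((lam k : ℂ) - z)⁻¹ * ⟪b k, x⟫_ℂ := by
  classical
  have h1 : ∀ x, ((lam k : ℂ) - z) * ⟪b k, R x⟫_ℂ = ⟪b k, x⟫_ℂ := by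
    intro x
    obtain ⟨hx, hx2⟩ := hR.1 x
    have h2 := congrArg (fun y => ⟪b k, y⟫_ℂ) hx2
    simp only [inner_sub_right, inner_smul_right, h.inner_apply] at h2
    rw [sub_mul, h2]
  have h3 : (lam k : ℂ) - z ≠ 0 := by
    intro h0
    have h4 := h1 (b k)
    rw [h0, zero_mul, inner_basis_self, if_pos rfl] at h4
    exact zero_ne_one h4
  exact ⟨h3, fun x => by rw [← h1 x, inv_mul_cancel_left₀ h3]⟩

theorem isResolventAt (h : IsDiagonal D b lam) {z : ℂ} {δ : ℝ} (hδ : 0 < δ)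
    (hz : ∀ k, δ ≤ ‖(lam k : ℂ) - z‖) : ∃ R, IsResolventAt D z R := by
  have hne : ∀ k, (lam k : ℂ) - z ≠ 0 := fun k => norm_pos_iff.1 (hδ.trans_le (hz k))
  obtain ⟨R, hR⟩ := exists_diagonal b (μ := fun k => ((lam k : ℂ) - z)⁻¹) (C := δ⁻¹) fun k => by
    rw [norm_inv]
    exact inv_anti₀ hδ (hz k)
  refine ⟨R, fun x => ?_, fun x => ext_inner_basis (b := b) fun k => ?_⟩
  · have hx : R x ∈ D.domain := by
      rw [h.mem_iff]
      have h1 := ((hasSum_norm_inner_sq b x).summable.mul_left 2).add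
        ((hasSum_norm_inner_sq b (z • R x)).summable.mul_left 2)
      refine Summable.of_nonneg_of_le (fun k => by positivity) (fun k => ?_) h1
      have h2 : (lam k : ℂ) * ⟪b k, R x⟫_ℂ = ⟪b k, x⟫_ℂ + ⟪b k, z • R x⟫_ℂ := by
        rw [inner_smul_right, hR]
        field_simp [hne k]
        ring
      have h3 : lam k ^ 2 * ‖⟪b k, R x⟫_ℂ‖ ^ 2 = ‖(lam k : ℂ) * ⟪b k, R x⟫_ℂ‖ ^ 2 := by
        rw [norm_mul, Complex.norm_real, mul_pow, Real.norm_eq_abs, sq_abs]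
      rw [h3, h2]
      have h4 := norm_add_le (⟪b k, x⟫_ℂ) ⟪b k, z • R x⟫_ℂ
      have h5 := pow_le_pow_left₀ (norm_nonneg _) h4 2
      nlinarith [sq_nonneg (‖⟪b k, x⟫_ℂ‖ - ‖⟪b k, z • R x⟫_ℂ‖)]
    refine ⟨hx, ext_inner_basis (b := b) fun k => ?_⟩
    rw [inner_sub_right, inner_smul_right, h.inner_apply, ← sub_mul, hR,
      mul_inv_cancel_left₀ (hne k)]
  · rw [hR, inner_sub_right, inner_smul_right, h.inner_apply, ← sub_mul,
      inv_mul_cancel_left₀ (hne k)]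

theorem isCompactOperator_resolvent [CompleteSpace H] (h : IsDiagonal D b lam)
    (hlam : Tendsto (fun k => |lam k|) cofinite atTop) {z : ℂ} {R : H →L[ℂ] H}
    (hR : IsResolventAt D z R) : IsCompactOperator R := by
  refine isCompactOperator_of_tendsto_diagonal (μ := fun k => ((lam k : ℂ) - z)⁻¹) ?_
    fun x k => (h.inner_resolvent hR k).2 x
  refine tendsto_inv₀_cobounded.comp (tendsto_norm_atTop_iff_cobounded.1 ?_)
  refine tendsto_atTop_mono (fun k => ?_) (tendsto_atTop_add_const_right _ (-‖z‖) hlam)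
  have h1 := norm_sub_norm_le (lam k : ℂ) z
  rw [Complex.norm_real, Real.norm_eq_abs] at h1
  linarith

theorem opSpectrum_eq (h : IsDiagonal D b lam)
    (hlam : Tendsto (fun k => |lam k|) cofinite atTop) :
    opSpectrum D = Set.range fun k => (lam k : ℂ) := by
  ext z
  constructor
  · intro hz
    by_contra hne
    refine hz ?_
    have hpos : ∀ k, 0 < ‖(lam k : ℂ) - z‖ := fun k =>
      norm_pos_iff.2 fun h0 => hne ⟨k, sub_eq_zero.1 h0⟩
    have h1 : {k | ¬ ‖z‖ + 1 ≤ |lam k|}.Finite := hlam.eventually_ge_atTop (‖z‖ + 1)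
    obtain ⟨δ, hδ, hδ'⟩ : ∃ δ > 0, ∀ k ∈ h1.toFinset, δ ≤ ‖(lam k : ℂ) - z‖ := by
      rcases h1.toFinset.eq_empty_or_nonempty with he | hne
      · exact ⟨1, one_pos, fun k hk => absurd (he ▸ hk) (Finset.notMem_empty k)⟩
      · obtain ⟨k, hk, hmin⟩ := h1.toFinset.exists_min_image (fun k => ‖(lam k : ℂ) - z‖) hne
        exact ⟨_, hpos k, hmin⟩
    refine h.isResolventAt (δ := min δ 1) (lt_min hδ one_pos) fun k => ?_
    by_cases hk : ‖z‖ + 1 ≤ |lam k|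
    · refine (min_le_right _ _).trans ?_
      have h2 := norm_sub_norm_le (lam k : ℂ) z
      rw [Complex.norm_real, Real.norm_eq_abs] at h2
      linarith
    · exact (min_le_left _ _).trans (hδ' k (by simpa using hk))
  · rintro ⟨k, rfl⟩ ⟨R, hR⟩
    exact (h.inner_resolvent hR k).1 (sub_self _)

/-- The multiplicity is one if no diagonal entry is repeated. -/
theorem finrank_opEigenspace (h : IsDiagonal D b lam) (hinj : Function.Injective lam) (k : ι) :
    Module.finrank ℂ (opEigenspace D (lam k)) = 1 := by
  classical
  have h1 : opEigenspace D (lam k) = Submodule.span ℂ {b k} := by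
    apply le_antisymm
    · rintro _ ⟨x, hx, rfl⟩
      have hx' : D x = (lam k : ℂ) • (x : H) := sub_eq_zero.1 hx
      rw [Submodule.mem_span_singleton]
      refine ⟨⟪b k, (x : H)⟫_ℂ, ext_inner_basis (b := b) fun l => ?_⟩
      rw [inner_smul_right, inner_basis_self]
      split_ifs with hl
      · subst hl
        simp
      · have h2 := h.inner_apply x l
        rw [hx', inner_smul_right] at h2
        have h3 : ((lam k : ℂ) - lam l) * ⟪b l, (x : H)⟫_ℂ = 0 := by rw [sub_mul, h2, sub_self]
        rcases mul_eq_zero.1 h3 with h4 | h4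
        · exact absurd (hinj (Complex.ofReal_injective (sub_eq_zero.1 h4))).symm hl
        · rw [mul_zero]
          exact h4.symm
    · rw [Submodule.span_singleton_le_iff_mem]
      exact ⟨⟨b k, h.basis_mem k⟩, sub_eq_zero.2 (h.apply_basis k), rfl⟩
  rw [h1, finrank_span_singleton (b.orthonormal.ne_zero k)]

end IsDiagonal

end Diagonal

section Trace

variable {H : Type*} [NormedAddCommGroup H] [InnerProductSpace ℂ H] [CompleteSpace H]
  {ι κ : Type*}

/-! ### The trace and the functional calculus of diagonal operators -/

/-- The Hilbert–Schmidt norm of a self-adjoint operator may be computed in any basis. -/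
theorem summable_norm_sq_of_basis {Q : H →L[ℂ] H} (hQ : IsSelfAdjoint Q) (b : HilbertBasis ι ℂ H)
    (c : HilbertBasis κ ℂ H) (h : Summable fun i => ‖Q (c i)‖ ^ 2) :
    Summable fun k => ‖Q (b k)‖ ^ 2 := by
  have h1 : ∀ i k, ‖⟪b k, Q (c i)⟫_ℂ‖ ^ 2 = ‖⟪c i, Q (b k)⟫_ℂ‖ ^ 2 := by
    intro i k
    have h2 : ⟪b k, Q (c i)⟫_ℂ = ⟪Q (b k), c i⟫_ℂ := by
      rw [← ContinuousLinearMap.adjoint_inner_left, ← ContinuousLinearMap.star_eq_adjoint,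
        hQ.star_eq]
    rw [h2, norm_inner_symm]
  let F : κ × ι → ℝ := fun p => ‖⟪b p.2, Q (c p.1)⟫_ℂ‖ ^ 2
  have hF : 0 ≤ F := fun p => sq_nonneg _
  have h3 : Summable F := by
    refine (summable_prod_of_nonneg hF).2 ⟨fun i => ?_, ?_⟩
    · exact (hasSum_norm_inner_sq b (Q (c i))).summable
    · exact h.congr fun i => (hasSum_norm_inner_sq b (Q (c i))).tsum_eq.symm
  have hF' : 0 ≤ F ∘ Prod.swap := fun p => sq_nonneg _
  have h4 := ((summable_prod_of_nonneg hF').1 h3.prod_symm).2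
  refine h4.congr fun k => ?_
  have h5 : ∀ i, (F ∘ Prod.swap) (k, i) = ‖⟪c i, Q (b k)⟫_ℂ‖ ^ 2 := fun i => h1 i k
  simp only [h5]
  exact (hasSum_norm_inner_sq c _).tsum_eq

theorem cfc_apply_eigenvector {R : H →L[ℂ] H} (hR : IsSelfAdjoint R) {v : H} (hv : v ≠ 0) {t : ℝ}
    (h : R v = (t : ℂ) • v) {f : ℝ → ℝ} (hf : Continuous f) :
    cfc f R v = (f t : ℂ) • v := by
  have ht : t ∈ spectrum ℝ R := by
    intro hu
    obtain ⟨u, hu⟩ := hu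
    have h1 : (u : H →L[ℂ] H) v = 0 := by
      rw [hu, sub_apply, h, Algebra.algebraMap_eq_smul_one]
      simp
    have h2 : ((↑u⁻¹ : H →L[ℂ] H) * (u : H →L[ℂ] H)) v = 0 := by
      rw [mul_apply_eq_comp, h1, map_zero]
    rw [Units.inv_mul] at h2
    exact hv h2
  have key : ∀ F : C(spectrum ℝ R, ℝ), cfcHom hR F v = (F ⟨t, ht⟩ : ℂ) • v := by
    intro F
    induction F using ContinuousMap.induction_on_of_compact with
    | const r =>
      have : cfcHom hR (.const _ r) = algebraMap ℝ (H →L[ℂ] H) r := by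
        exact AlgHomClass.commutes (cfcHom hR) r
      rw [this, Algebra.algebraMap_eq_smul_one]
      simp
    | id =>
      rw [cfcHom_id hR, h]
      rfl
    | star_id =>
      rw [star_trivial, cfcHom_id hR, h]
      rfl
    | add F G hF hG =>
      rw [map_add, add_apply, hF, hG, ContinuousMap.add_apply, Complex.ofReal_add, add_smul]
    | mul F G hF hG =>
      rw [map_mul, mul_apply_eq_comp, hG, map_smul, hF, ContinuousMap.mul_apply, Complex.ofReal_mul,
        mul_comm, mul_smul]
    | frequently F hF =>
      have hc : IsClosed {F : C(spectrum ℝ R, ℝ) | cfcHom hR F v = (F ⟨t, ht⟩ : ℂ) • v} := by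
        refine isClosed_eq ?_ ?_
        · exact (ContinuousLinearMap.apply ℂ H v).continuous.comp (cfcHom_continuous hR)
        · exact (Complex.continuous_ofReal.comp (continuous_eval_const _)).smul continuous_const
      exact hc.mem_of_frequently_of_tendsto hF tendsto_id
  rw [cfc_apply f R hR hf.continuousOn]
  exact key _

variable {b : HilbertBasis ι ℂ H}

theorem isSelfAdjoint_of_diagonal {R : H →L[ℂ] H} {μ : ι → ℝ}
    (hR : ∀ x k, ⟪b k, R x⟫_ℂ = μ k * ⟪b k, x⟫_ℂ) : IsSelfAdjoint R := by
  rw [ContinuousLinearMap.isSelfAdjoint_iff']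
  refine (ContinuousLinearMap.eq_adjoint_iff _ _).2 (fun x y => ?_) |>.symm
  refine (b.hasSum_inner_mul_inner (R x) y).unique ?_
  have h : (fun k => ⟪R x, b k⟫_ℂ * ⟪b k, y⟫_ℂ) = fun k => ⟪x, b k⟫_ℂ * ⟪b k, R y⟫_ℂ := by
    funext k
    rw [hR, ← inner_conj_symm (R x), hR, map_mul, Complex.conj_ofReal, inner_conj_symm]
    ring
  rw [h]
  exact b.hasSum_inner_mul_inner x (R y)

/-- Bounded diagonal operators with nonnegative entries are positive, and are squares of operators
of the same kind. -/
theorem exists_sqrt_of_diagonal {R : H →L[ℂ] H} {μ : ι → ℝ} {C : ℝ} (h0 : ∀ k, 0 ≤ μ k)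
    (hC : ∀ k, μ k ≤ C) (hR : ∀ x k, ⟪b k, R x⟫_ℂ = μ k * ⟪b k, x⟫_ℂ) :
    ∃ Q : H →L[ℂ] H, IsSelfAdjoint Q ∧ R = Q * Q ∧
      ∀ x k, ⟪b k, Q x⟫_ℂ = (Real.sqrt (μ k) : ℝ) * ⟪b k, x⟫_ℂ := by
  obtain ⟨Q, hQ⟩ := exists_diagonal b (μ := fun k => ((Real.sqrt (μ k) : ℝ) : ℂ))
    (C := Real.sqrt C) fun k => by
      rw [Complex.norm_real, Real.norm_of_nonneg (Real.sqrt_nonneg _)]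
      exact Real.sqrt_le_sqrt (hC k)
  refine ⟨Q, isSelfAdjoint_of_diagonal hQ, ?_, hQ⟩
  ext1 x
  refine ext_inner_basis (b := b) fun k => ?_
  rw [mul_apply_eq_comp, hQ, hQ, hR, ← mul_assoc, ← Complex.ofReal_mul, Real.mul_self_sqrt (h0 k)]

theorem isTraceClass_cfc_rpow_of_diagonal {R : H →L[ℂ] H} {μ : ι → ℝ} {C p : ℝ}
    (h0 : ∀ k, 0 ≤ μ k) (hC : ∀ k, μ k ≤ C) (hR : ∀ x k, ⟪b k, R x⟫_ℂ = μ k * ⟪b k, x⟫_ℂ)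
    (hp : 0 ≤ p) (hs : Summable fun k => μ k ^ p) :
    IsTraceClass (cfc (fun t : ℝ => t ^ p) R) := by
  obtain ⟨Q, hQsa, hQQ, -⟩ := exists_sqrt_of_diagonal h0 hC hR
  have hR0 : 0 ≤ R := by
    have h := star_mul_self_nonneg Q
    rwa [hQsa.star_eq, ← hQQ] at h
  have hf : Continuous fun t : ℝ => t ^ p := Real.continuous_rpow_const hp
  have hpos : 0 ≤ cfc (fun t : ℝ => t ^ p) R :=
    cfc_nonneg fun t ht => Real.rpow_nonneg (spectrum_nonneg_of_nonneg hR0 ht) _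
  have hspan : ⊤ ≤ (Submodule.span ℂ (Set.range
      ((↑) : Set.range b → H))).topologicalClosure := by
    rw [Subtype.range_coe]
    exact b.dense_span.ge
  refine ⟨Set.range b, HilbertBasis.mk b.orthonormal.toSubtypeRange hspan, ?_⟩
  rw [CFC.abs_of_nonneg _ hpos, HilbertBasis.coe_mk,
    ← (Equiv.ofInjective _ b.orthonormal.linearIndependent.injective).summable_iff]
  refine hs.congr fun k => ?_
  change _ = RCLike.re ⟪b k, cfc (fun t : ℝ => t ^ p) R (b k)⟫_ℂ
  classical
  rw [cfc_apply_eigenvector (isSelfAdjoint_of_diagonal hR) (b.orthonormal.ne_zero k)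
    (apply_basis_of_diagonal hR k) hf, inner_smul_right, inner_basis_self, if_pos rfl, mul_one]
  exact (Complex.ofReal_re _).symm

/-- The trace of `R` is the squared Hilbert–Schmidt norm of the square root of `R`, and so may be
computed in the basis that diagonalises `R`. -/
theorem summable_of_isTraceClass_diagonal {R : H →L[ℂ] H} {μ : ι → ℝ} {C : ℝ}
    (h0 : ∀ k, 0 ≤ μ k) (hC : ∀ k, μ k ≤ C) (hR : ∀ x k, ⟪b k, R x⟫_ℂ = μ k * ⟪b k, x⟫_ℂ)
    (h : IsTraceClass (cfc (fun t : ℝ => t ^ (1 : ℝ)) R)) : Summable μ := by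
  obtain ⟨Q, hQsa, hQQ, hQ⟩ := exists_sqrt_of_diagonal h0 hC hR
  have hR0 : 0 ≤ R := by
    have h := star_mul_self_nonneg Q
    rwa [hQsa.star_eq, ← hQQ] at h
  obtain ⟨s, c, hc⟩ := h
  have h1 : cfc (fun t : ℝ => t ^ (1 : ℝ)) R = R := by
    simp only [Real.rpow_one]
    exact cfc_id' ℝ R (isSelfAdjoint_of_diagonal hR)
  rw [h1, CFC.abs_of_nonneg _ hR0] at hc
  refine (summable_norm_sq_of_basis hQsa b c ?_).congr fun k => ?_
  · refine hc.congr fun i => ?_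
    rw [hQQ, mul_apply_eq_comp, ← ContinuousLinearMap.adjoint_inner_left,
      ← ContinuousLinearMap.star_eq_adjoint, hQsa.star_eq]
    exact inner_self_eq_norm_sq (𝕜 := ℂ) _
  · rw [apply_basis_of_diagonal hQ, norm_smul, b.orthonormal.1, mul_one, Complex.norm_real,
      Real.norm_of_nonneg (Real.sqrt_nonneg _), Real.sq_sqrt (h0 k)]

end Trace

end SpectralGeometry

namespace QuantumSurface

open Filter SpectralGeometry

/-! ### The eigenbasis of the Dirac operator -/

theorem hil_ext {x y : Hil} (h1 : ∀ n, x.fst n = y.fst n) (h2 : ∀ n, x.snd n = y.snd n) :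
    x = y := by
  have h3 : x.fst = y.fst := lp.ext (funext h1)
  have h4 : x.snd = y.snd := lp.ext (funext h2)
  exact WithLp.ofLp_injective 2 (Prod.ext h3 h4)

theorem inner_vec (v w : Ell2) (x : Hil) : ⟪vec v w, x⟫_ℂ = ⟪v, x.fst⟫_ℂ + ⟪w, x.snd⟫_ℂ :=
  WithLp.prod_inner_apply _ _

theorem inner_eigenvec_zero (x : Hil) : ⟪eigenvec 0, x⟫_ℂ = x.snd 0 := by
  change ⟪vec 0 (e 0), x⟫_ℂ = _
  rw [inner_vec, inner_zero_left, inner_e_left, zero_add]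

theorem inner_eigenvec_succ (m : ℕ) (x : Hil) :
    ⟪eigenvec (m + 1 : ℕ), x⟫_ℂ = ((Real.sqrt 2)⁻¹ : ℂ) * (x.fst m + x.snd (m + 1)) := by
  change ⟪((Real.sqrt 2)⁻¹ : ℂ) • vec (e m) (e (m + 1)), x⟫_ℂ = _
  rw [inner_smul_left, inner_vec, inner_e_left, inner_e_left, map_inv₀, Complex.conj_ofReal]

theorem inner_eigenvec_negSucc (m : ℕ) (x : Hil) :
    ⟪eigenvec (Int.negSucc m), x⟫_ℂ = ((Real.sqrt 2)⁻¹ : ℂ) * (-x.fst m + x.snd (m + 1)) := by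
  change ⟪((Real.sqrt 2)⁻¹ : ℂ) • vec (-e m) (e (m + 1)), x⟫_ℂ = _
  rw [inner_smul_left, inner_vec, inner_neg_left, inner_e_left, inner_e_left, map_inv₀,
    Complex.conj_ofReal]

theorem sqrt_two_inv_sq : ((Real.sqrt 2)⁻¹ : ℂ) * ((Real.sqrt 2)⁻¹ : ℂ) = 2⁻¹ := by
  rw [← mul_inv]
  congr 1
  exact_mod_cast Real.mul_self_sqrt (by norm_num : (0 : ℝ) ≤ 2)

theorem eigenvec_zero_fst (n : ℕ) : (eigenvec 0).fst n = 0 := rfl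

theorem eigenvec_zero_snd (n : ℕ) : (eigenvec 0).snd n = if n = 0 then 1 else 0 := e_apply 0 n

theorem eigenvec_succ_fst (m n : ℕ) : (eigenvec (m + 1 : ℕ)).fst n =
    ((Real.sqrt 2)⁻¹ : ℂ) * if n = m then 1 else 0 :=
  congrArg (((Real.sqrt 2)⁻¹ : ℂ) * ·) (e_apply m n)

theorem eigenvec_succ_snd (m n : ℕ) : (eigenvec (m + 1 : ℕ)).snd n =
    ((Real.sqrt 2)⁻¹ : ℂ) * if n = m + 1 then 1 else 0 :=
  congrArg (((Real.sqrt 2)⁻¹ : ℂ) * ·) (e_apply (m + 1) n)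

theorem eigenvec_negSucc_fst (m n : ℕ) : (eigenvec (Int.negSucc m)).fst n =
    ((Real.sqrt 2)⁻¹ : ℂ) * -(if n = m then 1 else 0) :=
  congrArg (((Real.sqrt 2)⁻¹ : ℂ) * -·) (e_apply m n)

theorem eigenvec_negSucc_snd (m n : ℕ) : (eigenvec (Int.negSucc m)).snd n =
    ((Real.sqrt 2)⁻¹ : ℂ) * if n = m + 1 then 1 else 0 :=
  congrArg (((Real.sqrt 2)⁻¹ : ℂ) * ·) (e_apply (m + 1) n)

theorem int_cases {p : ℤ → Prop} (h0 : p 0) (hp : ∀ m : ℕ, p (m + 1 : ℕ))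
    (hn : ∀ m : ℕ, p (Int.negSucc m)) (k : ℤ) : p k := by
  rcases k with (_ | m) | m
  · exact h0
  · exact hp m
  · exact hn m

theorem orthonormal_eigenvec : Orthonormal ℂ eigenvec := by
  rw [orthonormal_iff_ite]
  intro k l
  induction k using int_cases with
  | h0 =>
    rw [inner_eigenvec_zero]
    induction l using int_cases with
    | h0 => simp [eigenvec_zero_snd]
    | hp m => rw [eigenvec_succ_snd, if_neg (by omega), if_neg (by omega), mul_zero]
    | hn m => rw [eigenvec_negSucc_snd, if_neg (by omega), if_neg (by omega), mul_zero]
  | hp j =>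
    rw [inner_eigenvec_succ]
    induction l using int_cases with
    | h0 => rw [eigenvec_zero_snd, eigenvec_zero_fst, if_neg (by omega), if_neg (by omega)]; simp
    | hp m =>
      rw [eigenvec_succ_snd, eigenvec_succ_fst]
      by_cases h : j = m
      · subst h
        rw [if_pos rfl, if_pos rfl, if_pos rfl, mul_one, mul_add, sqrt_two_inv_sq]
        norm_num
      · rw [if_neg h, if_neg (by omega), if_neg (by omega)]
        simp
    | hn m =>
      rw [eigenvec_negSucc_snd, eigenvec_negSucc_fst, if_neg (by omega : ¬ ((j + 1 : ℕ) : ℤ) = _)]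
      by_cases h : j = m
      · subst h
        simp
      · rw [if_neg h, if_neg (by omega)]
        simp
  | hn j =>
    rw [inner_eigenvec_negSucc]
    induction l using int_cases with
    | h0 => rw [eigenvec_zero_snd, eigenvec_zero_fst, if_neg (by omega), if_neg (by omega)]; simp
    | hp m =>
      rw [eigenvec_succ_snd, eigenvec_succ_fst, if_neg (by omega : ¬ Int.negSucc j = _)]
      by_cases h : j = m
      · subst h
        simp
      · rw [if_neg h, if_neg (by omega)]
        simp
    | hn m =>
      rw [eigenvec_negSucc_snd, eigenvec_negSucc_fst]
      by_cases h : j = m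
      · subst h
        rw [if_pos rfl, if_pos rfl, if_pos rfl, mul_one, mul_neg, neg_neg, mul_one, mul_add,
          sqrt_two_inv_sq]
        norm_num
      · rw [if_neg h, if_neg (by omega), if_neg (by omega)]
        simp

theorem span_eigenvec_orthogonal : (Submodule.span ℂ (Set.range eigenvec))ᗮ = ⊥ := by
  rw [Submodule.eq_bot_iff]
  intro x hx
  have h : ∀ k, ⟪eigenvec k, x⟫_ℂ = 0 := fun k =>
    (Submodule.mem_orthogonal _ _).1 hx _ (Submodule.subset_span ⟨k, rfl⟩)
  have hs : ((Real.sqrt 2)⁻¹ : ℂ) ≠ 0 := by simp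
  have h1 : ∀ m : ℕ, x.fst m = 0 ∧ x.snd (m + 1) = 0 := by
    intro m
    have h2 := h (m + 1 : ℕ)
    have h3 := h (Int.negSucc m)
    rw [inner_eigenvec_succ, mul_eq_zero_iff_left hs] at h2
    rw [inner_eigenvec_negSucc, mul_eq_zero_iff_left hs] at h3
    have h4 : 2 * x.snd (m + 1) = 0 := by linear_combination h2 + h3
    have h5 : x.snd (m + 1) = 0 := by simpa using h4
    exact ⟨by simpa [h5] using h2, h5⟩
  refine hil_ext (fun m => (h1 m).1) fun n => ?_
  cases n with
  | zero =>
    have := h 0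
    rwa [inner_eigenvec_zero] at this
  | succ m => exact (h1 m).2

/-- The vectors `b_k` as a Hilbert basis. -/
def eigenbasis : HilbertBasis ℤ ℂ Hil :=
  HilbertBasis.mkOfOrthogonalEqBot orthonormal_eigenvec span_eigenvec_orthogonal

theorem coe_eigenbasis : ⇑eigenbasis = eigenvec :=
  HilbertBasis.coe_mkOfOrthogonalEqBot _ _

/-- The maximal domain of the diagonal operator is `dom N ⊕ dom N`: by the parallelogram law,
`|⟨b_k, x⟩|² + |⟨b_{-k}, x⟩|²` is the sum of the squares of the two entries of `x` that belong to
`e_{k-1} ⊕ 0` and `0 ⊕ e_k`, for `k > 0`. -/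
theorem mem_numberDomain_iff (x : Hil) : x ∈ numberDomain ↔
    Summable fun k : ℤ => (k : ℝ) ^ 2 * ‖⟪eigenbasis k, x⟫_ℂ‖ ^ 2 := by
  have hdom : x ∈ numberDomain ↔ x.fst ∈ number.domain ∧ x.snd ∈ number.domain := Iff.rfl
  have hs : ‖((Real.sqrt 2)⁻¹ : ℂ)‖ ^ 2 = 1 / 2 := by
    rw [norm_inv, Complex.norm_real, inv_pow, Real.norm_of_nonneg (Real.sqrt_nonneg 2),
      Real.sq_sqrt (by norm_num)]
    norm_num
  have hplus : ∀ m : ℕ, (((m + 1 : ℕ) : ℤ) : ℝ) ^ 2 * ‖⟪eigenbasis (m + 1 : ℕ), x⟫_ℂ‖ ^ 2 =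
      ((m : ℝ) + 1) ^ 2 * (1 / 2 * ‖x.fst m + x.snd (m + 1)‖ ^ 2) := fun m => by
    rw [coe_eigenbasis, inner_eigenvec_succ, norm_mul, mul_pow, hs]
    push_cast
    ring
  have hminus : ∀ m : ℕ, (((Int.negSucc m : ℤ)) : ℝ) ^ 2 *
      ‖⟪eigenbasis (Int.negSucc m), x⟫_ℂ‖ ^ 2 =
      ((m : ℝ) + 1) ^ 2 * (1 / 2 * ‖-x.fst m + x.snd (m + 1)‖ ^ 2) := fun m => by
    rw [coe_eigenbasis, inner_eigenvec_negSucc, norm_mul, mul_pow, hs]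
    push_cast
    ring
  have hpar : ∀ m : ℕ, ‖x.fst m + x.snd (m + 1)‖ ^ 2 + ‖-x.fst m + x.snd (m + 1)‖ ^ 2 =
      2 * (‖x.fst m‖ ^ 2 + ‖x.snd (m + 1)‖ ^ 2) := fun m => by
    have h := parallelogram_law_with_norm ℂ (x.snd (m + 1)) (x.fst m)
    rw [add_comm (x.fst m), neg_add_eq_sub]
    linarith
  rw [hdom]
  constructor
  · rintro ⟨h1, h2⟩
    have h3 := (mem_number_iff _).1 (S_mem_number h1)
    rw [← summable_nat_add_iff 1] at h3
    have h4 := (mem_number_iff _).1 h2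
    rw [← summable_nat_add_iff 1] at h4
    have h5 := h3.add h4
    have h6 : ∀ m : ℕ, ((m + 1 : ℕ) : ℝ) ^ 2 * ‖(S x.fst) (m + 1)‖ ^ 2 +
        ((m + 1 : ℕ) : ℝ) ^ 2 * ‖x.snd (m + 1)‖ ^ 2 =
        ((m : ℝ) + 1) ^ 2 * (1 / 2 * (‖x.fst m + x.snd (m + 1)‖ ^ 2 +
          ‖-x.fst m + x.snd (m + 1)‖ ^ 2)) := fun m => by
      rw [S_apply_succ, hpar]
      push_cast
      ring
    simp only [h6] at h5
    refine Summable.of_nat_of_neg_add_one ?_ ?_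
    · rw [← summable_nat_add_iff 1]
      refine Summable.of_nonneg_of_le (fun m => by positivity) (fun m => ?_) h5
      rw [hplus]
      gcongr
      linarith [sq_nonneg ‖-x.fst m + x.snd (m + 1)‖]
    · refine Summable.of_nonneg_of_le (fun m => by positivity) (fun m => ?_) h5
      have : -((m : ℤ) + 1) = Int.negSucc m := rfl
      rw [this, hminus]
      gcongr
      linarith [sq_nonneg ‖x.fst m + x.snd (m + 1)‖]
  · intro h
    have h1 : Summable fun m : ℕ => ((m : ℝ) + 1) ^ 2 * (1 / 2 * ‖x.fst m + x.snd (m + 1)‖ ^ 2) :=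
      (h.comp_injective (i := fun m : ℕ => ((m + 1 : ℕ) : ℤ)) fun a b hab => by
        simpa using hab).congr hplus
    have h2 : Summable fun m : ℕ => ((m : ℝ) + 1) ^ 2 * (1 / 2 * ‖-x.fst m + x.snd (m + 1)‖ ^ 2) :=
      (h.comp_injective (i := fun m : ℕ => Int.negSucc m) fun a b hab => by
        simpa using hab).congr hminus
    have h3 : Summable fun m : ℕ => ((m : ℝ) + 1) ^ 2 * (‖x.fst m‖ ^ 2 + ‖x.snd (m + 1)‖ ^ 2) := by
      refine (h1.add h2).congr fun m => ?_
      rw [← mul_add, ← mul_add, hpar]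
      ring
    rw [mem_number_iff, mem_number_iff]
    constructor
    · refine Summable.of_nonneg_of_le (fun m => by positivity) (fun m => ?_) h3
      gcongr
      · linarith
      · linarith [sq_nonneg ‖x.snd (m + 1)‖]
    · rw [← summable_nat_add_iff 1]
      refine Summable.of_nonneg_of_le (fun m => by positivity) (fun m => ?_) h3
      push_cast
      gcongr
      linarith [sq_nonneg ‖x.fst m‖]

theorem dirac_fst (x : dirac.domain) (m : ℕ) :
    (dirac x).fst m = ((m : ℂ) + 1) * (x : Hil).snd (m + 1) := by
  change (Sadj (number ⟨(x : Hil).snd, x.2.2⟩)) m = _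
  rw [Sadj_apply, number_apply]
  push_cast
  rfl

theorem dirac_snd_zero (x : dirac.domain) : (dirac x).snd 0 = 0 := by
  change (number ⟨S (x : Hil).fst, S_mem_number x.2.1⟩) 0 = _
  rw [number_apply]
  simp

theorem dirac_snd_succ (x : dirac.domain) (m : ℕ) :
    (dirac x).snd (m + 1) = ((m : ℂ) + 1) * (x : Hil).fst m := by
  change (number ⟨S (x : Hil).fst, S_mem_number x.2.1⟩) (m + 1) = _
  rw [number_apply, S_apply_succ]
  push_cast
  rfl

theorem absDirac_fst (x : absDirac.domain) (m : ℕ) :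
    (absDirac x).fst m = ((m : ℂ) + 1) * (x : Hil).fst m := by
  change (number ⟨(x : Hil).fst, x.2.1⟩) m + (x : Hil).fst m = _
  rw [number_apply, add_mul, one_mul]

theorem absDirac_snd (x : absDirac.domain) (m : ℕ) :
    (absDirac x).snd m = (m : ℂ) * (x : Hil).snd m := rfl

theorem isDiagonal_dirac : IsDiagonal dirac eigenbasis fun k => (k : ℝ) where
  mem_iff := mem_numberDomain_iff
  inner_apply x k := by
    rw [coe_eigenbasis]
    induction k using int_cases with
    | h0 => rw [inner_eigenvec_zero, dirac_snd_zero]; simp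
    | hp m =>
      rw [inner_eigenvec_succ, inner_eigenvec_succ, dirac_fst, dirac_snd_succ]
      push_cast
      ring
    | hn m =>
      rw [inner_eigenvec_negSucc, inner_eigenvec_negSucc, dirac_fst, dirac_snd_succ]
      push_cast
      ring

theorem isDiagonal_absDirac : IsDiagonal absDirac eigenbasis fun k => |(k : ℝ)| where
  mem_iff x := by
    simp only [sq_abs]
    exact mem_numberDomain_iff x
  inner_apply x k := by
    rw [coe_eigenbasis]
    induction k using int_cases with
    | h0 => rw [inner_eigenvec_zero, absDirac_snd]; simp
    | hp m =>
      have h : |(((m + 1 : ℕ) : ℤ) : ℝ)| = m + 1 := by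
        rw [abs_of_nonneg (by positivity)]
        push_cast
        ring
      rw [inner_eigenvec_succ, inner_eigenvec_succ, absDirac_fst, absDirac_snd, h]
      push_cast
      ring
    | hn m =>
      have h : |((Int.negSucc m : ℤ) : ℝ)| = m + 1 := by
        rw [Int.cast_negSucc, abs_neg, abs_of_nonneg (by positivity)]
        push_cast
        ring
      rw [inner_eigenvec_negSucc, inner_eigenvec_negSucc, absDirac_fst, absDirac_snd, h]
      push_cast
      ring

theorem tendsto_abs_int : Tendsto (fun k : ℤ => |(k : ℝ)|) cofinite atTop :=
  (tendsto_norm_cocompact_atTop (E := ℝ)).comp Int.tendsto_coe_cofinite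

/-! ### Summability -/

theorem summable_int_rpow {p : ℝ} (hp : 1 < p) :
    Summable fun k : ℤ => ((1 + |(k : ℝ)|)⁻¹) ^ p := by
  have h : Summable fun n : ℕ => ((1 + (n : ℝ))⁻¹) ^ p := by
    refine ((summable_nat_add_iff 1).2 (Real.summable_nat_rpow_inv.2 hp)).congr fun n => ?_
    rw [Real.inv_rpow (by positivity)]
    push_cast
    rw [add_comm]
  exact Summable.of_nat_of_neg (by simpa using h) (by simpa using h)

theorem not_summable_int_inv : ¬ Summable fun k : ℤ => (1 + |(k : ℝ)|)⁻¹ := by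
  intro h
  have h1 := h.comp_injective (i := fun n : ℕ => (n : ℤ)) Nat.cast_injective
  refine Real.not_summable_natCast_inv ((summable_nat_add_iff 1).1 (h1.congr fun n => ?_))
  simp [add_comm]

theorem isPlusSummable_dirac : IsPlusSummable dirac 1 := by
  have hne : ∀ k : ℤ, (1 : ℝ) ≤ 1 + |(k : ℝ)| := fun k => by linarith [abs_nonneg (k : ℝ)]
  obtain ⟨R, hR⟩ := isDiagonal_absDirac.isResolventAt (z := -1) one_pos fun k => by
    rw [sub_neg_eq_add]
    have : ((|(k : ℝ)| : ℝ) : ℂ) + 1 = ((1 + |(k : ℝ)| : ℝ) : ℂ) := by push_cast; ring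
    rw [this, Complex.norm_real, Real.norm_of_nonneg (by positivity)]
    exact hne k
  have hRd : ∀ x k, ⟪eigenbasis k, R x⟫_ℂ =
      (((1 + |(k : ℝ)|)⁻¹ : ℝ) : ℂ) * ⟪eigenbasis k, x⟫_ℂ := fun x k => by
    rw [(isDiagonal_absDirac.inner_resolvent hR k).2 x]
    push_cast
    rw [sub_neg_eq_add, add_comm]
  have h0 : ∀ k : ℤ, 0 ≤ (1 + |(k : ℝ)|)⁻¹ := fun k => by positivity
  have h1 : ∀ k : ℤ, (1 + |(k : ℝ)|)⁻¹ ≤ 1 := fun k => inv_le_one_of_one_le₀ (hne k)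
  exact ⟨absDirac, R, isDiagonal_dirac.isAbs isDiagonal_absDirac, hR,
    fun ε hε => isTraceClass_cfc_rpow_of_diagonal h0 h1 hRd (by positivity)
      (summable_int_rpow (by linarith)),
    fun h => not_summable_int_inv (summable_of_isTraceClass_diagonal h0 h1 hRd h)⟩

/-! ### Commutators with the Dirac operator and its absolute value -/

theorem number_eq_of_hasCommutator {a d : Ell2 →L[ℂ] Ell2} (h : HasCommutator number a d)
    (v : number.domain) : ∃ hv : a v ∈ number.domain, number ⟨a v, hv⟩ = a (number v) + d v := by
  obtain ⟨hv, h2⟩ := h v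
  exact ⟨hv, by rw [← h2, add_sub_cancel]⟩

theorem vec_ext_sub (a b c d : Ell2) : vec a b - vec c d = vec (a - c) (b - d) := rfl

/-- `[|D|, ·]` on block matrices. The terms `b` and `-c` come from `|D| = diag(N + 1, N)`. -/
theorem hasCommutator_absDirac {a b c d a' b' c' d' : Ell2 →L[ℂ] Ell2}
    (ha : HasCommutator number a a') (hb : HasCommutator number b b')
    (hc : HasCommutator number c c') (hd : HasCommutator number d d') :
    HasCommutator absDirac (block a b c d) (block a' (b' + b) (c' - c) d') := by
  intro v
  obtain ⟨ha1, ha2⟩ := number_eq_of_hasCommutator ha ⟨(v : Hil).fst, v.2.1⟩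
  obtain ⟨hb1, hb2⟩ := number_eq_of_hasCommutator hb ⟨(v : Hil).snd, v.2.2⟩
  obtain ⟨hc1, hc2⟩ := number_eq_of_hasCommutator hc ⟨(v : Hil).fst, v.2.1⟩
  obtain ⟨hd1, hd2⟩ := number_eq_of_hasCommutator hd ⟨(v : Hil).snd, v.2.2⟩
  refine ⟨⟨number.domain.add_mem ha1 hb1, number.domain.add_mem hc1 hd1⟩, ?_⟩
  have h1 := number.map_add ⟨_, ha1⟩ ⟨_, hb1⟩
  have h2 := number.map_add ⟨_, hc1⟩ ⟨_, hd1⟩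
  rw [ha2, hb2] at h1
  rw [hc2, hd2] at h2
  have h3 : absDirac ⟨block a b c d v, number.domain.add_mem ha1 hb1,
      number.domain.add_mem hc1 hd1⟩ = vec (number (⟨_, ha1⟩ + ⟨_, hb1⟩) +
        (a (v : Hil).fst + b (v : Hil).snd)) (number (⟨_, hc1⟩ + ⟨_, hd1⟩)) := rfl
  have h4 : absDirac v = vec (number ⟨(v : Hil).fst, v.2.1⟩ + (v : Hil).fst)
      (number ⟨(v : Hil).snd, v.2.2⟩) := rfl
  have h5 : ∀ p q : Ell2, block a b c d (vec p q) = vec (a p + b q) (c p + d q) :=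
    fun p q => rfl
  rw [h3, h4, h1, h2, h5, vec_ext_sub, block_apply]
  congr 1
  · simp only [map_add, add_apply]
    abel
  · simp only [map_add, sub_apply]
    abel

/-- Block matrices of smooth Toeplitz operators are smooth for `[|D|, ·]`, because `[N, ·]`
preserves the algebra of the entries. -/
theorem inDomDelta_block (n : ℕ) : ∀ {a b c d : Ell2 →L[ℂ] Ell2}, a ∈ smoothToeplitz ⊤ →
    b ∈ smoothToeplitz ⊤ → c ∈ smoothToeplitz ⊤ → d ∈ smoothToeplitz ⊤ →
    InDomDelta absDirac n (block a b c d) := by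
  induction n with
  | zero => exact fun _ _ _ _ => trivial
  | succ n ih =>
    intro a b c d ha hb hc hd
    obtain ⟨a', ha', hac⟩ := exists_hasCommutator_number ha
    obtain ⟨b', hb', hbc⟩ := exists_hasCommutator_number hb
    obtain ⟨c', hc', hcc⟩ := exists_hasCommutator_number hc
    obtain ⟨d', hd', hdc⟩ := exists_hasCommutator_number hd
    exact ⟨_, hasCommutator_absDirac hac hbc hcc hdc,
      ih ha' (add_mem hb' hb) (sub_mem hc' hc) hd'⟩

/-- `[D, π a]` is off-diagonal with the entries `[S*, a] N + S* [N, a]` and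
`[S, a] N + [N, S a] - a [N, S]`. Since `[S*, a]` and `[S, a]` decay rapidly, their products with `N`
are bounded. -/
theorem exists_hasCommutator_dirac {a : Ell2 →L[ℂ] Ell2} (ha : a ∈ smoothToeplitz ⊤) :
    ∃ b ∈ smoothToeplitz ⊤, ∃ c ∈ smoothToeplitz ⊤,
      HasCommutator dirac (block a 0 0 a) (block 0 b c 0) := by
  obtain ⟨δ, hδ, hδc⟩ := exists_hasCommutator_number ha
  obtain ⟨δ₁, hδ₁, hδ₁c⟩ := exists_hasCommutator_number (mul_mem S_mem ha)
  obtain ⟨δ₂, hδ₂, hδ₂c⟩ := exists_hasCommutator_number S_mem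
  obtain ⟨k₁, hk₁, hk₁n⟩ := (rapid_commutator Sadj_mem ha).exists_mul_number
  obtain ⟨k₂, hk₂, hk₂n⟩ := (rapid_commutator S_mem ha).exists_mul_number
  refine ⟨k₁ + Sadj * δ, add_mem (rapid_mem_smoothToeplitz hk₁) (mul_mem Sadj_mem hδ),
    k₂ + (δ₁ - a * δ₂), add_mem (rapid_mem_smoothToeplitz hk₂)
      (sub_mem hδ₁ (mul_mem ha hδ₂)), fun v => ?_⟩
  obtain ⟨hf, -⟩ := number_eq_of_hasCommutator hδc ⟨(v : Hil).fst, v.2.1⟩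
  obtain ⟨hs, hs2⟩ := number_eq_of_hasCommutator hδc ⟨(v : Hil).snd, v.2.2⟩
  obtain ⟨h1, h12⟩ := number_eq_of_hasCommutator hδ₁c ⟨(v : Hil).fst, v.2.1⟩
  obtain ⟨h2, h22⟩ := number_eq_of_hasCommutator hδ₂c ⟨(v : Hil).fst, v.2.1⟩
  have hx : block a 0 0 a v = vec (a (v : Hil).fst) (a (v : Hil).snd) := by
    simp [block_apply]
  have hmem : vec (a (v : Hil).fst) (a (v : Hil).snd) ∈ dirac.domain := ⟨hf, hs⟩
  have h3 : dirac ⟨vec (a (v : Hil).fst) (a (v : Hil).snd), hmem⟩ =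
      vec (Sadj (number ⟨a (v : Hil).snd, hs⟩)) (number ⟨(S * a) (v : Hil).fst, h1⟩) := rfl
  have h4 : dirac v = vec (Sadj (number ⟨(v : Hil).snd, v.2.2⟩))
      (number ⟨S (v : Hil).fst, h2⟩) := rfl
  have h5 : ∀ p q : Ell2, block a 0 0 a (vec p q) = vec (a p) (a q) := fun p q => by
    simp [block_apply, vec]
  simp only [hx]
  refine ⟨hmem, ?_⟩
  have e1 := hk₁n ⟨(v : Hil).snd, v.2.2⟩
  have e2 := hk₂n ⟨(v : Hil).fst, v.2.1⟩
  rw [sub_apply, mul_apply_eq_comp,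
    mul_apply_eq_comp] at e1 e2
  rw [h3, h4, h5, h12, h22, hs2, vec_ext_sub, block_apply]
  simp only [add_apply, sub_apply,
    mul_apply_eq_comp, zero_apply, zero_add, add_zero,
    map_add, ← e1, ← e2]
  congr 1 <;> abel

theorem mem_smoothToeplitz_top {g : ℕ} (a : smoothAlgebra g) :
    (a : Ell2 →L[ℂ] Ell2) ∈ smoothToeplitz ⊤ :=
  smoothToeplitz_le_top _ ((smoothAlgebra_eq g).le a.2)

theorem isAbs_dirac : IsAbs dirac absDirac := isDiagonal_dirac.isAbs isDiagonal_absDirac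

theorem isRegular_rep (g : ℕ) : IsRegular (rep g) dirac := by
  refine ⟨absDirac, isAbs_dirac, fun a => ?_⟩
  have ha := mem_smoothToeplitz_top a
  obtain ⟨b, hb, c, hc, h⟩ := exists_hasCommutator_dirac ha
  exact ⟨fun n => inDomDelta_block n ha (zero_mem _) (zero_mem _) ha, _, h,
    fun n => inDomDelta_block n (zero_mem _) hb hc (zero_mem _)⟩

/-! ### The spectral triple -/

theorem block_mul (a b c d a' b' c' d' : Ell2 →L[ℂ] Ell2) :
    block a b c d * block a' b' c' d' =
      block (a * a' + b * c') (a * b' + b * d') (c * a' + d * c') (c * b' + d * d') := by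
  ext1 x
  rw [mul_apply_eq_comp, block_apply, block_apply, block_apply]
  change vec (a (a' x.fst + b' x.snd) + b (c' x.fst + d' x.snd))
    (c (a' x.fst + b' x.snd) + d (c' x.fst + d' x.snd)) = _
  simp only [map_add, add_apply, mul_apply_eq_comp]
  congr 1 <;> abel

theorem block_neg (a b c d : Ell2 →L[ℂ] Ell2) :
    -block a b c d = block (-a) (-b) (-c) (-d) := by
  ext1 x
  rw [neg_apply, block_apply, block_apply]
  simp only [neg_apply, ← neg_add]
  rfl

theorem block_sub (a b c d a' b' c' d' : Ell2 →L[ℂ] Ell2) :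
    block a b c d - block a' b' c' d' = block (a - a') (b - b') (c - c') (d - d') := by
  ext1 x
  rw [sub_apply, block_apply, block_apply, block_apply, vec_ext_sub]
  simp only [sub_apply]
  congr 1 <;> abel

theorem block_one : block 1 0 0 1 = 1 := map_one diagRep

theorem star_block (a b c d : Ell2 →L[ℂ] Ell2) :
    star (block a b c d) = block (star a) (star c) (star b) (star d) := by
  refine ((ContinuousLinearMap.eq_adjoint_iff _ _).2 fun x y => ?_).symm
  simp only [block_apply, inner_vec, ContinuousLinearMap.star_eq_adjoint, inner_add_left,
    ContinuousLinearMap.adjoint_inner_left]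
  have h := WithLp.prod_inner_apply (𝕜 := ℂ) x
    (vec (a y.fst + b y.snd) (c y.fst + d y.snd))
  refine Eq.trans ?_ h.symm
  change _ = ⟪x.fst, a y.fst + b y.snd⟫_ℂ + ⟪x.snd, c y.fst + d y.snd⟫_ℂ
  rw [inner_add_right, inner_add_right]
  ring

theorem isSelfAdjoint_grading : IsSelfAdjoint grading := by
  rw [IsSelfAdjoint, grading, star_block]
  simp

theorem grading_mul_self : grading * grading = 1 := by
  rw [grading, block_mul, ← block_one]
  simp

theorem grading_mul_diag (a : Ell2 →L[ℂ] Ell2) :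
    grading * block a 0 0 a = block a 0 0 a * grading := by
  rw [grading, block_mul, block_mul]
  simp

theorem dense_smoothAlgebra (g : ℕ) :
    (surface g : Set (Ell2 →L[ℂ] Ell2)) ⊆ closure (smoothAlgebra g : Set (Ell2 →L[ℂ] Ell2)) := by
  rw [smoothAlgebra_eq]
  exact surface_subset_closure (boundaryAlgebra_subset_closure g)

theorem isEvenSpectralTriple_dirac (g : ℕ) :
    IsEvenSpectralTriple (surface g) (smoothAlgebra g) (rep g) dirac grading where
  isClosed := isClosed_surface g
  le := by
    rw [smoothAlgebra_eq]
    exact smoothToeplitz_le_surface g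
  dense := dense_smoothAlgebra g
  stable := by
    rw [smoothAlgebra_eq]
    exact isHolomorphicallyStable_smoothToeplitz g
  faithful a b hab := by
    refine Subtype.ext (ContinuousLinearMap.ext fun v => ?_)
    have h : block (a : Ell2 →L[ℂ] Ell2) 0 0 a (vec v 0) =
        block (b : Ell2 →L[ℂ] Ell2) 0 0 b (vec v 0) := congrArg (· (vec v 0)) hab
    have h2 := congrArg (fun x : Hil => x.fst) h
    simpa [block_apply, vec] using h2
  selfAdjoint := isDiagonal_dirac.isSelfAdjoint
  exists_resolvent := by
    refine ⟨Complex.I, isDiagonal_dirac.isResolventAt (δ := 1) one_pos fun k => ?_⟩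
    have h := Complex.abs_im_le_norm (((k : ℝ) : ℂ) - Complex.I)
    simpa using h
  compact_resolvent _ _ hR := isDiagonal_dirac.isCompactOperator_resolvent tendsto_abs_int hR
  grading_selfAdjoint := isSelfAdjoint_grading
  grading_sq := grading_mul_self
  grading_dirac v := by
    have hx : grading v = vec (v : Hil).fst (-(v : Hil).snd) := by
      simp [grading, block_apply]
    have hmem : vec (v : Hil).fst (-(v : Hil).snd) ∈ dirac.domain :=
      ⟨v.2.1, number.domain.neg_mem v.2.2⟩
    simp only [hx]
    refine ⟨hmem, ?_⟩
    have h1 : grading (dirac v) = vec (dirac v).fst (-(dirac v).snd) := by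
      simp [grading, block_apply]
    rw [h1]
    refine hil_ext (fun m => ?_) fun m => ?_
    · change (dirac v).fst m = -(dirac ⟨_, hmem⟩).fst m
      rw [dirac_fst, dirac_fst]
      change _ = -((m + 1 : ℂ) * -((v : Hil).snd (m + 1)))
      ring
    · change -(dirac v).snd m = -(dirac ⟨_, hmem⟩).snd m
      cases m with
      | zero => rw [dirac_snd_zero, dirac_snd_zero]
      | succ m =>
        rw [dirac_snd_succ, dirac_snd_succ]
        rfl
  grading_rep a := grading_mul_diag a
  commutator a := by
    obtain ⟨b, -, c, -, h⟩ := exists_hasCommutator_dirac (mem_smoothToeplitz_top a)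
    exact ⟨_, h⟩

/-! ### The phase of the Dirac operator -/

theorem phase_fst (x : Hil) (m : ℕ) : (phase x).fst m = x.snd (m + 1) := by
  rw [← Sadj_apply]
  simp [phase, block_apply, vec]

theorem phase_snd (x : Hil) : (phase x).snd = S x.fst := by
  simp [phase, block_apply, vec]

theorem isPolarDecomposition_phase : IsPolarDecomposition dirac phase absDirac where
  isAbs := isAbs_dirac
  eq_comp v hP hD := by
    refine hil_ext (fun m => ?_) fun m => ?_
    · rw [dirac_fst, phase_fst, absDirac_snd]
      push_cast
      rfl
    · rw [phase_snd]
      cases m with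
      | zero => rw [dirac_snd_zero, S_apply_zero]
      | succ m => rw [dirac_snd_succ, S_apply_succ, absDirac_fst]
  ker_eq v := by
    have hne : ∀ m : ℕ, (m : ℂ) + 1 ≠ 0 := fun m => Nat.cast_add_one_ne_zero m
    constructor
    · intro h
      have h1 : ∀ m, v.fst m = 0 := fun m => by
        rw [← S_apply_succ, ← phase_snd, h]
        rfl
      have h2 : ∀ m, v.snd (m + 1) = 0 := fun m => by
        rw [← phase_fst, h]
        rfl
      have hv : v = (v.snd 0) • eigenvec 0 := by
        refine hil_ext (fun m => ?_) fun m => ?_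
        · rw [h1]
          exact (mul_zero _).symm
        · change _ = v.snd 0 * (eigenvec 0).snd m
          rw [eigenvec_zero_snd]
          cases m with
          | zero => simp
          | succ m => simp [h2]
      have hmem : v ∈ dirac.domain := by
        rw [hv, ← coe_eigenbasis]
        exact dirac.domain.smul_mem _ (isDiagonal_dirac.basis_mem 0)
      refine ⟨hmem, hil_ext (fun m => ?_) fun m => ?_⟩
      · rw [dirac_fst, h2, mul_zero]
        rfl
      · cases m with
        | zero => exact dirac_snd_zero _
        | succ m =>
          rw [dirac_snd_succ, h1, mul_zero]
          rfl
    · rintro ⟨hv, h⟩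
      refine hil_ext (fun m => ?_) fun m => ?_
      · have h1 := dirac_fst ⟨v, hv⟩ m
        rw [h] at h1
        rw [phase_fst]
        exact (mul_eq_zero.1 h1.symm).resolve_left (hne m)
      · rw [phase_snd]
        cases m with
        | zero => exact S_apply_zero _
        | succ m =>
          have h1 := dirac_snd_succ ⟨v, hv⟩ m
          rw [h] at h1
          rw [S_apply_succ]
          exact (mul_eq_zero.1 h1.symm).resolve_left (hne m)

theorem isCompactOperator_block {a b c d : Ell2 →L[ℂ] Ell2} (ha : IsCompactOperator a)
    (hb : IsCompactOperator b) (hc : IsCompactOperator c) (hd : IsCompactOperator d) :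
    IsCompactOperator (block a b c d) := by
  have h1 := ((ha.comp_clm (WithLp.fstL 2 ℂ Ell2 Ell2)).add
    (hb.comp_clm (WithLp.sndL 2 ℂ Ell2 Ell2))).clm_comp
      (((WithLp.prodContinuousLinearEquiv 2 ℂ Ell2 Ell2).symm : (Ell2 × Ell2) →L[ℂ] Hil).comp
        (ContinuousLinearMap.inl ℂ Ell2 Ell2))
  have h2 := ((hc.comp_clm (WithLp.fstL 2 ℂ Ell2 Ell2)).add
    (hd.comp_clm (WithLp.sndL 2 ℂ Ell2 Ell2))).clm_comp
      (((WithLp.prodContinuousLinearEquiv 2 ℂ Ell2 Ell2).symm : (Ell2 × Ell2) →L[ℂ] Hil).comp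
        (ContinuousLinearMap.inr ℂ Ell2 Ell2))
  refine (congrArg IsCompactOperator (funext fun x => ?_)).mp (h1.add h2)
  change vec _ _ + vec _ _ = vec _ _
  refine congrArg₂ vec ?_ ?_
  · exact add_zero _
  · exact zero_add _

theorem Sadj_mul_S : Sadj * S = 1 := by
  ext x n
  rw [mul_apply_eq_comp, Sadj_apply, S_apply_succ]
  rfl

/-- `F² - 1` vanishes on `H₊` and is the commutator `[S, S*]` on `H₋`. -/
theorem isEvenFredholmModule_phase (g : ℕ) : IsEvenFredholmModule (rep g) phase grading where
  grading_selfAdjoint := isSelfAdjoint_grading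
  grading_sq := grading_mul_self
  grading_rep a := grading_mul_diag a
  odd := by
    rw [grading, phase, block_mul, block_mul, block_neg]
    simp
  selfAdjoint := by
    have h1 : star S = Sadj := rfl
    have h2 : star Sadj = S := by rw [← h1, star_star]
    have h : star phase - phase = 0 := by
      rw [phase, star_block, h1, h2, star_zero, sub_self]
    rw [h]
    exact isCompactOperator_zero
  sq := by
    have h : phase * phase - 1 = block 0 0 0 (S * Sadj - Sadj * S) := by
      rw [phase, block_mul, ← block_one, block_sub, Sadj_mul_S]
      simp
    rw [h]
    exact isCompactOperator_block isCompactOperator_zero isCompactOperator_zero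
      isCompactOperator_zero (rapid_commutator S_mem Sadj_mem).isCompactOperator
  commutator a := by
    have ha := mem_smoothToeplitz_top a
    have h : phase * rep g a - rep g a * phase =
        block 0 (Sadj * (a : Ell2 →L[ℂ] Ell2) - a * Sadj) (S * (a : Ell2 →L[ℂ] Ell2) - a * S) 0 := by
      change phase * block a 0 0 a - block a 0 0 a * phase = _
      rw [phase, block_mul, block_mul, block_sub]
      simp
    rw [h]
    exact isCompactOperator_block isCompactOperator_zero
      (rapid_commutator Sadj_mem ha).isCompactOperator
      (rapid_commutator S_mem ha).isCompactOperator isCompactOperator_zero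

/-! ### The index -/

/-- A surjection `X → Y` with one-dimensional kernel has index one. -/
theorem index_eq_one_of_surjective {E : Type*} [AddCommGroup E] [Module ℂ E] {T : E →ₗ[ℂ] E}
    {X Y : Submodule ℂ E} {v : E} (hmaps : ∀ x ∈ X, T x ∈ Y) (hsurj : ∀ y ∈ Y, ∃ x ∈ X, T x = y)
    (hv : v ≠ 0) (hvX : v ∈ X) (hTv : T v = 0) (hker : ∀ x ∈ X, T x = 0 → ∃ c : ℂ, c • v = x) :
    IsFredholmBetween T X Y ∧ indexBetween T X Y = 1 := by
  have h1 : X ⊓ LinearMap.ker T = Submodule.span ℂ {v} := by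
    apply le_antisymm
    · rintro x ⟨hx, hx0⟩
      exact Submodule.mem_span_singleton.2 (hker x hx hx0)
    · rw [Submodule.span_singleton_le_iff_mem]
      exact ⟨hvX, hTv⟩
  have h2 : (X.map T).submoduleOf Y = ⊤ := by
    refine eq_top_iff.2 fun y _ => ?_
    obtain ⟨x, hx, hxy⟩ := hsurj y y.2
    exact ⟨x, hx, hxy⟩
  have h3 : Subsingleton (Y ⧸ (X.map T).submoduleOf Y) :=
    Submodule.Quotient.subsingleton_iff.2 h2
  refine ⟨⟨hmaps, ?_, inferInstance⟩, ?_⟩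
  · rw [h1]
    infer_instance
  · rw [indexBetween, h1, finrank_span_singleton hv, Module.finrank_zero_of_subsingleton]
    rfl

theorem mem_gradedPart_neg {x : Hil} : x ∈ gradedPart grading (-1) ↔ x.fst = 0 := by
  have h1 : grading x = vec x.fst (-x.snd) := by simp [grading, block_apply]
  rw [gradedPart, Module.End.mem_eigenspace_iff]
  change grading x = (-1 : ℂ) • x ↔ _
  rw [h1, neg_one_smul]
  constructor
  · intro h
    have h2 : x.fst = -x.fst := congrArg (fun y : Hil => y.fst) h
    exact lp.ext (funext fun m => self_eq_neg.1 (congrArg (fun y : Ell2 => y m) h2))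
  · intro h
    refine hil_ext (fun m => ?_) fun m => rfl
    change x.fst m = -x.fst m
    rw [h]
    exact neg_zero.symm

theorem mem_gradedPart_one {x : Hil} : x ∈ gradedPart grading 1 ↔ x.snd = 0 := by
  have h1 : grading x = vec x.fst (-x.snd) := by simp [grading, block_apply]
  rw [gradedPart, Module.End.mem_eigenspace_iff]
  change grading x = (1 : ℂ) • x ↔ _
  rw [h1, one_smul]
  constructor
  · intro h
    have h2 : -x.snd = x.snd := congrArg (fun y : Hil => y.snd) h
    exact lp.ext (funext fun m => neg_eq_self.1 (congrArg (fun y : Ell2 => y m) h2))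
  · intro h
    refine hil_ext (fun m => rfl) fun m => ?_
    change -x.snd m = x.snd m
    rw [h]
    exact neg_zero

theorem phase_mem_gradedPart {x : Hil} (hx : x ∈ gradedPart grading (-1)) :
    phase x ∈ gradedPart grading 1 := by
  rw [mem_gradedPart_neg] at hx
  rw [mem_gradedPart_one, phase_snd, hx, map_zero]

theorem exists_phase_eq {y : Hil} (hy : y ∈ gradedPart grading 1) :
    ∃ x ∈ gradedPart grading (-1), phase x = y := by
  rw [mem_gradedPart_one] at hy
  refine ⟨vec 0 (S y.fst), mem_gradedPart_neg.2 rfl, hil_ext (fun m => ?_) fun m => ?_⟩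
  · rw [phase_fst]
    exact S_apply_succ _ _
  · rw [phase_snd, hy]
    change (S 0) m = _
    rw [map_zero]

theorem eigenvec_zero_mem : eigenvec 0 ∈ gradedPart grading (-1) := mem_gradedPart_neg.2 rfl

theorem eigenvec_zero_ne : eigenvec 0 ≠ 0 := orthonormal_eigenvec.ne_zero 0

theorem phase_eigenvec_zero : phase (eigenvec 0) = 0 := by
  refine hil_ext (fun m => ?_) fun m => ?_
  · rw [phase_fst, eigenvec_zero_snd, if_neg (Nat.succ_ne_zero m)]
    rfl
  · rw [phase_snd]
    change (S 0) m = _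
    rw [map_zero]
    rfl

theorem exists_smul_eigenvec_zero {x : Hil} (h0 : x ∈ gradedPart grading (-1))
    (hx : phase x = 0) : ∃ c : ℂ, c • eigenvec 0 = x := by
  refine ⟨x.snd 0, hil_ext (fun m => ?_) fun m => ?_⟩
  · rw [mem_gradedPart_neg.1 h0]
    exact mul_zero _
  · change x.snd 0 * (eigenvec 0).snd m = x.snd m
    rw [eigenvec_zero_snd]
    cases m with
    | zero => simp
    | succ m =>
      rw [← phase_fst, hx, if_neg (Nat.succ_ne_zero m), mul_zero]
      rfl

theorem index_phase :
    IsFredholmBetween (phase : Hil →ₗ[ℂ] Hil) (gradedPart grading (-1)) (gradedPart grading 1) ∧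
    indexBetween (phase : Hil →ₗ[ℂ] Hil) (gradedPart grading (-1)) (gradedPart grading 1) = 1 :=
  index_eq_one_of_surjective (fun _ => phase_mem_gradedPart) (fun _ => exists_phase_eq)
    eigenvec_zero_ne eigenvec_zero_mem phase_eigenvec_zero fun _ => exists_smul_eigenvec_zero

theorem Sadj_surjective : Function.Surjective Sadj := fun y =>
  ⟨S y, by rw [← mul_apply_eq_comp, Sadj_mul_S]; rfl⟩

theorem Sadj_e_zero : Sadj (e 0) = 0 := by
  ext n
  rw [Sadj_apply, e_apply, if_neg (Nat.succ_ne_zero n)]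
  rfl

theorem index_Sadj : IsFredholmBetween (Sadj : Ell2 →ₗ[ℂ] Ell2) ⊤ ⊤ ∧
    indexBetween (Sadj : Ell2 →ₗ[ℂ] Ell2) ⊤ ⊤ = 1 := by
  refine index_eq_one_of_surjective (v := e 0) (fun _ _ => trivial)
    (fun y _ => (Sadj_surjective y).imp fun _ h => ⟨trivial, h⟩) (orthonormal_e.ne_zero 0)
    trivial Sadj_e_zero fun x _ hx => ⟨x 0, ?_⟩
  have hx' : Sadj x = 0 := hx
  ext m
  change x 0 * (e 0) m = x m
  rw [e_apply]
  cases m with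
  | zero => simp
  | succ m =>
    rw [← Sadj_apply, hx', if_neg (Nat.succ_ne_zero m), mul_zero]
    rfl

theorem isFredholm_Sadj : Sadj.IsFredholm := by
  have hfin : FiniteDimensional ℂ (LinearMap.ker (Sadj : Ell2 →ₗ[ℂ] Ell2)) := by
    have h := index_Sadj.1.finite_ker
    rwa [top_inf_eq] at h
  have hrange : Sadj.range = ⊤ := LinearMap.range_eq_top.2 Sadj_surjective
  refine ⟨(Sadj.isOpenMap Sadj_surjective).isQuotientMap Sadj.continuous Sadj_surjective
    |>.isStrictMap, ?_, hfin, ?_, ?_⟩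
  · rw [hrange]
    exact isClosed_univ
  · rw [hrange]
    infer_instance
  · exact Submodule.ClosedComplemented.of_finiteDimensional _

theorem matrixOp_one {H : Type*} [NormedAddCommGroup H] [InnerProductSpace ℂ H] {n : ℕ} :
    matrixOp (1 : Matrix (Fin n) (Fin n) (H →L[ℂ] H)) = LinearMap.id := by
  refine LinearMap.ext fun w => funext fun i => ?_
  change (∑ j, ((((1 : Matrix (Fin n) (Fin n) (H →L[ℂ] H)) i j : H →L[ℂ] H) : H →ₗ[ℂ] H).comp
    (LinearMap.proj j))) w = w i
  rw [LinearMap.sum_apply, Finset.sum_eq_single i]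
  · rw [Matrix.one_apply_eq]
    rfl
  · intro j _ hj
    rw [Matrix.one_apply_ne hj.symm]
    rfl
  · simp

/-- The pairing of the fundamental class with the unit of the algebra is the index of `S*`. -/
theorem hasNontrivialFundamentalClass_dirac (g : ℕ) :
    HasNontrivialFundamentalClass (rep g) dirac grading := by
  refine ⟨phase, absDirac, isPolarDecomposition_phase, isEvenFredholmModule_phase g, 1, 1,
    one_mul 1, Matrix.conjTranspose_one, ?_⟩
  have h1 : (1 : Matrix (Fin 1) (Fin 1) (smoothAlgebra g)).map (rep g) = 1 :=
    Matrix.map_one _ (map_zero _) (map_one _)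
  have h2 : ∀ s (w : Fin 1 → Hil), w ∈ gradedRange grading s
      (1 : Matrix (Fin 1) (Fin 1) (Hil →L[ℂ] Hil)) ↔ w 0 ∈ gradedPart grading s := fun s w => by
    rw [gradedRange, matrixOp_one, Submodule.map_id, Submodule.mem_pi]
    simp
  have h3 : ∀ w : Fin 1 → Hil, compression phase (1 : Matrix (Fin 1) (Fin 1) (Hil →L[ℂ] Hil)) w =
      fun _ => phase (w 0) := fun w => by
    rw [compression, matrixOp_one]
    funext i
    fin_cases i
    simp [matrixOp]
  have key := index_eq_one_of_surjective
    (T := compression phase (1 : Matrix (Fin 1) (Fin 1) (Hil →L[ℂ] Hil)))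
    (X := gradedRange grading (-1) 1) (Y := gradedRange grading 1 1) (v := fun _ => eigenvec 0)
    (fun x hx => by
      rw [h3, h2]
      exact phase_mem_gradedPart ((h2 _ _).1 hx))
    (fun y hy => by
      obtain ⟨x, hx, hxy⟩ := exists_phase_eq ((h2 _ _).1 hy)
      refine ⟨fun _ => x, (h2 _ _).2 hx, ?_⟩
      rw [h3]
      funext i
      rw [hxy, Subsingleton.elim i 0])
    (fun h => eigenvec_zero_ne (congrFun h 0)) ((h2 _ _).2 eigenvec_zero_mem)
    (by
      rw [h3, phase_eigenvec_zero]
      rfl)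
    (fun x hx hx0 => by
      rw [h3] at hx0
      obtain ⟨c, hc⟩ := exists_smul_eigenvec_zero ((h2 _ _).1 hx) (congrFun hx0 0)
      refine ⟨c, ?_⟩
      funext i
      rw [Subsingleton.elim i 0]
      exact hc)
  rw [h1]
  exact ⟨key.1, by rw [key.2]; exact one_ne_zero⟩

end QuantumSurface

end

theorem mainTheorem1 (g : ℕ) :
    -- an even spectral triple for the noncommutative surface of genus `g`
    SpectralGeometry.IsEvenSpectralTriple (QuantumSurface.surface g)
      (QuantumSurface.smoothAlgebra g) (QuantumSurface.rep g) QuantumSurface.dirac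
      QuantumSurface.grading ∧
    -- summability and regularity
    SpectralGeometry.IsPlusSummable QuantumSurface.dirac 1 ∧
    SpectralGeometry.IsRegular (QuantumSurface.rep g) QuantumSurface.dirac ∧
    -- the spectrum, the multiplicities and the eigenbasis of the Dirac operator
    SpectralGeometry.opSpectrum QuantumSurface.dirac = Set.range (fun k : ℤ => (k : ℂ)) ∧
    (∀ k : ℤ, Module.finrank ℂ (SpectralGeometry.opEigenspace QuantumSurface.dirac k) = 1) ∧
    (∃ b : HilbertBasis ℤ ℂ QuantumSurface.Hil, ⇑b = QuantumSurface.eigenvec) ∧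
    (∀ k : ℤ, ∃ hk : QuantumSurface.eigenvec k ∈ QuantumSurface.dirac.domain,
      QuantumSurface.dirac ⟨QuantumSurface.eigenvec k, hk⟩ = (k : ℂ) • QuantumSurface.eigenvec k) ∧
    -- the fundamental class and its non-triviality
    SpectralGeometry.IsPolarDecomposition QuantumSurface.dirac QuantumSurface.phase
      QuantumSurface.absDirac ∧
    SpectralGeometry.IsEvenFredholmModule (QuantumSurface.rep g) QuantumSurface.phase
      QuantumSurface.grading ∧
    SpectralGeometry.IsFredholmBetween (QuantumSurface.phase : QuantumSurface.Hil →ₗ[ℂ] QuantumSurface.Hil)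
      (SpectralGeometry.gradedPart QuantumSurface.grading (-1))
      (SpectralGeometry.gradedPart QuantumSurface.grading 1) ∧
    SpectralGeometry.indexBetween (QuantumSurface.phase : QuantumSurface.Hil →ₗ[ℂ] QuantumSurface.Hil)
      (SpectralGeometry.gradedPart QuantumSurface.grading (-1))
      (SpectralGeometry.gradedPart QuantumSurface.grading 1) = 1 ∧
    QuantumSurface.Sadj.IsFredholm ∧
    SpectralGeometry.indexBetween (QuantumSurface.Sadj : QuantumSurface.Ell2 →ₗ[ℂ] QuantumSurface.Ell2)
      ⊤ ⊤ = 1 ∧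
    SpectralGeometry.HasNontrivialFundamentalClass (QuantumSurface.rep g) QuantumSurface.dirac
      QuantumSurface.grading := by
  open QuantumSurface in
  refine ⟨isEvenSpectralTriple_dirac g, isPlusSummable_dirac, isRegular_rep g, ?_, fun k => ?_,
    ⟨eigenbasis, coe_eigenbasis⟩, fun k => ?_, isPolarDecomposition_phase,
    isEvenFredholmModule_phase g, index_phase.1, index_phase.2, isFredholm_Sadj, index_Sadj.2,
    hasNontrivialFundamentalClass_dirac g⟩
  · rw [QuantumSurface.isDiagonal_dirac.opSpectrum_eq QuantumSurface.tendsto_abs_int]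
    simp
  · have h := QuantumSurface.isDiagonal_dirac.finrank_opEigenspace Int.cast_injective k
    simpa using h
  · rw [← QuantumSurface.coe_eigenbasis]
    refine ⟨QuantumSurface.isDiagonal_dirac.basis_mem k, ?_⟩
    rw [QuantumSurface.isDiagonal_dirac.apply_basis, Complex.ofReal_intCast]
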